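/- **Model.** Let $k\ge 1$ and let $V$ be a set of $n$ vertices (say $V=\{1,\dots,n\}$) partitioned into blocks $V_1,\dots,V_k$ with $|V_i|=n/k$. A random graph on $V$ has each pair of vertices as an edge independently, with probability $a/n$ if both ends are in the same block and $b/n$ otherwise. Colour each edge Red or Blue with probability $\frac12$ each, put each vertex into $Y$ or $Z$ with probability $\frac12$ each, and split $Y$ into $Y_1,Y_2$ by putting each vertex of $Y$ into $Y_1$ or $Y_2$ with probability $\frac12$ each, all choices being independent. Sets $U_1',\dots,U_k'\subset Z$ are *$\gamma$-correct* if for some permutation $\pi$ of $\{1,\dots,k\}$ we have $|V_{\pi(i)}\cap Z\cap U_i'|\ge(1-\gamma)|V_{\pi(i)}\cap Z|$ for all $i$. **Spectral Partition** (input: the Red bipartite $Z\times Y$ adjacency matrix, the Blue graph on $Z$, and $a,b,k$). 1. Let $A_1$ be the Red adjacency matrix with rows $Z$ and columns $Y_1$, and let $d=\frac{a+(k-1)b}{k}$. Zero out all rows and columns of $A_1$ whose sum is larger than $20d$, to obtain $A$. 2. Let $W$ be the span of $k$ orthonormal left singular vectors of $A$ for its $k$ largest singular values. 3. Choose $m=\lceil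 2\log n\rceil$ vertices $y_1,\dots,y_m$ independently and uniformly from $Y_2$. Let $\mathbf a_i\in\{0,1\}^Z$ be the Red column of $y_i$, and project $\mathbf a_i-\mathbf a$ orthogonally onto $W$, where $\mathbf a$ is the constant vector with entries $\frac{a+b}{2n}$. 4. For each projected vector let $X_i\subset Z$ be the set of its $\lfloor n/2k\rfloor$ largest coordinates (all of $Z$ if $|Z|$ is smaller), ties broken in favour of the smaller vertex. 5. Of the sets $X_1,\dots,X_m$ discard those with the lowest Blue edge density: at most half of the sets, and, subject to this, as many as possible such that among the remaining ones there are $k$ sets any two of which meet in fewer than $0.2\,n/2k$ vertices. Output any such $k$ sets $U_1',\dots,U_k'$. **Theorem.** There are absolute constants $C_1,C_2>0$ such that for every fixed integer $k\ge1$ and every fixed $\gamma\in(0,1]$ the following holds. If $n\ge a>b\ge C_1$ and $$\frac{(a-b)^2}{a}\ \ge\ C_2\,k^2\,\frac1\gamma ,$$ then with probability $1-o(1)$ as $n\to\infty$ through multiples of $k$, Spectral Partition has an output, and every possible output is a $\gamma$-correct partition $U_1',\dots,U_k'$ of $Z$. Here $o(1)$ depends only on $n$, $k$ and $\gamma$;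 it is uniform in $a,b$ (which may depend on $n$) and in the blocks. -/

import Mathlib

open MeasureTheory ProbabilityTheory
open scoped Finset Matrix ENNReal

noncomputable section

namespace SBM

/-! ### The random input -/

/-- The law of a coin with values in `Bool` that shows `true` with probability `p`
(`p` is truncated to `[0, 1]`). -/
def coin (p : ℝ) : Measure Bool :=
  bernoulliMeasure true false (Set.projIcc 0 1 zero_le_one p)

/-- The blocks `V_i = {v | β v = i}` have equal size `n / k`. -/
def EqualBlocks {n k : ℕ} (β : Fin n → Fin k) : Prop :=
  ∀ i : Fin k, k * #{v | β v = i} = n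

open Classical in
/-- The probability of an edge on the pair `e`: `a / n` if both ends lie in the same block, `b / n`
if they lie in different blocks. -/
def edgeProb {n k : ℕ} (β : Fin n → Fin k) (a b : ℝ) (e : Sym2 (Fin n)) : ℝ :=
  if ∀ u ∈ e, ∀ v ∈ e, β u = β v then a / n else b / n

/-- One outcome of all coins: is the pair an edge; is it coloured Red; does the vertex go
to `Z` (rather than `Y`); does the vertex, if it is in `Y`, go to `Y₁` (rather than `Y₂`).
The coins on the diagonal of `Sym2 (Fin n)` are never used. -/
abbrev Outcome (n : ℕ) : Type :=
  (Sym2 (Fin n) → Bool) × (Sym2 (Fin n) → Bool) × (Fin n → Bool) × (Fin n → Bool)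

/-- The joint law: all coins are independent, the edge coins follow the stochastic block model
and the other three kinds are fair. -/
def law {n k : ℕ} (β : Fin n → Fin k) (a b : ℝ) : Measure (Outcome n) :=
  (Measure.pi fun e : Sym2 (Fin n) => coin (edgeProb β a b e)).prod
    ((Measure.pi fun _ : Sym2 (Fin n) => coin (1 / 2)).prod
      ((Measure.pi fun _ : Fin n => coin (1 / 2)).prod
        (Measure.pi fun _ : Fin n => coin (1 / 2))))

namespace Outcome

variable {n : ℕ} (ω : Outcome n)

/-- The Red edges (the coins on loops are ignored by `fromEdgeSet`). -/
def red : SimpleGraph (Fin n) :=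
  SimpleGraph.fromEdgeSet {e | ω.1 e = true ∧ ω.2.1 e = true}

/-- The Blue edges. -/
def blue : SimpleGraph (Fin n) :=
  SimpleGraph.fromEdgeSet {e | ω.1 e = true ∧ ω.2.1 e = false}

def Z : Finset (Fin n) := {v | ω.2.2.1 v = true}

def Y₁ : Finset (Fin n) := {v | ω.2.2.1 v = false ∧ ω.2.2.2 v = true}

def Y₂ : Finset (Fin n) := {v | ω.2.2.1 v = false ∧ ω.2.2.2 v = false}

end Outcome

/-! ### The spectral procedure -/

open Classical in
/-- Bipartite adjacency matrix of `G` with rows indexed by `R` and columns indexed by `S`. -/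
def biadj {n : ℕ} (G : SimpleGraph (Fin n)) (R S : Finset (Fin n)) : Matrix R S ℝ :=
  Matrix.of fun x y => if G.Adj x y then 1 else 0

open Classical in
/-- Zero out all rows and columns whose sum (the degree of the vertex) exceeds `D`. -/
def trim {R S : Type*} [Fintype R] [Fintype S] (D : ℝ) (A : Matrix R S ℝ) : Matrix R S ℝ :=
  Matrix.of fun x y => if D < ∑ y', A x y' ∨ D < ∑ x', A x' y then 0 else A x y

/-- `W` is spanned by `k` orthonormal left singular vectors of `A` that belong to
the `k` largest singular values (counted with multiplicity). -/
def IsTopLeftSingularSpace {R S : Type*} [Fintype R] [Fintype S] [DecidableEq R] [DecidableEq S]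
    (k : ℕ) (A : Matrix R S ℝ) (W : Submodule ℝ (EuclideanSpace ℝ R)) : Prop :=
  ∃ (u : Fin k → EuclideanSpace ℝ R) (s : Fin k → ℝ),
    Orthonormal ℝ u ∧
    (∀ i, 0 ≤ s i ∧ Matrix.toEuclideanLin (A * Aᵀ) (u i) = (s i) ^ 2 • u i) ∧
    W = Submodule.span ℝ (Set.range u) ∧
    ∀ x ∈ Wᗮ, ∀ i, ‖Matrix.toEuclideanLin Aᵀ x‖ ≤ s i * ‖x‖

open Classical in
/-- The column of the vertex `y` in the bipartite adjacency matrix with rows `Z`, minus the constant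
vector `(a + b) / (2 n)`. -/
def centredColumn {n : ℕ} (G : SimpleGraph (Fin n)) (Z : Finset (Fin n)) (a b : ℝ) (y : Fin n) :
    EuclideanSpace ℝ Z :=
  WithLp.toLp 2 fun z : Z => (if G.Adj z y then 1 else 0) - (a + b) / (2 * (n : ℝ))

open Classical in
/-- The `r` elements of `Z` (all of `Z` if there are fewer) where `w` is largest, ties being broken
in favour of the smaller vertex. -/
def topCoords {n : ℕ} {Z : Finset (Fin n)} (r : ℕ) (w : EuclideanSpace ℝ Z) : Finset (Fin n) :=
  ({z : Z | #{z' : Z | w z < w z' ∨ (w z' = w z ∧ z' < z)} < r} : Finset Z).map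
    (Function.Embedding.subtype _)

open Classical in
/-- Edge density of `G` inside `X`: the proportion of the pairs in `X × X` that are adjacent. -/
def density {n : ℕ} (G : SimpleGraph (Fin n)) (X : Finset (Fin n)) : ℚ := G.edgeDensity X X

/-- `K` arises from the `m` indices by discarding at most half of them, those with the lowest
scores (ties are broken arbitrarily). -/
def IsKept {m : ℕ} (score : Fin m → ℚ) (K : Finset (Fin m)) : Prop :=
  m ≤ 2 * #K ∧ ∀ i ∈ K, ∀ j ∉ K, score j ≤ score i

/-- `f` picks `k` of the sets `X i`, `i ∈ K`, any two of which meet in fewer than `t` points. -/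
def IsSeparatedChoice {n m k : ℕ} (X : Fin m → Finset (Fin n)) (t : ℝ) (K : Finset (Fin m))
    (f : Fin k → Fin m) : Prop :=
  (∀ i, f i ∈ K) ∧ ∀ i j, i ≠ j → (#(X (f i) ∩ X (f j)) : ℝ) < t

/-- `U` is a possible result of the selection: among the sets `X i` discard as many of the lowest
scores as possible, but not more than half, such that `k` sets with pairwise small
intersections remain, and let `U` be any such `k` sets. -/
def IsSelection {n m k : ℕ} (X : Fin m → Finset (Fin n)) (score : Fin m → ℚ) (t : ℝ)
    (U : Fin k → Finset (Fin n)) : Prop :=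
  ∃ (K : Finset (Fin m)) (f : Fin k → Fin m),
    IsKept score K ∧ IsSeparatedChoice X t K f ∧ (∀ i, U i = X (f i)) ∧
    ∀ (K' : Finset (Fin m)) (f' : Fin k → Fin m),
      IsKept score K' → IsSeparatedChoice X t K' f' → #K ≤ #K'

/-- The number of sampled columns, `2 log n` rounded up. -/
def numSamples (n : ℕ) : ℕ := ⌈2 * Real.log n⌉₊

/-- The expected degree `(a + (k - 1) b) / k` of a vertex of the block model (up to `O(a / n)`). -/
def avgDegree (k : ℕ) (a b : ℝ) : ℝ := (a + (k - 1) * b) / k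

/-- `U` is a possible output of the spectral procedure on the outcome `ω` of the coins and the sampled
columns `c`. -/
def IsSpectralOutput {n : ℕ} (k : ℕ) (a b : ℝ) (ω : Outcome n) (c : Fin (numSamples n) → Fin n)
    (U : Fin k → Finset (Fin n)) : Prop :=
  ∃ W : Submodule ℝ (EuclideanSpace ℝ ω.Z),
    IsTopLeftSingularSpace k (trim (20 * avgDegree k a b) (biadj ω.red ω.Z ω.Y₁)) W ∧
    IsSelection
      (fun i => topCoords (n / (2 * k)) (W.starProjection (centredColumn ω.red ω.Z a b (c i))))
      (fun i => density ω.blue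
        (topCoords (n / (2 * k)) (W.starProjection (centredColumn ω.red ω.Z a b (c i)))))
      (0.2 * (n / (2 * k))) U

/-! ### Correctness and success probability -/

/-- Up to relabelling, each `U i` contains a `1 - γ` fraction of the block of `Z`
with the same label. -/
def IsCorrect {n k : ℕ} (γ : ℝ) (β : Fin n → Fin k) (Z : Finset (Fin n))
    (U : Fin k → Finset (Fin n)) : Prop :=
  ∃ π : Equiv.Perm (Fin k), ∀ i,
    (1 - γ) * (#{v ∈ Z | β v = π i} : ℝ) ≤ (#({v ∈ Z | β v = π i} ∩ U i) : ℝ)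

/-- The procedure has an output, and every possible output is `γ`-correct. -/
def Succeeds {n k : ℕ} (γ : ℝ) (β : Fin n → Fin k) (a b : ℝ) (ω : Outcome n)
    (c : Fin (numSamples n) → Fin n) : Prop :=
  (∃ U : Fin k → Finset (Fin n), IsSpectralOutput k a b ω c U) ∧
    ∀ U : Fin k → Finset (Fin n), IsSpectralOutput k a b ω c U → IsCorrect γ β ω.Z U

/-- The probability that the procedure succeeds, when, given the coins, the sampled columns are
independent and uniform in `Y₂` (if `Y₂` is empty this counts as a failure). -/
def successProb {n k : ℕ} (γ : ℝ) (β : Fin n → Fin k) (a b : ℝ) : ℝ≥0∞ :=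
  ∫⁻ ω, uniformOn {c : Fin (numSamples n) → Fin n | ∀ i, c i ∈ ω.Y₂}
    {c | Succeeds γ β a b ω c} ∂(law β a b)

end SBM

end

set_option linter.unusedSectionVars false

namespace SBM

/-! ### Expectations over finitely many independent coordinates -/

section ProductExpectation

variable {ι κ α : Type*} [Fintype ι] [DecidableEq ι] [Fintype κ]

/-- `w i` is a probability weight on the values of the coordinate `i`. -/
structure IsWeight (w : ι → κ → ℝ) : Prop where
  nonneg : ∀ i x, 0 ≤ w i x
  sum_eq : ∀ i, ∑ x, w i x = 1

/-- Expectation of `f` when the coordinates are independent with weights `w`. -/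
noncomputable def ex (w : ι → κ → ℝ) (f : (ι → κ) → ℝ) : ℝ := ∑ ω, (∏ i, w i (ω i)) * f ω

open Classical in
/-- Probability of `P` when the coordinates are independent with weights `w`. -/
noncomputable def pr (w : ι → κ → ℝ) (P : (ι → κ) → Prop) : ℝ := ex w fun ω => if P ω then 1 else 0

variable {w : ι → κ → ℝ}

theorem ex_prod_univ (w : ι → κ → ℝ) (g : ι → κ → ℝ) :
    ex w (fun ω => ∏ i, g i (ω i)) = ∏ i, ∑ x, w i x * g i x := by
  unfold ex
  rw [Finset.prod_univ_sum, Fintype.piFinset_univ]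
  exact Finset.sum_congr rfl fun ω _ => (Finset.prod_mul_distrib).symm

theorem ex_const (hw : IsWeight w) (c : ℝ) : ex w (fun _ => c) = c := by
  have h := ex_prod_univ w (fun _ _ => 1)
  simp only [Finset.prod_const_one, mul_one, hw.sum_eq] at h
  unfold ex at h ⊢
  rw [← Finset.sum_mul]
  simp only [mul_one] at h
  rw [h, one_mul]

theorem ex_prod (hw : IsWeight w) (s : Finset α) (φ : α → ι) (hφ : Set.InjOn φ s)
    (g : α → κ → ℝ) :
    ex w (fun ω => ∏ a ∈ s, g a (ω (φ a))) = ∏ a ∈ s, ∑ x, w (φ a) x * g a x := by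
  classical
  have h1 : ∀ ω : ι → κ, ∏ a ∈ s, g a (ω (φ a)) =
      ∏ i, (fun i x => ∏ a ∈ s with φ a = i, g a x) i (ω i) := by
    intro ω
    rw [← Finset.prod_fiberwise s φ]
    refine Finset.prod_congr rfl fun i _ => Finset.prod_congr rfl fun a ha => ?_
    rw [(Finset.mem_filter.1 ha).2]
  rw [funext h1, ex_prod_univ w (fun i x => ∏ a ∈ s with φ a = i, g a x), ← Finset.prod_fiberwise s φ (fun a => ∑ x, w (φ a) x * g a x)]
  refine Finset.prod_congr rfl fun i _ => ?_
  have hsub : #{a ∈ s | φ a = i} ≤ 1 := by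
    rw [Finset.card_le_one]
    intro a ha b hb
    simp only [Finset.mem_filter] at ha hb
    exact hφ ha.1 hb.1 (ha.2.trans hb.2.symm)
  rcases Nat.le_one_iff_eq_zero_or_eq_one.1 hsub |>.imp Finset.card_eq_zero.1
    Finset.card_eq_one.1 with h | ⟨a, h⟩
  · simp [h, hw.sum_eq]
  · have ha : φ a = i := by
      have : a ∈ ({a ∈ s | φ a = i} : Finset α) := by rw [h]; simp
      exact (Finset.mem_filter.1 this).2
    simp [h, ha]

theorem ex_mono (hw : IsWeight w) {f g : (ι → κ) → ℝ} (h : ∀ ω, f ω ≤ g ω) : ex w f ≤ ex w g :=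
  Finset.sum_le_sum fun ω _ =>
    mul_le_mul_of_nonneg_left (h ω) (Finset.prod_nonneg fun _ _ => hw.nonneg _ _)

theorem ex_nonneg (hw : IsWeight w) {f : (ι → κ) → ℝ} (h : ∀ ω, 0 ≤ f ω) : 0 ≤ ex w f :=
  Finset.sum_nonneg fun ω _ =>
    mul_nonneg (Finset.prod_nonneg fun _ _ => hw.nonneg _ _) (h ω)

theorem ex_add (f g : (ι → κ) → ℝ) : ex w (fun ω => f ω + g ω) = ex w f + ex w g := by
  simp only [ex, mul_add, Finset.sum_add_distrib]

theorem ex_sum (s : Finset α) (f : α → (ι → κ) → ℝ) :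
    ex w (fun ω => ∑ a ∈ s, f a ω) = ∑ a ∈ s, ex w (f a) := by
  simp only [ex, Finset.mul_sum]
  exact Finset.sum_comm

theorem ex_const_mul (c : ℝ) (f : (ι → κ) → ℝ) : ex w (fun ω => c * f ω) = c * ex w f := by
  simp only [ex, Finset.mul_sum]
  exact Finset.sum_congr rfl fun ω _ => by ring

theorem pr_mono (hw : IsWeight w) {P Q : (ι → κ) → Prop} (h : ∀ ω, P ω → Q ω) :
    pr w P ≤ pr w Q := by
  classical
  refine ex_mono hw fun ω => ?_
  by_cases hP : P ω
  · simp [hP, h ω hP]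
  · simp only [hP, if_false]; split_ifs <;> norm_num

theorem pr_or_le (hw : IsWeight w) (P Q : (ι → κ) → Prop) :
    pr w (fun ω => P ω ∨ Q ω) ≤ pr w P + pr w Q := by
  classical
  unfold pr
  rw [← ex_add]
  refine ex_mono hw fun ω => ?_
  by_cases hP : P ω <;> by_cases hQ : Q ω <;> simp [hP, hQ]

theorem pr_exists_le (hw : IsWeight w) (s : Finset α) (P : α → (ι → κ) → Prop) :
    pr w (fun ω => ∃ a ∈ s, P a ω) ≤ ∑ a ∈ s, pr w (P a) := by
  classical
  unfold pr
  rw [← ex_sum]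
  refine ex_mono hw fun ω => ?_
  split_ifs with h
  · obtain ⟨a, ha, hP⟩ := h
    have := Finset.single_le_sum (f := fun a => if P a ω then (1 : ℝ) else 0)
      (fun b _ => by split_ifs <;> norm_num) ha
    simpa [hP] using this
  · exact Finset.sum_nonneg fun b _ => by split_ifs <;> norm_num

theorem pr_le_of_ex_le (hw : IsWeight w) {f : (ι → κ) → ℝ} (hf : ∀ ω, 0 ≤ f ω) {t c : ℝ}
    (ht : 0 < t) (h : ex w f ≤ c) {P : (ι → κ) → Prop} (hP : ∀ ω, P ω → t ≤ f ω) :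
    pr w P ≤ c / t := by
  classical
  rw [le_div_iff₀ ht, mul_comm]
  refine le_trans ?_ h
  unfold pr
  rw [← ex_const_mul]
  refine ex_mono hw fun ω => ?_
  split_ifs with hω
  · simpa using hP ω hω
  · simpa using hf ω

/-- Resampling the coordinates in `J` does not change the law. -/
theorem ex_resample (hw : IsWeight w) (J : Finset ι) (f : (ι → κ) → ℝ) :
    ex w (fun ω => ex w fun η => f (J.piecewise η ω)) = ex w f := by
  have key : ∀ F : (ι → κ) × (ι → κ) → ℝ,
      ∑ x : (ι → κ) × (ι → κ), F (J.piecewise x.2 x.1, J.piecewise x.1 x.2) = ∑ x, F x := by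
    intro F
    refine Fintype.sum_bijective
      (fun x : (ι → κ) × (ι → κ) => (J.piecewise x.2 x.1, J.piecewise x.1 x.2))
      (Function.Involutive.bijective ?_) _ _ fun x => rfl
    rintro ⟨x, y⟩
    ext i <;> by_cases hi : i ∈ J <;> simp [Finset.piecewise, hi]
  have h2 := key fun x => ((∏ i, w i (x.1 i)) * ∏ i, w i (x.2 i)) * f x.1
  rw [Fintype.sum_prod_type, Fintype.sum_prod_type] at h2
  have hR : ∑ x : ι → κ, ∑ y : ι → κ, ((∏ i, w i (x i)) * ∏ i, w i (y i)) * f x = ex w f := by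
    unfold ex
    refine Finset.sum_congr rfl fun x _ => ?_
    have := ex_const hw (f x)
    unfold ex at this
    calc _ = (∏ i, w i (x i)) * ∑ y : ι → κ, (∏ i, w i (y i)) * f x := by
          rw [Finset.mul_sum]; exact Finset.sum_congr rfl fun y _ => by ring
      _ = _ := by rw [this]
  rw [← hR]
  dsimp only at h2 ⊢
  rw [← h2]
  unfold ex
  refine Finset.sum_congr rfl fun x _ => ?_
  rw [Finset.mul_sum]
  refine Finset.sum_congr rfl fun y _ => ?_
  rw [← mul_assoc, ← Finset.prod_mul_distrib, ← Finset.prod_mul_distrib]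
  congr 1
  refine Finset.prod_congr rfl fun i _ => ?_
  by_cases hi : i ∈ J <;> simp [Finset.piecewise, hi, mul_comm]

theorem ex_mul_le_of_resample (hw : IsWeight w) (J : Finset ι) {f g : (ι → κ) → ℝ} {c : ℝ}
    (hf : ∀ ω, 0 ≤ f ω) (hJ : ∀ ω η, f (J.piecewise η ω) = f ω)
    (hg : ∀ ω, ex w (fun η => g (J.piecewise η ω)) ≤ c) :
    ex w (fun ω => f ω * g ω) ≤ c * ex w f := by
  rw [← ex_resample hw J, ← ex_const_mul]
  refine ex_mono hw fun ω => ?_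
  simp only [hJ, ex_const_mul]
  rw [mul_comm]
  exact mul_le_mul_of_nonneg_right (hg ω) (hf ω)

theorem ex_le_of_resample (hw : IsWeight w) (J : Finset ι) {g : (ι → κ) → ℝ} {c : ℝ}
    (hg : ∀ ω, ex w (fun η => g (J.piecewise η ω)) ≤ c) : ex w g ≤ c := by
  rw [← ex_resample hw J]
  exact (ex_mono hw hg).trans_eq (ex_const hw c)

theorem ex_prod_le (hw : IsWeight w) [DecidableEq α] (S : Finset α) (J : α → Finset ι)
    (g : α → (ι → κ) → ℝ) {c : ℝ} (hg0 : ∀ a ω, 0 ≤ g a ω)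
    (hJ : ∀ a ∈ S, ∀ b ∈ S, a ≠ b → ∀ ω η, g b ((J a).piecewise η ω) = g b ω)
    (hg : ∀ a ∈ S, ∀ ω, ex w (fun η => g a ((J a).piecewise η ω)) ≤ c) :
    ex w (fun ω => ∏ a ∈ S, g a ω) ≤ c ^ #S := by
  induction S using Finset.induction_on with
  | empty => simp [ex_const hw]
  | insert a S ha ih =>
    have hc : 0 ≤ c := by
      rcases isEmpty_or_nonempty (ι → κ) with hne | ⟨⟨ω⟩⟩
      · have := ex_const hw 1
        simp [ex] at this
      · exact (ex_nonneg hw fun η => hg0 a _).trans (hg a (Finset.mem_insert_self _ _) ω)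
    have h1 : ∀ ω, ∏ b ∈ insert a S, g b ω = (∏ b ∈ S, g b ω) * g a ω := fun ω => by
      rw [Finset.prod_insert ha, mul_comm]
    simp_rw [h1]
    rw [Finset.card_insert_of_notMem ha, pow_succ']
    refine (ex_mul_le_of_resample hw (J a) (fun ω => Finset.prod_nonneg fun b _ => hg0 b ω) ?_
      (hg a (Finset.mem_insert_self _ _))).trans ?_
    · intro ω η
      refine Finset.prod_congr rfl fun b hb => ?_
      exact hJ a (Finset.mem_insert_self _ _) b (Finset.mem_insert_of_mem hb)
        (fun h => ha (h ▸ hb)) ω η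
    · exact mul_le_mul_of_nonneg_left (ih
        (fun x hx y hy => hJ x (Finset.mem_insert_of_mem hx) y (Finset.mem_insert_of_mem hy))
        (fun x hx => hg x (Finset.mem_insert_of_mem hx))) hc

open Classical in
/-- Tail bound for the number of `a ∈ S` with `P a`, when each `P a` has conditional probability at
most `q` given the coordinates outside `J a`, and these determine all the other `P b`. -/
theorem pr_card_le (hw : IsWeight w) (S : Finset α) (J : α → Finset ι)
    (P : α → (ι → κ) → Prop) {q Λ : ℝ} (hΛ : 1 ≤ Λ)
    (hJ : ∀ a ∈ S, ∀ b ∈ S, a ≠ b → ∀ ω η, P b ((J a).piecewise η ω) ↔ P b ω)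
    (hq : ∀ a ∈ S, ∀ ω, pr w (fun η => P a ((J a).piecewise η ω)) ≤ q) (r : ℝ) :
    pr w (fun ω => r ≤ #{a ∈ S | P a ω}) ≤ (1 + (Λ - 1) * q) ^ #S / Λ ^ r := by
  have hΛ0 : 0 < Λ := by linarith
  have h := ex_prod_le hw S J (fun a ω => 1 + (Λ - 1) * if P a ω then 1 else 0)
    (c := 1 + (Λ - 1) * q) (fun a ω => by split_ifs <;> nlinarith)
    (fun a ha b hb hab ω η => by simp only [hJ a ha b hb hab ω η]) (fun a ha ω => by
      rw [ex_add, ex_const hw, ex_const_mul]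
      have := hq a ha ω
      unfold pr at this
      nlinarith)
  refine pr_le_of_ex_le hw (fun ω => Finset.prod_nonneg fun a _ => ?_) (by positivity) h ?_
  · split_ifs <;> nlinarith
  · intro ω hω
    have : ∏ a ∈ S, (1 + (Λ - 1) * if P a ω then (1 : ℝ) else 0) = Λ ^ #{a ∈ S | P a ω} := by
      rw [← Finset.prod_const, Finset.prod_filter]
      refine Finset.prod_congr rfl fun a _ => ?_
      split_ifs <;> ring
    rw [this, ← Real.rpow_natCast]
    exact Real.rpow_le_rpow_of_exponent_le hΛ hω

theorem ex_sq_sum (hw : IsWeight w) (s : Finset α) (φ : α → ι) (hφ : Set.InjOn φ s)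
    (h : α → κ → ℝ) (h0 : ∀ a ∈ s, ∑ x, w (φ a) x * h a x = 0) :
    ex w (fun ω => (∑ a ∈ s, h a (ω (φ a))) ^ 2) = ∑ a ∈ s, ∑ x, w (φ a) x * h a x ^ 2 := by
  classical
  simp_rw [sq (∑ a ∈ s, h a _), Finset.sum_mul_sum]
  rw [ex_sum]
  refine Finset.sum_congr rfl fun a ha => ?_
  rw [ex_sum, Finset.sum_eq_single a]
  · have := ex_prod hw {a} φ (by simp) (fun a x => h a x ^ 2)
    simpa [sq] using this
  · intro b hb hba
    have := ex_prod hw {a, b} φ (hφ.mono (by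
      intro x hx; simp at hx; rcases hx with rfl | rfl <;> assumption)) h
    simp only [Finset.prod_pair hba.symm, h0 a ha, zero_mul] at this
    exact this
  · exact fun h => absurd ha h

end ProductExpectation

/-! ### Heavy couples -/

theorem sum_zpow_two_lt_le (I : Finset ℤ) {c : ℝ} (hc : 0 < c) :
    ∑ i ∈ I with (2 : ℝ) ^ i < c, (2 : ℝ) ^ i ≤ 2 * c := by
  obtain ⟨J, hJ⟩ : ∃ J : ℤ, ∀ i : ℤ, (2 : ℝ) ^ i < c → i ≤ J ∧ (2 : ℝ) ^ J ≤ c := by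
    refine ⟨Int.log 2 c, fun i hi => ⟨?_, ?_⟩⟩
    · exact (Int.zpow_le_iff_le_log (by norm_num) hc).1 (by exact_mod_cast hi.le)
    · exact_mod_cast Int.zpow_log_le_self (b := 2) (by norm_num) hc
  by_cases hne : ({i ∈ I | (2 : ℝ) ^ i < c} : Finset ℤ).Nonempty
  swap
  · rw [Finset.not_nonempty_iff_eq_empty.1 hne]; simp; exact hc.le
  obtain ⟨i₀, hi₀⟩ := hne
  have hJc := (hJ i₀ (Finset.mem_filter.1 hi₀).2).2
  set F : Finset ℤ := {i ∈ I | (2 : ℝ) ^ i < c} with hF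
  have h1 : ∑ i ∈ F, (2 : ℝ) ^ i = (2 : ℝ) ^ J * ∑ m ∈ F.image (fun i => (J - i).toNat), (1 / 2 : ℝ) ^ m := by
    rw [Finset.sum_image, Finset.mul_sum]
    · refine Finset.sum_congr rfl fun i hi => ?_
      have hle := (hJ i (Finset.mem_filter.1 hi).2).1
      have : (1 / 2 : ℝ) ^ (J - i).toNat = (2 : ℝ) ^ (-(J - i)) := by
        rw [one_div, inv_pow, zpow_neg, ← zpow_natCast, Int.toNat_of_nonneg (by omega)]
      rw [this, ← zpow_add₀ (by norm_num)]
      congr 1; ring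
    · intro x hx y hy hxy
      have h1 := (hJ x (Finset.mem_filter.1 hx).2).1
      have h2 := (hJ y (Finset.mem_filter.1 hy).2).1
      simp only at hxy
      omega
  rw [h1]
  have h2 : ∑ m ∈ F.image (fun i => (J - i).toNat), (1 / 2 : ℝ) ^ m ≤ 2 := by
    refine le_trans ?_ tsum_geometric_two.le
    exact summable_geometric_two.sum_le_tsum _ fun _ _ => by positivity
  nlinarith [zpow_pos (two_pos : (0 : ℝ) < 2) J]

theorem sum_zpow_two_neg_lt_le (I : Finset ℤ) {c : ℝ} (hc : 0 < c) :
    ∑ i ∈ I with c < (2 : ℝ) ^ i, (2 : ℝ) ^ (-i) ≤ 2 / c := by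
  have h := sum_zpow_two_lt_le (I.image fun i => -i) (c := c⁻¹) (by positivity)
  rw [div_eq_mul_inv]
  refine le_trans (le_of_eq ?_) h
  have : ({i ∈ I.image fun i => -i | (2 : ℝ) ^ i < c⁻¹} : Finset ℤ) =
      ({i ∈ I | c < (2 : ℝ) ^ i} : Finset ℤ).image fun i => -i := by
    ext j
    simp only [Finset.mem_filter, Finset.mem_image]
    constructor
    · rintro ⟨⟨i, hi, rfl⟩, h⟩
      rw [zpow_neg, inv_lt_inv₀ (by positivity) hc] at h
      exact ⟨i, ⟨hi, h⟩, rfl⟩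
    · rintro ⟨i, ⟨hi, h⟩, rfl⟩
      refine ⟨⟨i, hi, rfl⟩, ?_⟩
      rw [zpow_neg, inv_lt_inv₀ (by positivity) hc]
      exact h
  rw [this, Finset.sum_image (fun x _ y _ h => by simpa using h)]

/-- The bound for one pair of dyadic levels in the heavy couples estimate: `e` is the number of
edges between the levels `i` and `j` (of sizes `s` and `t`). -/
theorem dyadic_level_bound {K N D s t e : ℝ} {i j : ℤ} (hK : Real.exp 1 ≤ K) (hN : 0 < N)
    (hD : 0 < D) (hs : 0 < s) (ht : 0 < t) (htN : t ≤ N) (he : 0 ≤ e)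
    (hβ : t * 4 ^ j / N ≤ 1)
    (hheavy : √D < 4 * ((2 : ℝ) ^ i * 2 ^ j)) (hmid : (2 : ℝ) ^ i < 2 * √D * 2 ^ j)
    (hdisc : e ≤ K * (s * t * D / N) ∨
      e * Real.log (e / (s * t * D / N)) ≤ K * t * Real.log (N / t)) :
    e * (4 * ((2 : ℝ) ^ i * 2 ^ j)) / N ≤
      20 * K * √D * (s * 4 ^ i / N) * (t * 4 ^ j / N)
      + 16 * K * (t * 4 ^ j / N) * (if (2 : ℝ) ^ i < 2 * √D * 2 ^ j then 2 ^ i / 2 ^ j else 0)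
      + 16 * K * (t * 4 ^ j / N) * (if (2 : ℝ) ^ i < √D then 2 ^ i else 0)
      + 4 * D * (s * 4 ^ i / N) *
        (if √D / (4 * 2 ^ i) < (2 : ℝ) ^ j then 2 ^ (-j) else 0) / 2 ^ i := by
  have hK1 : 1 < K := lt_of_lt_of_le (by have := Real.add_one_lt_exp (one_ne_zero (α := ℝ)); linarith) hK
  have h4 : ∀ m : ℤ, (4 : ℝ) ^ m = 2 ^ m * 2 ^ m := fun m => by
    rw [← mul_zpow]; norm_num
  rw [h4] at hβ
  rw [h4, h4]
  have hj2 : (2 : ℝ) ^ (-j) = ((2 : ℝ) ^ j)⁻¹ := zpow_neg _ _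
  rw [hj2]
  obtain ⟨x, hx⟩ : ∃ x : ℝ, x = 2 ^ i := ⟨_, rfl⟩
  obtain ⟨y, hy⟩ : ∃ y : ℝ, y = 2 ^ j := ⟨_, rfl⟩
  have hx0 : 0 < x := hx ▸ zpow_pos two_pos _
  have hy0 : 0 < y := hy ▸ zpow_pos two_pos _
  obtain ⟨r, hr⟩ : ∃ r : ℝ, r = √D := ⟨_, rfl⟩
  have hr0 : 0 < r := hr ▸ Real.sqrt_pos.2 hD
  have hDr : D = r * r := by rw [hr, Real.mul_self_sqrt hD.le]
  rw [← hy] at hβ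
  rw [← hx, ← hy, ← hr] at hheavy hmid ⊢
  have hmid' : x < 2 * r * y := hmid
  rw [if_pos hmid', if_pos (show r / (4 * x) < y by rw [div_lt_iff₀ (by positivity)]; linarith)]
  rw [hDr] at hdisc ⊢
  obtain ⟨a, ha⟩ : ∃ a : ℝ, a = s * (x * x) / N := ⟨_, rfl⟩
  obtain ⟨b, hb⟩ : ∃ b : ℝ, b = t * (y * y) / N := ⟨_, rfl⟩
  obtain ⟨μ, hμ⟩ : ∃ μ : ℝ, μ = s * t * (r * r) / N := ⟨_, rfl⟩
  have ha0 : 0 < a := by rw [ha]; positivity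
  have hb0 : 0 < b := by rw [hb]; positivity
  have hμ0 : 0 < μ := by rw [hμ]; positivity
  rw [← ha, ← hb]
  rw [← hb] at hβ
  rw [← hμ] at hdisc
  -- all four terms are nonnegative
  have T1 : 0 ≤ 20 * K * r * a * b := by positivity
  have T2 : 0 ≤ 16 * K * b * (x / y) := by positivity
  have T3 : 0 ≤ 16 * K * b * (if x < r then x else 0) := by split_ifs <;> positivity
  have T4 : 0 ≤ 4 * (r * r) * a * y⁻¹ / x := by positivity
  have hμab : μ = r * r * a * b * N / (x * x * (y * y)) := by
    rw [hμ, ha, hb]; field_simp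
  suffices h : e * (4 * (x * y)) / N ≤ 20 * K * r * a * b ∨
      e * (4 * (x * y)) / N ≤ 16 * K * b * (x / y) ∨
      e * (4 * (x * y)) / N ≤ 16 * K * b * (if x < r then x else 0) ∨
      e * (4 * (x * y)) / N ≤ 4 * (r * r) * a * y⁻¹ / x by
    generalize 20 * K * r * a * b = u₁ at *
    generalize 16 * K * b * (x / y) = u₂ at *
    generalize 16 * K * b * (if x < r then x else 0) = u₃ at *
    generalize 4 * (r * r) * a * y⁻¹ / x = u₄ at *
    generalize e * (4 * (x * y)) / N = u at *
    clear * - h T1 T2 T3 T4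
    rcases h with h | h | h | h <;> linarith
  clear T1 T2 T3 T4
  by_cases hA : e ≤ K * μ
  · have : e * (4 * (x * y)) / N ≤ K * μ * (4 * (x * y)) / N := by gcongr
    have h2 : K * μ * (4 * (x * y)) / N = 4 * K * r * a * b * (r / (x * y)) := by
      rw [hμab]; field_simp
    have h3 : r / (x * y) ≤ 4 := by rw [div_le_iff₀ (by positivity)]; linarith
    have h4 : 4 * K * r * a * b * (r / (x * y)) ≤ 4 * K * r * a * b * 4 := by gcongr
    have h5 : 4 * K * r * a * b * 4 ≤ 20 * K * r * a * b := by
      have : 0 ≤ K * r * a * b := by positivity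
      clear * - this
      linarith
    exact Or.inl (this.trans (h2.trans_le (h4.trans h5)))
  by_cases hB : e ≤ s * t * r * (x * y) / N
  · have : e * (4 * (x * y)) / N ≤ s * t * r * (x * y) / N * (4 * (x * y)) / N := by gcongr
    have h2 : s * t * r * (x * y) / N * (4 * (x * y)) / N = 4 * r * a * b := by
      rw [ha, hb]; field_simp
    have h3 : 4 * r * a * b ≤ 20 * K * r * a * b := by
      have : 0 < r * a * b := by positivity
      have h5 : r * a * b ≤ K * (r * a * b) := le_mul_of_one_le_left this.le hK1.le
      clear * - h5 this
      linarith
    exact Or.inl (this.trans (h2.trans_le h3))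
  push Not at hA hB
  have hdisc' := hdisc.resolve_left (not_le.2 hA)
  obtain ⟨l, hl⟩ : ∃ l : ℝ, l = e / μ := ⟨_, rfl⟩
  rw [← hl] at hdisc'
  have hel : e = l * μ := by rw [hl]; field_simp
  have hlK : K < l := by rw [hl, lt_div_iff₀ hμ0]; exact hA
  have hl0 : 0 < l := by linarith
  have hlxy : x * y < l * r := by
    rw [hel, hμ] at hB
    have : l * (s * t * (r * r) / N) = s * t * r / N * (l * r) := by ring
    rw [this] at hB
    have h2 : s * t * r * (x * y) / N = s * t * r / N * (x * y) := by ring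
    rw [h2] at hB
    exact lt_of_mul_lt_mul_left hB (by positivity)
  have hlog1 : 1 ≤ Real.log l := by
    rw [← Real.log_exp 1]
    exact Real.log_le_log (Real.exp_pos 1) (by linarith)
  have hNt : N / t = y * y / b := by rw [hb]; field_simp
  have hNt1 : 1 ≤ N / t := by rw [le_div_iff₀ ht]; linarith
  have hLn : 0 ≤ Real.log (N / t) := Real.log_nonneg hNt1
  have tb : t = b * N / (y * y) := by rw [hb]; field_simp
  by_cases hC : Real.log (N / t) ≤ 4 * Real.log l
  · have he4 : e ≤ 4 * K * t := by
      have : e * Real.log l ≤ (4 * K * t) * Real.log l := by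
        calc _ ≤ K * t * Real.log (N / t) := hdisc'
          _ ≤ K * t * (4 * Real.log l) := by gcongr
          _ = _ := by ring
      exact le_of_mul_le_mul_right this (by linarith)
    have h1 : e * (4 * (x * y)) / N ≤ 4 * K * t * (4 * (x * y)) / N := by gcongr
    have h2 : 4 * K * t * (4 * (x * y)) / N = 16 * K * b * (x / y) := by
      rw [tb]; field_simp; ring
    exact Or.inr (Or.inl (h1.trans h2.le))
  push Not at hC
  have hl4 : l ^ 4 < y * y / b := by
    rw [← hNt]
    have : Real.log (l ^ 4) < Real.log (N / t) := by rw [Real.log_pow]; exact_mod_cast hC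
    exact (Real.log_lt_log_iff (by positivity) (by linarith)).1 this
  by_cases hD1 : 1 ≤ b * (y * y)
  · have hyy : y * y ≤ y ^ 4 * b := by
      calc y * y = y * y * 1 := by ring
        _ ≤ y * y * (b * (y * y)) := by gcongr
        _ = y ^ 4 * b := by ring
    have hl4' : l ^ 4 < y ^ 4 := by
      refine hl4.trans_le ?_
      rw [div_le_iff₀ hb0]
      exact hyy
    have hly : l < y := lt_of_pow_lt_pow_left₀ 4 hy0.le hl4'
    have hxr : x < r := by
      have : x * y < y * r := hlxy.trans (by gcongr)
      rw [mul_comm x y] at this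
      exact lt_of_mul_lt_mul_left this hy0.le
    have hlog : Real.log (N / t) ≤ 4 * y := by
      rw [hNt]
      calc Real.log (y * y / b) ≤ Real.log (y ^ 4) := by
            refine Real.log_le_log (by positivity) ?_
            rw [div_le_iff₀ hb0]
            exact hyy
        _ = 4 * Real.log y := by rw [Real.log_pow]; norm_num
        _ ≤ 4 * y := by have := Real.log_le_sub_one_of_pos hy0; linarith
    have he4 : e ≤ K * t * (4 * y) := by
      calc e ≤ e * Real.log l := le_mul_of_one_le_right he hlog1
        _ ≤ K * t * Real.log (N / t) := hdisc'
        _ ≤ _ := by gcongr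
    have h1 : e * (4 * (x * y)) / N ≤ K * t * (4 * y) * (4 * (x * y)) / N := by gcongr
    have h2 : K * t * (4 * y) * (4 * (x * y)) / N = 16 * K * b * x := by
      rw [tb]; field_simp; ring
    rw [if_pos hxr]
    exact Or.inr (Or.inr (Or.inl (h1.trans h2.le)))
  · push Not at hD1
    have hyb : y * y < 1 / b := by rw [lt_div_iff₀ hb0]; linarith
    have hlb : l * b ≤ 1 := by
      have h4 : l ^ 4 * b ^ 2 < 1 := by
        rw [lt_div_iff₀ hb0] at hl4
        calc l ^ 4 * b ^ 2 = l ^ 4 * b * b := by ring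
          _ < y * y * b := by gcongr
          _ < 1 := by rw [mul_comm]; exact hD1
      have h5 : (l * b) ^ 4 ≤ 1 ^ 4 := by
        calc (l * b) ^ 4 = l ^ 4 * b ^ 2 * (b * b) := by ring
          _ ≤ 1 * (1 * 1) := by gcongr
          _ = 1 ^ 4 := by norm_num
      exact le_of_pow_le_pow_left₀ (by norm_num) (by norm_num) h5
    have h2 : e * (4 * (x * y)) / N = 4 * (r * r) * a * (l * b) * y⁻¹ / x := by
      rw [hel, hμab]; field_simp
    have h3 : 4 * (r * r) * a * (l * b) * y⁻¹ / x ≤ 4 * (r * r) * a * 1 * y⁻¹ / x := by gcongr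
    rw [mul_one] at h3
    exact Or.inr (Or.inr (Or.inr (h2.trans_le h3)))

theorem dyadic_levels_sum_le {K N D : ℝ} (hK : Real.exp 1 ≤ K) (hN : 0 < N) (hD : 0 < D)
    (I J : Finset ℤ) (s t : ℤ → ℝ) (e : ℤ → ℤ → ℝ) (hs : ∀ i, 0 ≤ s i) (ht : ∀ j, 0 ≤ t j)
    (htN : ∀ j, t j ≤ N) (he : ∀ i j, 0 ≤ e i j)
    (hα : ∑ i ∈ I, s i * 4 ^ i / N ≤ 1) (hβ : ∑ j ∈ J, t j * 4 ^ j / N ≤ 1)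
    (hdisc : ∀ i j, 0 < s i → s i ≤ t j → e i j ≤ K * (s i * t j * D / N) ∨
      e i j * Real.log (e i j / (s i * t j * D / N)) ≤ K * t j * Real.log (N / t j)) :
    ∑ i ∈ I, ∑ j ∈ J, (if 0 < s i ∧ s i ≤ t j ∧ √D < 4 * ((2 : ℝ) ^ i * 2 ^ j) ∧
        (2 : ℝ) ^ i < 2 * √D * 2 ^ j then e i j * (4 * ((2 : ℝ) ^ i * 2 ^ j)) / N else 0)
      ≤ 148 * K * √D := by
  have hK1 : 1 ≤ K := by
    have := Real.add_one_lt_exp (one_ne_zero (α := ℝ)); linarith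
  have hr : 0 < √D := Real.sqrt_pos.2 hD
  set A : ℤ → ℝ := fun i => s i * 4 ^ i / N with hA
  set Bt : ℤ → ℝ := fun j => t j * 4 ^ j / N with hBt
  have hA0 : ∀ i, 0 ≤ A i := fun i => by have := hs i; simp only [hA]; positivity
  have hB0 : ∀ j, 0 ≤ Bt j := fun j => by have := ht j; simp only [hBt]; positivity
  have key : ∀ i ∈ I, ∀ j ∈ J, (if 0 < s i ∧ s i ≤ t j ∧ √D < 4 * ((2 : ℝ) ^ i * 2 ^ j) ∧
        (2 : ℝ) ^ i < 2 * √D * 2 ^ j then e i j * (4 * ((2 : ℝ) ^ i * 2 ^ j)) / N else 0) ≤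
      20 * K * √D * A i * Bt j
      + 16 * K * Bt j * (if (2 : ℝ) ^ i < 2 * √D * 2 ^ j then 2 ^ i / 2 ^ j else 0)
      + 16 * K * Bt j * (if (2 : ℝ) ^ i < √D then 2 ^ i else 0)
      + 4 * D * A i * (if √D / (4 * 2 ^ i) < (2 : ℝ) ^ j then 2 ^ (-j) else 0) / 2 ^ i := by
    intro i hi j hj
    split_ifs with h
    all_goals try
      first
      | (obtain ⟨h1, h2, h3, h4⟩ := h
         have := dyadic_level_bound hK hN hD h1 (h1.trans_le h2) (htN j) (he i j)
           ((Finset.single_le_sum (fun j _ => hB0 j) hj).trans hβ) h3 h4 (hdisc i j h1 h2)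
         simpa [*] using this)
    all_goals
      have h1 := hA0 i
      have h2 := hB0 j
      positivity
  refine (Finset.sum_le_sum fun i hi => Finset.sum_le_sum fun j hj => key i hi j hj).trans ?_
  simp only [Finset.sum_add_distrib]
  have b1 : ∑ i ∈ I, ∑ j ∈ J, 20 * K * √D * A i * Bt j ≤ 20 * K * √D := by
    have : ∑ i ∈ I, ∑ j ∈ J, 20 * K * √D * A i * Bt j =
        20 * K * √D * ((∑ i ∈ I, A i) * ∑ j ∈ J, Bt j) := by
      rw [Finset.sum_mul_sum, Finset.mul_sum]
      refine Finset.sum_congr rfl fun i _ => ?_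
      rw [Finset.mul_sum]
      exact Finset.sum_congr rfl fun j _ => by ring
    rw [this]
    have h2 : (∑ i ∈ I, A i) * ∑ j ∈ J, Bt j ≤ 1 * 1 :=
      mul_le_mul hα hβ (Finset.sum_nonneg fun j _ => hB0 j) zero_le_one
    have : 0 ≤ 20 * K * √D := by positivity
    nlinarith
  have b2 : ∑ i ∈ I, ∑ j ∈ J, 16 * K * Bt j *
      (if (2 : ℝ) ^ i < 2 * √D * 2 ^ j then 2 ^ i / 2 ^ j else 0) ≤ 64 * K * √D := by
    rw [Finset.sum_comm]
    have : ∀ j ∈ J, ∑ i ∈ I, 16 * K * Bt j *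
        (if (2 : ℝ) ^ i < 2 * √D * 2 ^ j then 2 ^ i / 2 ^ j else 0) ≤ 64 * K * √D * Bt j := by
      intro j _
      rw [← Finset.mul_sum, ← Finset.sum_filter, ← Finset.sum_div]
      have hj : (0 : ℝ) < 2 ^ j := zpow_pos two_pos _
      have h := sum_zpow_two_lt_le I (c := 2 * √D * 2 ^ j) (by positivity)
      have h2 : (∑ i ∈ I with (2 : ℝ) ^ i < 2 * √D * 2 ^ j, (2 : ℝ) ^ i) / 2 ^ j ≤ 4 * √D := by
        rw [div_le_iff₀ hj]; linarith
      have h3 : 0 ≤ 16 * K * Bt j := by have := hB0 j; positivity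
      nlinarith [mul_le_mul_of_nonneg_left h2 h3]
    refine (Finset.sum_le_sum this).trans ?_
    rw [← Finset.mul_sum]
    exact mul_le_of_le_one_right (by positivity) hβ
  have b3 : ∑ i ∈ I, ∑ j ∈ J, 16 * K * Bt j * (if (2 : ℝ) ^ i < √D then 2 ^ i else 0)
      ≤ 32 * K * √D := by
    rw [Finset.sum_comm]
    have : ∀ j ∈ J, ∑ i ∈ I, 16 * K * Bt j * (if (2 : ℝ) ^ i < √D then 2 ^ i else 0)
        ≤ 32 * K * √D * Bt j := by
      intro j _
      rw [← Finset.mul_sum, ← Finset.sum_filter]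
      have h := sum_zpow_two_lt_le I hr
      have h3 : 0 ≤ 16 * K * Bt j := by have := hB0 j; positivity
      nlinarith [mul_le_mul_of_nonneg_left h h3]
    refine (Finset.sum_le_sum this).trans ?_
    rw [← Finset.mul_sum]
    exact mul_le_of_le_one_right (by positivity) hβ
  have b4 : ∑ i ∈ I, ∑ j ∈ J, 4 * D * A i *
      (if √D / (4 * 2 ^ i) < (2 : ℝ) ^ j then 2 ^ (-j) else 0) / 2 ^ i ≤ 32 * K * √D := by
    have : ∀ i ∈ I, ∑ j ∈ J, 4 * D * A i *
        (if √D / (4 * 2 ^ i) < (2 : ℝ) ^ j then 2 ^ (-j) else 0) / 2 ^ i ≤ 32 * √D * A i := by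
      intro i _
      have hi : (0 : ℝ) < 2 ^ i := zpow_pos two_pos _
      rw [← Finset.sum_div, ← Finset.mul_sum, ← Finset.sum_filter]
      have h := sum_zpow_two_neg_lt_le J (c := √D / (4 * 2 ^ i)) (by positivity)
      rw [div_le_iff₀ hi]
      have h3 : 0 ≤ 4 * D * A i := by have := hA0 i; positivity
      refine (mul_le_mul_of_nonneg_left h h3).trans (le_of_eq ?_)
      have hDD : D = √D * √D := (Real.mul_self_sqrt hD.le).symm
      field_simp
      rw [hDD]
      simp only [Real.sqrt_mul_self hr.le]
      ring
    refine (Finset.sum_le_sum this).trans ?_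
    rw [← Finset.mul_sum]
    refine (mul_le_of_le_one_right (by positivity) hα).trans ?_
    have := mul_le_mul_of_nonneg_right hK1 hr.le
    linarith
  linarith

section Heavy

variable {α β : Type*} [Fintype α] [Fintype β]

omit [Fintype α] [Fintype β] in
theorem sum_fiberwise_levels (B : α → β → ℝ) (P : Finset α) (Q : Finset β) (l : α → ℤ) (m : β → ℤ)
    (F : ℤ → ℤ → ℝ) :
    ∑ x ∈ P, ∑ y ∈ Q, B x y * F (l x) (m y) = ∑ i ∈ P.image l, ∑ j ∈ Q.image m,
      (∑ x ∈ P with l x = i, ∑ y ∈ Q with m y = j, B x y) * F i j := by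
  classical
  rw [← Finset.sum_fiberwise_of_maps_to (s := P) (t := P.image l) (g := l)
    (fun x hx => Finset.mem_image_of_mem l hx) (fun x => ∑ y ∈ Q, B x y * F (l x) (m y))]
  refine Finset.sum_congr rfl fun i _ => ?_
  simp_rw [Finset.sum_mul]
  conv_rhs => rw [Finset.sum_comm]
  refine Finset.sum_congr rfl fun x hx => ?_
  rw [← Finset.sum_fiberwise_of_maps_to (s := Q) (t := Q.image m) (g := m)
    (fun x hx => Finset.mem_image_of_mem m hx) (fun y => B x y * F (l x) (m y))]
  refine Finset.sum_congr rfl fun j _ => ?_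
  refine Finset.sum_congr rfl fun y hy => ?_
  rw [(Finset.mem_filter.1 hx).2, (Finset.mem_filter.1 hy).2]

/-- Number of edges between two sets of vertices. -/
def edgeSum (B : α → β → ℝ) (S : Finset α) (T : Finset β) : ℝ := ∑ x ∈ S, ∑ y ∈ T, B x y

/-- The discrepancy property of Kahn and Szemerédi for a bipartite graph of density at most
`D / N`. -/
def Discrepancy (K N D : ℝ) (B : α → β → ℝ) : Prop :=
  ∀ (S : Finset α) (T : Finset β), S.Nonempty → T.Nonempty →
    edgeSum B S T ≤ K * (#S * #T * D / N) ∨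
    edgeSum B S T * Real.log (edgeSum B S T / (#S * #T * D / N)) ≤
      K * (max #S #T : ℕ) * Real.log (N / (max #S #T : ℕ))

theorem sum_level_le {N : ℝ} (hN : 0 < N) {u : α → ℝ} (hu1 : ∑ x, u x ^ 2 ≤ 1)
    (P : Finset α) (l : α → ℤ) (hl : ∀ x ∈ P, (2 : ℝ) ^ l x ≤ √N * u x) :
    ∑ i ∈ P.image l, (#{x ∈ P | l x = i} : ℝ) * 4 ^ i / N ≤ 1 := by
  classical
  refine le_trans ?_ hu1
  have h1 : ∀ i ∈ P.image l, (#{x ∈ P | l x = i} : ℝ) * 4 ^ i / N ≤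
      ∑ x ∈ P with l x = i, u x ^ 2 := by
    intro i _
    have : (#{x ∈ P | l x = i} : ℝ) * 4 ^ i / N = ∑ x ∈ P with l x = i, (4 : ℝ) ^ i / N := by
      rw [Finset.sum_const, nsmul_eq_mul, mul_div_assoc]
    rw [this]
    refine Finset.sum_le_sum fun x hx => ?_
    obtain ⟨hxP, rfl⟩ := Finset.mem_filter.1 hx
    rw [div_le_iff₀ hN]
    have h4 : (4 : ℝ) ^ l x = (2 ^ l x) ^ 2 := by rw [sq, ← mul_zpow]; norm_num
    rw [h4]
    calc ((2 : ℝ) ^ l x) ^ 2 ≤ (√N * u x) ^ 2 :=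
          pow_le_pow_left₀ (zpow_nonneg zero_le_two _) (hl x hxP) 2
      _ = u x ^ 2 * N := by rw [mul_pow, Real.sq_sqrt hN.le, mul_comm]
  refine (Finset.sum_le_sum h1).trans ?_
  rw [Finset.sum_fiberwise_of_maps_to (fun x hx => Finset.mem_image_of_mem l hx)]
  exact Finset.sum_le_sum_of_subset_of_nonneg (Finset.subset_univ _) fun x _ _ => sq_nonneg _

/-- Heavy couples contribute `O(√D)`. -/
theorem heavy_couples_le {K N D : ℝ} (hK : Real.exp 1 ≤ K) (hN : 0 < N) (hD : 0 < D)
    (hα : (Fintype.card α : ℝ) ≤ N) (hβ : (Fintype.card β : ℝ) ≤ N)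
    (B : α → β → ℝ) (hB : ∀ x y, 0 ≤ B x y) (hrow : ∀ x, ∑ y, B x y ≤ K * D)
    (hcol : ∀ y, ∑ x, B x y ≤ K * D) (hdisc : Discrepancy K N D B)
    (u : α → ℝ) (v : β → ℝ) (hu : ∀ x, 0 ≤ u x) (hv : ∀ y, 0 ≤ v y)
    (hu1 : ∑ x, u x ^ 2 ≤ 1) (hv1 : ∑ y, v y ^ 2 ≤ 1) :
    ∑ x, ∑ y, (if √D < N * (u x * v y) then B x y * (u x * v y) else 0) ≤ 298 * K * √D := by
  classical
  have hr : 0 < √D := Real.sqrt_pos.2 hD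
  have hDD : √D * √D = D := Real.mul_self_sqrt hD.le
  have hsN : 0 < √N := Real.sqrt_pos.2 hN
  have hNN : √N * √N = N := Real.mul_self_sqrt hN.le
  set P : Finset α := {x | 0 < u x} with hP
  set Q : Finset β := {y | 0 < v y} with hQ
  set l : α → ℤ := fun x => Int.log 2 (√N * u x) with hl
  set m : β → ℤ := fun y => Int.log 2 (√N * v y) with hm
  have hl1 : ∀ x ∈ P, (2 : ℝ) ^ l x ≤ √N * u x := fun x hx => by
    have hx : 0 < u x := by simpa [hP] using hx
    exact_mod_cast Int.zpow_log_le_self (b := 2) (by norm_num) (mul_pos hsN hx)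
  have hm1 : ∀ y ∈ Q, (2 : ℝ) ^ m y ≤ √N * v y := fun y hy => by
    have hy : 0 < v y := by simpa [hQ] using hy
    exact_mod_cast Int.zpow_log_le_self (b := 2) (by norm_num) (mul_pos hsN hy)
  have hl2 : ∀ x, √N * u x < 2 * 2 ^ l x := fun x => by
    have h := Int.lt_zpow_succ_log_self (b := 2) (by norm_num) (√N * u x)
    rw [zpow_add_one₀ (by norm_num)] at h
    push_cast at h
    linarith
  have hm2 : ∀ y, √N * v y < 2 * 2 ^ m y := fun y => by
    have h := Int.lt_zpow_succ_log_self (b := 2) (by norm_num) (√N * v y)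
    rw [zpow_add_one₀ (by norm_num)] at h
    push_cast at h
    linarith
  let F : ℤ → ℤ → ℝ := fun i j => if √D < 4 * ((2 : ℝ) ^ i * 2 ^ j) ∧
    (2 : ℝ) ^ i < 2 * √D * 2 ^ j ∧ (2 : ℝ) ^ j < 2 * √D * 2 ^ i then
      4 * ((2 : ℝ) ^ i * 2 ^ j) / N else 0
  have hF0 : ∀ i j, 0 ≤ F i j := fun i j => by
    simp only [F]; split_ifs <;> positivity
  have point : ∀ x y, (if √D < N * (u x * v y) then B x y * (u x * v y) else 0) ≤
      B x y * u x ^ 2 / √D + B x y * v y ^ 2 / √D +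
        (if 0 < u x then if 0 < v y then B x y * F (l x) (m y) else 0 else 0) := by
    intro x y
    have t1 : 0 ≤ B x y * u x ^ 2 / √D := by have := hB x y; positivity
    have t2 : 0 ≤ B x y * v y ^ 2 / √D := by have := hB x y; positivity
    have t3 : 0 ≤ (if 0 < u x then if 0 < v y then B x y * F (l x) (m y) else 0 else 0) := by
      have := mul_nonneg (hB x y) (hF0 (l x) (m y))
      split_ifs <;> first | exact this | exact le_rfl
    by_cases h : √D < N * (u x * v y)
    swap
    · rw [if_neg h]; linarith
    rw [if_pos h]
    have huv : 0 < u x * v y := by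
      by_contra hcon
      have : N * (u x * v y) ≤ 0 := mul_nonpos_of_nonneg_of_nonpos hN.le (not_lt.1 hcon)
      linarith
    have hux : 0 < u x := lt_of_le_of_ne (hu x) (fun h => by rw [← h] at huv; simp at huv)
    have hvy : 0 < v y := lt_of_le_of_ne (hv y) (fun h => by rw [← h] at huv; simp at huv)
    by_cases h1 : √D * v y ≤ u x
    · have : B x y * (u x * v y) ≤ B x y * u x ^ 2 / √D := by
        rw [mul_div_assoc]
        refine mul_le_mul_of_nonneg_left ?_ (hB x y)
        rw [le_div_iff₀ hr]
        nlinarith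
      linarith
    by_cases h2 : √D * u x ≤ v y
    · have : B x y * (u x * v y) ≤ B x y * v y ^ 2 / √D := by
        rw [mul_div_assoc]
        refine mul_le_mul_of_nonneg_left ?_ (hB x y)
        rw [le_div_iff₀ hr]
        nlinarith
      linarith
    push Not at h1 h2
    rw [if_pos hux, if_pos hvy] at t3 ⊢
    have a1 := hl1 x (by simpa [hP] using hux)
    have a2 := hm1 y (by simpa [hQ] using hvy)
    have a3 := hl2 x
    have a4 := hm2 y
    have p1 : (0 : ℝ) < 2 ^ l x := zpow_pos two_pos _
    have p2 : (0 : ℝ) < 2 ^ m y := zpow_pos two_pos _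
    have hprod : N * (u x * v y) ≤ 4 * ((2 : ℝ) ^ l x * 2 ^ m y) := by
      calc N * (u x * v y) = (√N * u x) * (√N * v y) := by
            rw [mul_mul_mul_comm, hNN]
        _ ≤ (2 * 2 ^ l x) * (2 * 2 ^ m y) := by gcongr
        _ = _ := by ring
    have hFv : F (l x) (m y) = 4 * ((2 : ℝ) ^ l x * 2 ^ m y) / N := by
      simp only [F]
      rw [if_pos]
      refine ⟨h.trans_le hprod, ?_, ?_⟩
      · calc (2 : ℝ) ^ l x ≤ √N * u x := a1
          _ < √N * (√D * v y) := by gcongr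
          _ = √D * (√N * v y) := by ring
          _ < √D * (2 * 2 ^ m y) := by gcongr
          _ = _ := by ring
      · calc (2 : ℝ) ^ m y ≤ √N * v y := a2
          _ < √N * (√D * u x) := by gcongr
          _ = √D * (√N * u x) := by ring
          _ < √D * (2 * 2 ^ l x) := by gcongr
          _ = _ := by ring
    have : B x y * (u x * v y) ≤ B x y * F (l x) (m y) := by
      refine mul_le_mul_of_nonneg_left ?_ (hB x y)
      rw [hFv, le_div_iff₀ hN]
      linarith
    linarith
  refine (Finset.sum_le_sum fun x _ => Finset.sum_le_sum fun y _ => point x y).trans ?_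
  simp only [Finset.sum_add_distrib]
  have c1 : ∑ x, ∑ y, B x y * u x ^ 2 / √D ≤ K * √D := by
    have : ∀ x, ∑ y, B x y * u x ^ 2 / √D ≤ K * √D * u x ^ 2 := by
      intro x
      rw [← Finset.sum_div, ← Finset.sum_mul, div_le_iff₀ hr]
      have := mul_le_mul_of_nonneg_right (hrow x) (sq_nonneg (u x))
      calc _ ≤ K * D * u x ^ 2 := this
        _ = K * (√D * √D) * u x ^ 2 := by rw [hDD]
        _ = _ := by ring
    refine (Finset.sum_le_sum fun x _ => this x).trans ?_
    rw [← Finset.mul_sum]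
    refine mul_le_of_le_one_right ?_ hu1
    have : 0 < K := lt_of_lt_of_le (Real.exp_pos 1) hK
    positivity
  have c2 : ∑ x, ∑ y, B x y * v y ^ 2 / √D ≤ K * √D := by
    rw [Finset.sum_comm]
    have : ∀ y, ∑ x, B x y * v y ^ 2 / √D ≤ K * √D * v y ^ 2 := by
      intro y
      rw [← Finset.sum_div, ← Finset.sum_mul, div_le_iff₀ hr]
      have := mul_le_mul_of_nonneg_right (hcol y) (sq_nonneg (v y))
      calc _ ≤ K * D * v y ^ 2 := this
        _ = K * (√D * √D) * v y ^ 2 := by rw [hDD]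
        _ = _ := by ring
    refine (Finset.sum_le_sum fun y _ => this y).trans ?_
    rw [← Finset.mul_sum]
    refine mul_le_of_le_one_right ?_ hv1
    have : 0 < K := lt_of_lt_of_le (Real.exp_pos 1) hK
    positivity
  set s : ℤ → ℝ := fun i => #{x ∈ P | l x = i} with hs
  set t : ℤ → ℝ := fun j => #{y ∈ Q | m y = j} with ht
  set e : ℤ → ℤ → ℝ := fun i j => ∑ x ∈ P with l x = i, ∑ y ∈ Q with m y = j, B x y with he
  have he0 : ∀ i j, 0 ≤ e i j := fun i j =>
    Finset.sum_nonneg fun x _ => Finset.sum_nonneg fun y _ => hB x y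
  have hsN' : ∀ i, s i ≤ N := fun i => le_trans (by
    simp only [hs]; exact_mod_cast Finset.card_le_univ _) hα
  have htN' : ∀ j, t j ≤ N := fun j => le_trans (by
    simp only [ht]; exact_mod_cast Finset.card_le_univ _) hβ
  have hsα : ∑ i ∈ P.image l, s i * 4 ^ i / N ≤ 1 := sum_level_le hN hu1 P l hl1
  have htβ : ∑ j ∈ Q.image m, t j * 4 ^ j / N ≤ 1 := sum_level_le hN hv1 Q m hm1
  have hd : ∀ i j, 0 < s i → 0 < t j → e i j ≤ K * (s i * t j * D / N) ∨
      e i j * Real.log (e i j / (s i * t j * D / N)) ≤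
        K * max (s i) (t j) * Real.log (N / max (s i) (t j)) := by
    intro i j hi hj
    have := hdisc {x ∈ P | l x = i} {y ∈ Q | m y = j}
      (Finset.card_pos.1 (by simpa [hs] using hi)) (Finset.card_pos.1 (by simpa [ht] using hj))
    push_cast at this
    exact this
  have c3 : ∑ x, ∑ y, (if 0 < u x then if 0 < v y then B x y * F (l x) (m y) else 0 else 0) ≤
      296 * K * √D := by
    have h1 : ∑ x, ∑ y, (if 0 < u x then if 0 < v y then B x y * F (l x) (m y) else 0 else 0) =
        ∑ x ∈ P, ∑ y ∈ Q, B x y * F (l x) (m y) := by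
      rw [hP, hQ, Finset.sum_filter]
      refine Finset.sum_congr rfl fun x _ => ?_
      split_ifs
      · rw [Finset.sum_filter]
      · simp
    rw [h1, sum_fiberwise_levels]
    have A1 := dyadic_levels_sum_le hK hN hD (P.image l) (Q.image m) s t e
      (fun i => Nat.cast_nonneg _) (fun i => Nat.cast_nonneg _) htN' he0 hsα htβ
      (fun i j hi hij => by
        have := hd i j hi (hi.trans_le hij)
        rwa [max_eq_right hij] at this)
    have A2 := dyadic_levels_sum_le hK hN hD (Q.image m) (P.image l) t s (fun j i => e i j)
      (fun i => Nat.cast_nonneg _) (fun i => Nat.cast_nonneg _) hsN' (fun j i => he0 i j) htβ hsα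
      (fun j i hj hij => by
        have := hd i j (hj.trans_le hij) hj
        rw [max_eq_left hij] at this
        rwa [mul_comm (t j) (s i)])
    rw [Finset.sum_comm] at A2
    have : ∀ i ∈ P.image l, ∀ j ∈ Q.image m, e i j * F i j ≤
        (if 0 < s i ∧ s i ≤ t j ∧ √D < 4 * ((2 : ℝ) ^ i * 2 ^ j) ∧
          (2 : ℝ) ^ i < 2 * √D * 2 ^ j then e i j * (4 * ((2 : ℝ) ^ i * 2 ^ j)) / N else 0) +
        (if 0 < t j ∧ t j ≤ s i ∧ √D < 4 * ((2 : ℝ) ^ j * 2 ^ i) ∧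
          (2 : ℝ) ^ j < 2 * √D * 2 ^ i then e i j * (4 * ((2 : ℝ) ^ j * 2 ^ i)) / N else 0) := by
      intro i hi j hj
      have hsi : 0 < s i := by
        obtain ⟨x, hx, rfl⟩ := Finset.mem_image.1 hi
        simp only [hs, Nat.cast_pos]
        exact Finset.card_pos.2 ⟨x, by simp [hx]⟩
      have htj : 0 < t j := by
        obtain ⟨x, hx, rfl⟩ := Finset.mem_image.1 hj
        simp only [ht, Nat.cast_pos]
        exact Finset.card_pos.2 ⟨x, by simp [hx]⟩
      have q1 : 0 ≤ e i j * (4 * ((2 : ℝ) ^ i * 2 ^ j)) / N := by have := he0 i j; positivity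
      rw [mul_comm ((2 : ℝ) ^ j) (2 ^ i)]
      simp only [F]
      by_cases hc : √D < 4 * ((2 : ℝ) ^ i * 2 ^ j) ∧
          (2 : ℝ) ^ i < 2 * √D * 2 ^ j ∧ (2 : ℝ) ^ j < 2 * √D * 2 ^ i
      · rw [if_pos hc, ← mul_div_assoc]
        rcases le_total (s i) (t j) with hle | hle
        · rw [if_pos ⟨hsi, hle, hc.1, hc.2.1⟩]
          refine le_add_of_nonneg_right ?_
          split_ifs <;> first | exact q1 | exact le_rfl
        · rw [if_pos (⟨htj, hle, hc.1, hc.2.2⟩ : 0 < t j ∧ t j ≤ s i ∧ _ ∧ _)]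
          refine le_add_of_nonneg_left ?_
          split_ifs <;> first | exact q1 | exact le_rfl
      · rw [if_neg hc, mul_zero]
        refine add_nonneg ?_ ?_ <;> split_ifs <;> first | exact q1 | exact le_rfl
    refine (Finset.sum_le_sum fun i hi => Finset.sum_le_sum fun j hj => this i hi j hj).trans ?_
    simp only [Finset.sum_add_distrib]
    linarith
  linarith

end Heavy

section Net

variable {α β : Type*} [Fintype α] [Fintype β]

/-- The bilinear form of a matrix. -/
def bilin (E : α → β → ℝ) (u : α → ℝ) (v : β → ℝ) : ℝ := ∑ x, ∑ y, E x y * (u x * v y)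

theorem bilin_sub_left (E : α → β → ℝ) (u u' : α → ℝ) (v : β → ℝ) :
    bilin E (fun x => u x - u' x) v = bilin E u v - bilin E u' v := by
  simp only [bilin, ← Finset.sum_sub_distrib]
  exact Finset.sum_congr rfl fun x _ => Finset.sum_congr rfl fun y _ => by ring

theorem bilin_sub_right (E : α → β → ℝ) (u : α → ℝ) (v v' : β → ℝ) :
    bilin E u (fun y => v y - v' y) = bilin E u v - bilin E u v' := by
  simp only [bilin, ← Finset.sum_sub_distrib]
  exact Finset.sum_congr rfl fun x _ => Finset.sum_congr rfl fun y _ => by ring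

theorem bilin_smul (E : α → β → ℝ) (a b : ℝ) (u : α → ℝ) (v : β → ℝ) :
    bilin E (fun x => a * u x) (fun y => b * v y) = a * b * bilin E u v := by
  simp only [bilin, Finset.mul_sum]
  exact Finset.sum_congr rfl fun x _ => Finset.sum_congr rfl fun y _ => by ring

theorem bilin_le_of_unit {E : α → β → ℝ} {Λ : ℝ}
    (h : ∀ u v, ∑ x, u x ^ 2 ≤ 1 → ∑ y, v y ^ 2 ≤ 1 → |bilin E u v| ≤ Λ) (u : α → ℝ) (v : β → ℝ) :
    |bilin E u v| ≤ Λ * √(∑ x, u x ^ 2) * √(∑ y, v y ^ 2) := by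
  have hu0 : 0 ≤ ∑ x, u x ^ 2 := Finset.sum_nonneg fun _ _ => sq_nonneg _
  have hv0 : 0 ≤ ∑ y, v y ^ 2 := Finset.sum_nonneg fun _ _ => sq_nonneg _
  obtain ⟨r, hr⟩ : ∃ r, r = √(∑ x, u x ^ 2) := ⟨_, rfl⟩
  obtain ⟨s, hs⟩ : ∃ s, s = √(∑ y, v y ^ 2) := ⟨_, rfl⟩
  have hr2 : r ^ 2 = ∑ x, u x ^ 2 := by rw [hr, Real.sq_sqrt hu0]
  have hs2 : s ^ 2 = ∑ y, v y ^ 2 := by rw [hs, Real.sq_sqrt hv0]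
  rw [← hr, ← hs]
  rcases (Real.sqrt_nonneg _ : 0 ≤ √(∑ x, u x ^ 2)).eq_or_lt with h0 | hr0
  · have hz : ∀ x, u x = 0 := fun x => by
      have : ∑ x, u x ^ 2 = 0 := by rw [← hr2, hr, ← h0]; norm_num
      have := (Finset.sum_eq_zero_iff_of_nonneg (fun x _ => sq_nonneg (u x))).1 this x (Finset.mem_univ x)
      exact pow_eq_zero_iff (two_ne_zero) |>.1 this
    rw [hr, ← h0]; simp [bilin, hz]
  rcases (Real.sqrt_nonneg _ : 0 ≤ √(∑ y, v y ^ 2)).eq_or_lt with h0 | hs0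
  · have hz : ∀ y, v y = 0 := fun x => by
      have : ∑ x, v x ^ 2 = 0 := by rw [← hs2, hs, ← h0]; norm_num
      have := (Finset.sum_eq_zero_iff_of_nonneg (fun x _ => sq_nonneg (v x))).1 this x (Finset.mem_univ x)
      exact pow_eq_zero_iff (two_ne_zero) |>.1 this
    rw [hs, ← h0]; simp [bilin, hz]
  rw [← hr] at hr0
  rw [← hs] at hs0
  have h1 := h (fun x => r⁻¹ * u x) (fun y => s⁻¹ * v y)
    (by simp only [mul_pow]; rw [← Finset.mul_sum, ← hr2]; field_simp; exact le_rfl)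
    (by simp only [mul_pow]; rw [← Finset.mul_sum, ← hs2]; field_simp; exact le_rfl)
  rw [bilin_smul, abs_mul, abs_of_pos (by positivity : 0 < r⁻¹ * s⁻¹)] at h1
  have : |bilin E u v| = r * s * (r⁻¹ * s⁻¹ * |bilin E u v|) := by field_simp
  rw [this]
  calc _ ≤ r * s * Λ := by gcongr
    _ = _ := by ring

/-- The vectors of the net are `z / (4 √N)` with `z` in this set. -/
noncomputable def latticeBall (α : Type*) [Fintype α] [DecidableEq α] (N : ℝ) : Finset (α → ℤ) :=
  {z ∈ Fintype.piFinset fun _ : α => Finset.Icc (-⌈16 * N⌉) ⌈16 * N⌉ | ∑ x, (z x : ℝ) ^ 2 ≤ 16 * N}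

theorem mem_latticeBall [DecidableEq α] {N : ℝ} {z : α → ℤ} :
    z ∈ latticeBall α N ↔ ∑ x, (z x : ℝ) ^ 2 ≤ 16 * N := by
  simp only [latticeBall, Finset.mem_filter, Fintype.mem_piFinset, Finset.mem_Icc,
    and_iff_right_iff_imp]
  intro h x
  have h1 : (z x : ℝ) ^ 2 ≤ 16 * N :=
    (Finset.single_le_sum (f := fun x => (z x : ℝ) ^ 2) (fun x _ => sq_nonneg _)
      (Finset.mem_univ x)).trans h
  have h2 : z x ^ 2 ≤ ⌈16 * N⌉ := by
    exact_mod_cast h1.trans (Int.le_ceil _)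
  constructor <;> nlinarith

theorem sum_exp_neg_sq_le (I : Finset ℤ) : ∑ c ∈ I, Real.exp (-(c : ℝ) ^ 2) ≤ Real.exp 3 := by
  have h1 : ∀ c ∈ I, Real.exp (-(c : ℝ) ^ 2) ≤ (if (2 : ℝ) ^ c < 2 then 2 ^ c else 0) +
      (if 1 / 2 < (2 : ℝ) ^ c then 2 ^ (-c) else 0) := by
    intro c _
    have hexp : ∀ a : ℤ, 0 ≤ a → Real.exp (-(a : ℝ) ^ 2) ≤ (2 : ℝ) ^ (-a) := by
      intro a ha
      obtain ⟨m, rfl⟩ := Int.eq_ofNat_of_zero_le ha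
      have h2 : (2 : ℝ) ^ m ≤ Real.exp 1 ^ m := by
        gcongr
        have := Real.add_one_lt_exp (one_ne_zero (α := ℝ)); linarith
      rw [zpow_neg, Real.exp_neg, inv_le_inv₀ (Real.exp_pos _) (by positivity)]
      push_cast
      rw [zpow_natCast]
      refine h2.trans ?_
      rw [← Real.exp_nat_mul]
      refine Real.exp_le_exp.2 ?_
      rw [mul_one]
      exact_mod_cast Nat.le_self_pow two_ne_zero m
    have p1 : (0 : ℝ) < 2 ^ c := zpow_pos two_pos _
    have p2 : (0 : ℝ) < 2 ^ (-c) := zpow_pos two_pos _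
    rcases le_total 0 c with hc | hc
    · rw [if_pos (show 1 / 2 < (2 : ℝ) ^ c by
        have : (1 : ℝ) ≤ 2 ^ c := one_le_zpow₀ (by norm_num) hc
        linarith)]
      refine (hexp c hc).trans (le_add_of_nonneg_left ?_)
      split_ifs <;> positivity
    · rw [if_pos (show (2 : ℝ) ^ c < 2 by
        have : (2 : ℝ) ^ c ≤ 1 := zpow_le_one_of_nonpos₀ (by norm_num) hc
        linarith)]
      have := hexp (-c) (by omega)
      push_cast at this
      rw [neg_sq, neg_neg] at this
      refine this.trans (le_add_of_nonneg_right ?_)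
      split_ifs <;> positivity
  refine (Finset.sum_le_sum h1).trans ?_
  rw [Finset.sum_add_distrib, ← Finset.sum_filter, ← Finset.sum_filter]
  have a1 := sum_zpow_two_lt_le I (c := 2) (by norm_num)
  have a2 := sum_zpow_two_neg_lt_le I (c := 1 / 2) (by norm_num)
  have a3 : (8 : ℝ) ≤ Real.exp 3 := by
    have h2 : (2 : ℝ) ≤ Real.exp 1 := by
      have := Real.add_one_lt_exp (one_ne_zero (α := ℝ)); linarith
    calc (8 : ℝ) = 2 ^ 3 := by norm_num
      _ ≤ Real.exp 1 ^ 3 := by gcongr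
      _ = Real.exp 3 := by rw [← Real.exp_nat_mul]; norm_num
  linarith

theorem card_latticeBall_le [DecidableEq α] {N : ℝ} (hα : (Fintype.card α : ℝ) ≤ N) :
    (#(latticeBall α N) : ℝ) ≤ Real.exp (19 * N) := by
  have h1 : (#(latticeBall α N) : ℝ) ≤
      ∑ z ∈ Fintype.piFinset fun _ : α => Finset.Icc (-⌈16 * N⌉) ⌈16 * N⌉,
        Real.exp (16 * N) * ∏ x, Real.exp (-(z x : ℝ) ^ 2) := by
    rw [latticeBall, Finset.card_eq_sum_ones, Finset.sum_filter]
    push_cast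
    refine Finset.sum_le_sum fun z _ => ?_
    rw [← Real.exp_sum, ← Real.exp_add]
    split_ifs with h
    · refine Real.one_le_exp ?_
      rw [Finset.sum_neg_distrib]; linarith
    · exact (Real.exp_pos _).le
  refine h1.trans ?_
  rw [← Finset.mul_sum, Finset.sum_prod_piFinset (g := fun (_ : α) (c : ℤ) => Real.exp (-(c : ℝ) ^ 2))]
  rw [Finset.prod_const, Finset.card_univ]
  calc Real.exp (16 * N) * (∑ c ∈ Finset.Icc (-⌈16 * N⌉) ⌈16 * N⌉, Real.exp (-(c : ℝ) ^ 2)) ^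
        Fintype.card α
      ≤ Real.exp (16 * N) * Real.exp 3 ^ Fintype.card α := by
        gcongr
        exact sum_exp_neg_sq_le _
    _ = Real.exp (16 * N + Fintype.card α * 3) := by rw [← Real.exp_nat_mul, Real.exp_add]
    _ ≤ _ := Real.exp_le_exp.2 (by linarith)

theorem exists_lattice_approx [DecidableEq α] {N : ℝ} (hN : 0 < N)
    (hα : (Fintype.card α : ℝ) ≤ N) (u : α → ℝ) (hu : ∑ x, u x ^ 2 ≤ 1) :
    ∃ z ∈ latticeBall α N,
      ∑ x, (3 / 4 * u x - z x / (4 * √N)) ^ 2 ≤ (1 / 4) ^ 2 := by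
  have hs : 0 < √N := Real.sqrt_pos.2 hN
  have hNN : √N ^ 2 = N := Real.sq_sqrt hN.le
  set z : α → ℤ := fun x => ⌊3 * √N * u x⌋ with hz
  have herr : ∑ x, (3 / 4 * u x - z x / (4 * √N)) ^ 2 ≤ (1 / 4) ^ 2 := by
    have : ∀ x, (3 / 4 * u x - z x / (4 * √N)) ^ 2 ≤ (1 / 4) ^ 2 / N := by
      intro x
      have h1 : 3 / 4 * u x - z x / (4 * √N) = (3 * √N * u x - z x) / (4 * √N) := by
        field_simp
      rw [h1, div_pow, mul_pow, hNN]
      have h2 := Int.fract_nonneg (3 * √N * u x)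
      have h3 := (Int.fract_lt_one (3 * √N * u x)).le
      rw [Int.fract] at h2 h3
      rw [div_le_div_iff₀ (by positivity) hN]
      have : (3 * √N * u x - z x) ^ 2 ≤ 1 := by
        simp only [hz]; nlinarith
      nlinarith
    refine (Finset.sum_le_sum fun x _ => this x).trans ?_
    rw [Finset.sum_const, Finset.card_univ, nsmul_eq_mul, mul_div_assoc', div_le_iff₀ hN]
    nlinarith
  refine ⟨z, mem_latticeBall.2 ?_, herr⟩
  -- triangle inequality in squared form: `|b|² ≤ 4/3 |a|² + 4 |a - b|²`
  have h1 : ∀ x, ((z x : ℝ) / (4 * √N)) ^ 2 ≤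
      4 / 3 * (3 / 4 * u x) ^ 2 + 4 * (3 / 4 * u x - z x / (4 * √N)) ^ 2 := fun x => by
    nlinarith [sq_nonneg (3 * (3 / 4 * u x - z x / (4 * √N)) + (z x / (4 * √N))),
      sq_nonneg (3 / 4 * u x - 4 * (3 / 4 * u x - z x / (4 * √N))),
      sq_nonneg ((3 / 4 * u x) + 3 * (3 / 4 * u x - z x / (4 * √N)))]
  have h2 : ∑ x, ((z x : ℝ) / (4 * √N)) ^ 2 ≤ 1 := by
    refine (Finset.sum_le_sum fun x _ => h1 x).trans ?_
    rw [Finset.sum_add_distrib, ← Finset.mul_sum, ← Finset.mul_sum]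
    have : ∑ x, (3 / 4 * u x) ^ 2 ≤ (3 / 4) ^ 2 := by
      simp only [mul_pow]; rw [← Finset.mul_sum]; nlinarith
    linarith
  have h3 : ∑ x, ((z x : ℝ) / (4 * √N)) ^ 2 = (∑ x, (z x : ℝ) ^ 2) / (16 * N) := by
    rw [Finset.sum_div]
    refine Finset.sum_congr rfl fun x _ => ?_
    rw [div_pow, mul_pow, hNN]; norm_num
  rw [h3, div_le_one (by positivity)] at h2
  exact h2

theorem bilin_le_of_lattice [DecidableEq α] [DecidableEq β] {N : ℝ} (hN : 0 < N)
    (hα : (Fintype.card α : ℝ) ≤ N) (hβ : (Fintype.card β : ℝ) ≤ N) {E : α → β → ℝ} {c : ℝ}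
    (h : ∀ z ∈ latticeBall α N, ∀ z' ∈ latticeBall β N,
      |bilin E (fun x => z x / (4 * √N)) (fun y => z' y / (4 * √N))| ≤ c)
    (u : α → ℝ) (v : β → ℝ) :
    |bilin E u v| ≤ 8 * c * √(∑ x, u x ^ 2) * √(∑ y, v y ^ 2) := by
  have hNN : √N ^ 2 = N := Real.sq_sqrt hN.le
  set A : Set ℝ := {q | ∃ (u : α → ℝ) (v : β → ℝ), ∑ x, u x ^ 2 ≤ 1 ∧ ∑ y, v y ^ 2 ≤ 1 ∧
    q = |bilin E u v|} with hA
  have hbdd : BddAbove A := by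
    refine ⟨∑ x, ∑ y, |E x y|, ?_⟩
    rintro q ⟨u, v, hu, hv, rfl⟩
    refine (Finset.abs_sum_le_sum_abs _ _).trans (Finset.sum_le_sum fun x _ =>
      (Finset.abs_sum_le_sum_abs _ _).trans (Finset.sum_le_sum fun y _ => ?_))
    have hux : |u x| ≤ 1 := by
      rw [← sq_le_one_iff_abs_le_one]
      exact (Finset.single_le_sum (f := fun x => u x ^ 2) (fun _ _ => sq_nonneg _)
        (Finset.mem_univ x)).trans hu
    have hvy : |v y| ≤ 1 := by
      rw [← sq_le_one_iff_abs_le_one]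
      exact (Finset.single_le_sum (f := fun x => v x ^ 2) (fun _ _ => sq_nonneg _)
        (Finset.mem_univ y)).trans hv
    rw [abs_mul, abs_mul]
    exact mul_le_of_le_one_right (abs_nonneg _)
      (mul_le_one₀ hux (abs_nonneg _) hvy)
  have hle : ∀ u v, ∑ x, u x ^ 2 ≤ 1 → ∑ y, v y ^ 2 ≤ 1 → |bilin E u v| ≤ sSup A :=
    fun u v hu hv => le_csSup hbdd ⟨u, v, hu, hv, rfl⟩
  have hgen := bilin_le_of_unit hle
  have hΛ0 : 0 ≤ sSup A := (abs_nonneg _).trans (hle 0 0 (by simp) (by simp))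
  have hstep : sSup A ≤ 16 / 9 * c + 7 / 9 * sSup A := by
    refine csSup_le ⟨_, 0, 0, by simp, by simp, rfl⟩ ?_
    rintro q ⟨u, v, hu, hv, rfl⟩
    obtain ⟨z, hz, hze⟩ := exists_lattice_approx hN hα u hu
    obtain ⟨z', hz', hze'⟩ := exists_lattice_approx hN hβ v hv
    have e1 : bilin E (fun x => 3 / 4 * u x) (fun y => 3 / 4 * v y) =
        bilin E (fun x => z x / (4 * √N)) (fun y => z' y / (4 * √N)) +
        bilin E (fun x => z x / (4 * √N)) (fun y => 3 / 4 * v y - z' y / (4 * √N)) +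
        bilin E (fun x => 3 / 4 * u x - z x / (4 * √N)) (fun y => 3 / 4 * v y) := by
      rw [bilin_sub_left, bilin_sub_right]; ring
    rw [bilin_smul] at e1
    have hzn : √(∑ x, ((z x : ℝ) / (4 * √N)) ^ 2) ≤ 1 := by
      rw [Real.sqrt_le_left (by norm_num), one_pow]
      have := mem_latticeBall.1 hz
      simp only [div_pow, mul_pow, hNN]
      rw [← Finset.sum_div, div_le_one (by positivity)]
      linarith
    have hvn : √(∑ y, (3 / 4 * v y) ^ 2) ≤ 3 / 4 := by
      rw [Real.sqrt_le_left (by norm_num)]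
      simp only [mul_pow]; rw [← Finset.mul_sum]; nlinarith
    have hd : √(∑ x, (3 / 4 * u x - z x / (4 * √N)) ^ 2) ≤ 1 / 4 := by
      rwa [Real.sqrt_le_left (by norm_num)]
    have hd' : √(∑ y, (3 / 4 * v y - z' y / (4 * √N)) ^ 2) ≤ 1 / 4 := by
      rwa [Real.sqrt_le_left (by norm_num)]
    have i1 := h z hz z' hz'
    have i2 : |bilin E (fun x => z x / (4 * √N)) (fun y => 3 / 4 * v y - z' y / (4 * √N))| ≤
        sSup A * 1 * (1 / 4) := (hgen _ _).trans (by gcongr)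
    have i3 : |bilin E (fun x => 3 / 4 * u x - z x / (4 * √N)) (fun y => 3 / 4 * v y)| ≤
        sSup A * (1 / 4) * (3 / 4) := (hgen _ _).trans (by gcongr)
    have i4 : |3 / 4 * (3 / 4) * bilin E u v| = 9 / 16 * |bilin E u v| := by
      rw [abs_mul, abs_of_pos (by norm_num)]; norm_num
    have := abs_add_three (bilin E (fun x => z x / (4 * √N)) (fun y => z' y / (4 * √N)))
      (bilin E (fun x => z x / (4 * √N)) (fun y => 3 / 4 * v y - z' y / (4 * √N)))
      (bilin E (fun x => 3 / 4 * u x - z x / (4 * √N)) (fun y => 3 / 4 * v y))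
    rw [← e1, i4] at this
    linarith
  refine (hgen u v).trans ?_
  have : sSup A ≤ 8 * c := by linarith
  gcongr

end Net

section RandomBipartite

variable {ι κ : Type*} [Fintype ι] [DecidableEq ι] [Fintype κ] {w : ι → κ → ℝ}

theorem ex_exp_sum_le {σ : Type*} (hw : IsWeight w) (s : Finset σ) (φ : σ → ι)
    (hφ : Set.InjOn φ s) (h : σ → κ → ℝ) (h01 : ∀ a x, h a x = 0 ∨ h a x = 1) (θ : ℝ) :
    ex w (fun ω => Real.exp (θ * ∑ a ∈ s, h a (ω (φ a)))) ≤
      Real.exp ((Real.exp θ - 1) * ∑ a ∈ s, ∑ x, w (φ a) x * h a x) := by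
  simp_rw [Finset.mul_sum s, Real.exp_sum]
  rw [ex_prod hw s φ hφ (fun a x => Real.exp (θ * h a x))]
  refine Finset.prod_le_prod (fun a _ => Finset.sum_nonneg fun x _ =>
    mul_nonneg (hw.nonneg _ _) (Real.exp_pos _).le) fun a _ => ?_
  have h1 : ∀ x, w (φ a) x * Real.exp (θ * h a x) =
      w (φ a) x + (Real.exp θ - 1) * (w (φ a) x * h a x) := by
    intro x
    rcases h01 a x with h | h <;> rw [h] <;> simp
    ring
  simp_rw [h1]
  rw [Finset.sum_add_distrib, hw.sum_eq, ← Finset.mul_sum]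
  rw [add_comm]
  exact Real.add_one_le_exp _

/-- Chernoff bound for a sum of independent indicators. -/
theorem pr_sum_ge_le {σ : Type*} (hw : IsWeight w) (s : Finset σ) (φ : σ → ι)
    (hφ : Set.InjOn φ s) (h : σ → κ → ℝ) (h01 : ∀ a x, h a x = 0 ∨ h a x = 1) {θ μ : ℝ}
    (hθ : 0 ≤ θ) (hμ : ∑ a ∈ s, ∑ x, w (φ a) x * h a x ≤ μ) (r : ℝ) :
    pr w (fun ω => r ≤ ∑ a ∈ s, h a (ω (φ a))) ≤ Real.exp ((Real.exp θ - 1) * μ - θ * r) := by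
  have h1 := pr_le_of_ex_le hw (fun ω => (Real.exp_pos (θ * ∑ a ∈ s, h a (ω (φ a)))).le)
    (Real.exp_pos (θ * r)) (ex_exp_sum_le hw s φ hφ h h01 θ)
    (P := fun ω => r ≤ ∑ a ∈ s, h a (ω (φ a)))
    (fun ω hω => Real.exp_le_exp.2 (mul_le_mul_of_nonneg_left hω hθ))
  refine h1.trans ?_
  rw [← Real.exp_sub]
  refine Real.exp_le_exp.2 ?_
  have : 0 ≤ Real.exp θ - 1 := by have := Real.add_one_le_exp θ; linarith
  have := mul_le_mul_of_nonneg_left hμ this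
  linarith

variable {α β : Type*} [Fintype α] [DecidableEq α] [Fintype β] [DecidableEq β]

/-- A random bipartite graph: the entry `(x, y)` of its biadjacency matrix is `g x y (ω (φ x y))`. -/
structure IsRandomBipartite (w : ι → κ → ℝ) (φ : α → β → ι) (g : α → β → κ → ℝ)
    (N D : ℝ) : Prop where
  weight : IsWeight w
  inj : ∀ x y x' y', φ x y = φ x' y' → x = x' ∧ y = y'
  zero_one : ∀ x y c, g x y c = 0 ∨ g x y c = 1
  mean_le : ∀ x y, ∑ c, w (φ x y) c * g x y c ≤ D / N
  card_left : (Fintype.card α : ℝ) ≤ N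
  card_right : (Fintype.card β : ℝ) ≤ N

/-- The mean of the entry `(x, y)`. -/
def entryMean (w : ι → κ → ℝ) (φ : α → β → ι) (g : α → β → κ → ℝ) (x : α) (y : β) : ℝ :=
  ∑ c, w (φ x y) c * g x y c

variable {φ : α → β → ι} {g : α → β → κ → ℝ} {N D : ℝ}

theorem IsRandomBipartite.mean_nonneg (H : IsRandomBipartite w φ g N D) (x : α) (y : β) :
    0 ≤ entryMean w φ g x y :=
  Finset.sum_nonneg fun c _ => mul_nonneg (H.weight.nonneg _ _) (by
    rcases H.zero_one x y c with h | h <;> rw [h]; exact zero_le_one)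

theorem IsRandomBipartite.pr_edgeSum_ge_le (H : IsRandomBipartite w φ g N D) (S : Finset α)
    (T : Finset β) {r : ℝ} (hμ : 0 < #S * #T * D / N)
    (hr : Real.exp 2 * (#S * #T * D / N) ≤ r) :
    pr w (fun ω => r ≤ edgeSum (fun x y => g x y (ω (φ x y))) S T) ≤
      Real.exp (-(r * Real.log (r / (#S * #T * D / N)) / 2)) := by
  obtain ⟨μ, hμd⟩ : ∃ μ : ℝ, μ = #S * #T * D / N := ⟨_, rfl⟩
  rw [← hμd] at hμ hr ⊢
  have hr0 : 0 < r := lt_of_lt_of_le (by positivity) hr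
  have hL : 2 ≤ Real.log (r / μ) := by
    rw [Real.le_log_iff_exp_le (by positivity), le_div_iff₀ hμ]; exact hr
  have h1 := pr_sum_ge_le H.weight (S ×ˢ T) (fun a : α × β => φ a.1 a.2)
    (by rintro ⟨x, y⟩ _ ⟨x', y'⟩ _ h
        obtain ⟨h1, h2⟩ := H.inj x y x' y' h
        exact Prod.ext h1 h2)
    (fun a => g a.1 a.2) (fun a x => H.zero_one _ _ _) (θ := Real.log (r / μ)) (μ := μ)
    (by linarith) (by
      refine (Finset.sum_le_sum fun a _ => H.mean_le a.1 a.2).trans ?_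
      rw [Finset.sum_const, Finset.card_product, nsmul_eq_mul, hμd]
      push_cast
      rw [mul_div_assoc]) r
  refine le_trans (le_of_eq ?_) (h1.trans (Real.exp_le_exp.2 ?_))
  · simp only [edgeSum, Finset.sum_product]
  · rw [Real.exp_log (by positivity)]
    have : (r / μ - 1) * μ = r - μ := by field_simp
    rw [this]
    nlinarith

/-- The alternative of the discrepancy property for sets that are not too large. -/
def SmallDiscrepancy (K N D : ℝ) (B : α → β → ℝ) : Prop :=
  ∀ (S : Finset α) (T : Finset β), S.Nonempty → T.Nonempty →
    Real.exp 1 * (max #S #T : ℕ) ≤ N →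
    edgeSum B S T ≤ K * (#S * #T * D / N) ∨
    edgeSum B S T * Real.log (edgeSum B S T / (#S * #T * D / N)) ≤
      K * (max #S #T : ℕ) * Real.log (N / (max #S #T : ℕ))

theorem IsRandomBipartite.pr_discrepant_le (H : IsRandomBipartite w φ g N D) (hN : 0 < N)
    (hD : 0 < D) {K : ℝ} (hK : Real.exp 2 ≤ K) (S : Finset α) (T : Finset β)
    (hS : S.Nonempty) (hT : T.Nonempty) (L : ℝ) :
    pr w (fun ω => ¬ (edgeSum (fun x y => g x y (ω (φ x y))) S T ≤ K * (#S * #T * D / N) ∨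
      edgeSum (fun x y => g x y (ω (φ x y))) S T *
        Real.log (edgeSum (fun x y => g x y (ω (φ x y))) S T / (#S * #T * D / N)) ≤ L)) ≤
      Real.exp (-(L / 2)) := by
  classical
  have hμ : 0 < #S * #T * D / N := by
    have := hS.card_pos; have := hT.card_pos; positivity
  obtain ⟨μ, hμd⟩ : ∃ μ : ℝ, μ = #S * #T * D / N := ⟨_, rfl⟩
  have hnat : ∀ ω : ι → κ, ∃ m : ℕ, edgeSum (fun x y => g x y (ω (φ x y))) S T = m := by
    intro ω
    have : ∀ x y, ∃ m : ℕ, g x y (ω (φ x y)) = m := fun x y => by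
      rcases H.zero_one x y (ω (φ x y)) with h | h
      · exact ⟨0, by simp [h]⟩
      · exact ⟨1, by simp [h]⟩
    choose m hm using this
    exact ⟨∑ x ∈ S, ∑ y ∈ T, m x y, by simp [edgeSum, hm]⟩
  by_cases hex : ∃ m : ℕ, K * μ < m ∧ L < m * Real.log (m / μ)
  · have h0 := Nat.find_spec hex
    set m := Nat.find hex
    have hmin : ∀ ω : ι → κ, ¬ (edgeSum (fun x y => g x y (ω (φ x y))) S T ≤ K * (#S * #T * D / N) ∨
      edgeSum (fun x y => g x y (ω (φ x y))) S T *
        Real.log (edgeSum (fun x y => g x y (ω (φ x y))) S T / (#S * #T * D / N)) ≤ L) →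
        (m : ℝ) ≤ edgeSum (fun x y => g x y (ω (φ x y))) S T := by
      intro ω hω
      obtain ⟨e, he⟩ := hnat ω
      rw [he, ← hμd] at hω
      rw [he]
      push Not at hω
      exact_mod_cast Nat.find_min' hex hω
    refine (pr_mono H.weight hmin).trans ((H.pr_edgeSum_ge_le S T hμ ?_).trans ?_)
    · rw [← hμd] at hμ ⊢
      exact (mul_le_mul_of_nonneg_right hK hμ.le).trans h0.1.le
    · rw [← hμd]
      refine Real.exp_le_exp.2 ?_
      linarith [h0.2]
  · refine (pr_mono H.weight (Q := fun _ => False) ?_).trans ?_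
    · intro ω hω
      obtain ⟨e, he⟩ := hnat ω
      rw [he, ← hμd] at hω
      push Not at hω
      exact hex ⟨e, hω⟩
    · simp [pr, ex, (Real.exp_pos _).le]

theorem mul_log_div_mono {N s t : ℝ} (hs : 0 < s) (hst : s ≤ t) (ht : Real.exp 1 * t ≤ N) :
    s * Real.log (N / s) ≤ t * Real.log (N / t) := by
  have ht0 : 0 < t := by linarith
  have hN : 0 < N := lt_of_lt_of_le (by positivity) ht
  have h1 : 1 ≤ Real.log (N / t) := by
    rw [Real.le_log_iff_exp_le (by positivity), le_div_iff₀ ht0]; exact ht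
  have h2 : Real.log (N / s) = Real.log (N / t) + Real.log (t / s) := by
    rw [← Real.log_mul (by positivity) (by positivity)]
    congr 1; field_simp
  have h3 : s * Real.log (t / s) ≤ t - s := by
    have := Real.log_le_sub_one_of_pos (show 0 < t / s by positivity)
    calc s * Real.log (t / s) ≤ s * (t / s - 1) := by gcongr
      _ = t - s := by field_simp
  rw [h2]
  nlinarith

theorem choose_le_exp {m s : ℕ} {N : ℝ} (hs : 0 < s) (hm : (m : ℝ) ≤ N)
    (hsN : Real.exp 1 * s ≤ N) : (m.choose s : ℝ) ≤ Real.exp (2 * (s * Real.log (N / s))) := by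
  have hs0 : (0 : ℝ) < s := by exact_mod_cast hs
  have hN : 0 < N := lt_of_lt_of_le (by positivity) hsN
  have h1 : 1 ≤ Real.log (N / s) := by
    rw [Real.le_log_iff_exp_le (by positivity), le_div_iff₀ hs0]; exact hsN
  have h2 : (m.choose s : ℝ) ≤ (m : ℝ) ^ s / s.factorial := Nat.choose_le_pow_div s m
  have h3 : (s : ℝ) ^ s / s.factorial ≤ Real.exp s := Real.pow_div_factorial_le_exp _ hs0.le s
  have h4 : (m : ℝ) ^ s / s.factorial ≤ (N / s) ^ s * ((s : ℝ) ^ s / s.factorial) := by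
    rw [div_pow, div_mul_div_cancel₀ (by positivity)]
    gcongr
  calc (m.choose s : ℝ) ≤ (N / s) ^ s * Real.exp s :=
        h2.trans (h4.trans (by gcongr))
    _ = Real.exp (s * Real.log (N / s) + s) := by
        rw [Real.exp_add, Real.exp_nat_mul, Real.exp_log (by positivity)]
    _ ≤ _ := Real.exp_le_exp.2 (by nlinarith)

theorem sum_small_sets_le {N : ℝ} (hα : (Fintype.card α : ℝ) ≤ N) (hN : 1 ≤ N) :
    ∑ S : Finset α, (if S.Nonempty ∧ Real.exp 1 * #S ≤ N then
      Real.exp (-(15 * (#S * Real.log (N / #S)))) else 0) ≤ 1 / N := by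
  have h1 : ∀ s ∈ Finset.range (Fintype.card α + 1),
      ∑ S ∈ Finset.powersetCard s (Finset.univ : Finset α), (if S.Nonempty ∧ Real.exp 1 * #S ≤ N then
      Real.exp (-(15 * (#S * Real.log (N / #S)))) else 0) ≤ if s = 0 then 0 else 1 / N ^ 2 := by
    intro s _
    have h2 : ∀ S ∈ Finset.powersetCard s (Finset.univ : Finset α),
        (if S.Nonempty ∧ Real.exp 1 * #S ≤ N then
        Real.exp (-(15 * (#S * Real.log (N / #S)))) else 0) =
        if 0 < s ∧ Real.exp 1 * s ≤ N then Real.exp (-(15 * (s * Real.log (N / s)))) else 0 := by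
      intro S hS
      have hc := (Finset.mem_powersetCard.1 hS).2
      simp only [← Finset.card_pos, hc]
    rw [Finset.sum_congr rfl h2, Finset.sum_const, Finset.card_powersetCard, Finset.card_univ,
      nsmul_eq_mul]
    split_ifs with h h' h'
    · omega
    · have hs0 : (1 : ℝ) ≤ s := by exact_mod_cast h.1
      have hc := choose_le_exp h.1 hα h.2
      have hlog := mul_log_div_mono (N := N) one_pos hs0 h.2
      rw [div_one, one_mul] at hlog
      have hN0 : 0 < N := by linarith
      calc _ ≤ Real.exp (2 * (s * Real.log (N / s))) * Real.exp (-(15 * (s * Real.log (N / s)))) := by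
            gcongr
        _ = Real.exp (-(13 * (s * Real.log (N / s)))) := by rw [← Real.exp_add]; congr 1; ring
        _ ≤ Real.exp (-(2 * Real.log N)) := by
            refine Real.exp_le_exp.2 ?_
            have := Real.log_nonneg hN
            linarith
        _ = 1 / N ^ 2 := by
            rw [Real.exp_neg, one_div, two_mul, Real.exp_add, Real.exp_log hN0, sq]
    · simp
    · simp only [mul_zero]; positivity
  rw [← Finset.powerset_univ, Finset.sum_powerset]
  refine (Finset.sum_le_sum h1).trans ?_
  rw [Finset.sum_range_succ']
  simp only [Nat.add_eq_zero_iff, one_ne_zero, and_false, if_false, if_true, add_zero,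
    Finset.sum_const, Finset.card_range, nsmul_eq_mul]
  have hN0 : 0 < N := by linarith
  rw [mul_one_div, div_le_div_iff₀ (by positivity) hN0]
  nlinarith

theorem IsRandomBipartite.pr_not_smallDiscrepancy_le (H : IsRandomBipartite w φ g N D)
    (hN : 1 ≤ N) (hD : 0 < D) :
    pr w (fun ω => ¬ SmallDiscrepancy 60 N D (fun x y => g x y (ω (φ x y)))) ≤ 1 / N := by
  have hN0 : 0 < N := by linarith
  have h60 : Real.exp 2 ≤ 60 := by
    have : Real.exp 2 = Real.exp 1 ^ 2 := by rw [← Real.exp_nat_mul]; norm_num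
    rw [this]
    have := Real.exp_one_lt_three
    nlinarith [Real.exp_pos 1]
  let Bad : Finset α × Finset β → (ι → κ) → Prop := fun p ω =>
    (p.1.Nonempty ∧ p.2.Nonempty ∧ Real.exp 1 * (max #p.1 #p.2 : ℕ) ≤ N) ∧
    ¬ (edgeSum (fun x y => g x y (ω (φ x y))) p.1 p.2 ≤ 60 * (#p.1 * #p.2 * D / N) ∨
      edgeSum (fun x y => g x y (ω (φ x y))) p.1 p.2 *
        Real.log (edgeSum (fun x y => g x y (ω (φ x y))) p.1 p.2 / (#p.1 * #p.2 * D / N)) ≤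
          60 * (max #p.1 #p.2 : ℕ) * Real.log (N / (max #p.1 #p.2 : ℕ)))
  have h1 : pr w (fun ω => ¬ SmallDiscrepancy 60 N D (fun x y => g x y (ω (φ x y)))) ≤
      ∑ p : Finset α × Finset β, pr w (Bad p) := by
    refine (pr_mono H.weight ?_).trans (pr_exists_le H.weight Finset.univ Bad)
    intro ω hω
    unfold SmallDiscrepancy at hω
    push Not at hω
    obtain ⟨S, T, hS, hT, hle, h⟩ := hω
    exact ⟨(S, T), Finset.mem_univ _, ⟨hS, hT, hle⟩, by push Not; exact h⟩
  have h2 : ∀ p : Finset α × Finset β, pr w (Bad p) ≤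
      (if p.1.Nonempty ∧ Real.exp 1 * #p.1 ≤ N then
        Real.exp (-(15 * (#p.1 * Real.log (N / #p.1)))) else 0) *
      (if p.2.Nonempty ∧ Real.exp 1 * #p.2 ≤ N then
        Real.exp (-(15 * (#p.2 * Real.log (N / #p.2)))) else 0) := by
    rintro ⟨S, T⟩
    by_cases hc : S.Nonempty ∧ T.Nonempty ∧ Real.exp 1 * (max #S #T : ℕ) ≤ N
    · have hmS : (#S : ℝ) ≤ (max #S #T : ℕ) := by exact_mod_cast le_max_left _ _
      have hmT : (#T : ℝ) ≤ (max #S #T : ℕ) := by exact_mod_cast le_max_right _ _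
      have hS0 : (0 : ℝ) < #S := by exact_mod_cast hc.1.card_pos
      have hT0 : (0 : ℝ) < #T := by exact_mod_cast hc.2.1.card_pos
      have e0 := Real.exp_pos 1
      rw [if_pos ⟨hc.1, le_trans (by gcongr) hc.2.2⟩, if_pos ⟨hc.2.1, le_trans (by gcongr) hc.2.2⟩]
      refine (pr_mono H.weight (fun ω hω => hω.2)).trans
        ((H.pr_discrepant_le hN0 hD h60 S T hc.1 hc.2.1 _).trans ?_)
      rw [← Real.exp_add]
      refine Real.exp_le_exp.2 ?_
      have m1 := mul_log_div_mono hS0 hmS hc.2.2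
      have m2 := mul_log_div_mono hT0 hmT hc.2.2
      linarith
    · refine (pr_mono H.weight (Q := fun _ => False) fun ω hω => hc hω.1).trans ?_
      have : pr w (fun _ => False) = 0 := by simp [pr, ex]
      rw [this]
      refine mul_nonneg ?_ ?_ <;> split_ifs <;> positivity
  refine h1.trans ((Finset.sum_le_sum fun p _ => h2 p).trans ?_)
  rw [Fintype.sum_prod_type]
  simp only
  rw [← Finset.sum_mul_sum]
  have a1 := sum_small_sets_le H.card_left hN
  have a2 := sum_small_sets_le H.card_right hN
  calc _ ≤ 1 / N * (1 / N) := by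
        refine mul_le_mul a1 a2 (Finset.sum_nonneg fun _ _ => ?_) (by positivity)
        split_ifs <;> positivity
    _ ≤ 1 / N * 1 := by gcongr; rw [div_le_one hN0]; exact hN
    _ = _ := mul_one _

end RandomBipartite

section Light

variable {ι κ : Type*} [Fintype ι] [DecidableEq ι] [Fintype κ] {w : ι → κ → ℝ}
  {α β : Type*} [Fintype α] [DecidableEq α] [Fintype β] [DecidableEq β]
  {φ : α → β → ι} {g : α → β → κ → ℝ} {N D : ℝ}

theorem IsRandomBipartite.entryMean_le_one (H : IsRandomBipartite w φ g N D) (x : α) (y : β) :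
    entryMean w φ g x y ≤ 1 := by
  rw [← H.weight.sum_eq (φ x y)]
  refine Finset.sum_le_sum fun c _ => mul_le_of_le_one_right (H.weight.nonneg _ _) ?_
  rcases H.zero_one x y c with h | h <;> rw [h]
  exact zero_le_one

/-- Moment generating function of a centred indicator. -/
theorem IsRandomBipartite.mgf_entry_le (H : IsRandomBipartite w φ g N D) (x : α) (y : β) {t : ℝ}
    (ht : |t| ≤ 1) :
    ∑ c, w (φ x y) c * Real.exp (t * (g x y c - entryMean w φ g x y)) ≤
      Real.exp (t ^ 2 * (D / N)) := by
  set p := entryMean w φ g x y with hp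
  have hp0 : 0 ≤ p := H.mean_nonneg x y
  have hp1 : p ≤ 1 := H.entryMean_le_one x y
  have h1 : ∀ c, w (φ x y) c * Real.exp (t * (g x y c - p)) ≤
      w (φ x y) c * (1 - t * p + t ^ 2 * p ^ 2) +
        (t + t ^ 2 * (1 - 2 * p)) * (w (φ x y) c * g x y c) := by
    intro c
    have hw0 := H.weight.nonneg (φ x y) c
    have hb : |t * (g x y c - p)| ≤ 1 := by
      rw [abs_mul]
      refine mul_le_one₀ ht (abs_nonneg _) (abs_le.2 ?_)
      rcases H.zero_one x y c with h | h <;> rw [h] <;> constructor <;> linarith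
    have := (abs_le.1 (Real.abs_exp_sub_one_sub_id_le hb)).2
    have h2 : Real.exp (t * (g x y c - p)) ≤ 1 + t * (g x y c - p) + (t * (g x y c - p)) ^ 2 := by
      linarith
    refine (mul_le_mul_of_nonneg_left h2 hw0).trans (le_of_eq ?_)
    rcases H.zero_one x y c with h | h <;> rw [h] <;> ring
  refine (Finset.sum_le_sum fun c _ => h1 c).trans ?_
  rw [Finset.sum_add_distrib, ← Finset.sum_mul, H.weight.sum_eq, ← Finset.mul_sum]
  have h3 : ∑ c, w (φ x y) c * g x y c = p := rfl
  rw [h3]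
  have h4 : p ≤ D / N := H.mean_le x y
  calc 1 * (1 - t * p + t ^ 2 * p ^ 2) + (t + t ^ 2 * (1 - 2 * p)) * p
      = t ^ 2 * (p - p ^ 2) + 1 := by ring
    _ ≤ t ^ 2 * (D / N) + 1 := by gcongr; nlinarith
    _ ≤ _ := Real.add_one_le_exp _

/-- The light part of the bilinear form. -/
noncomputable def lightSum (N D : ℝ) (E : α → β → ℝ) (u : α → ℝ) (v : β → ℝ) : ℝ :=
  ∑ x, ∑ y, if N * |u x * v y| ≤ √D then E x y * (u x * v y) else 0

theorem IsRandomBipartite.pr_lightSum_ge_le (H : IsRandomBipartite w φ g N D) (hN : 0 < N)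
    (hD : 0 < D) (u : α → ℝ) (v : β → ℝ) (hu : ∑ x, u x ^ 2 ≤ 1) (hv : ∑ y, v y ^ 2 ≤ 1) (C : ℝ) :
    pr w (fun ω => C * √D ≤ lightSum N D (fun x y => g x y (ω (φ x y)) - entryMean w φ g x y) u v) ≤
      Real.exp (N - C * N) := by
  have hr : 0 < √D := Real.sqrt_pos.2 hD
  have hDD : √D ^ 2 = D := Real.sq_sqrt hD.le
  set θ : ℝ := N / √D with hθ
  have hθ0 : 0 < θ := by positivity
  let t : α × β → ℝ := fun a => if N * |u a.1 * v a.2| ≤ √D then θ * (u a.1 * v a.2) else 0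
  have ht : ∀ a, |t a| ≤ 1 := by
    intro a
    simp only [t]
    split_ifs with h
    · rw [abs_mul, abs_of_pos hθ0, hθ, div_mul_eq_mul_div, div_le_one hr]; exact h
    · simp
  have hsum : ∑ a, t a ^ 2 ≤ θ ^ 2 := by
    have : ∀ a, t a ^ 2 ≤ θ ^ 2 * (u a.1 ^ 2 * v a.2 ^ 2) := by
      intro a
      simp only [t]
      split_ifs with h
      · exact le_of_eq (by ring)
      · have : 0 ≤ θ ^ 2 * (u a.1 ^ 2 * v a.2 ^ 2) := by positivity
        simpa using this
    refine (Finset.sum_le_sum fun a _ => this a).trans ?_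
    rw [← Finset.mul_sum, Fintype.sum_prod_type]
    simp only
    rw [← Finset.sum_mul_sum]
    refine mul_le_of_le_one_right (by positivity) ?_
    exact mul_le_one₀ hu (Finset.sum_nonneg fun _ _ => sq_nonneg _) hv
  have hex : ex w (fun ω => ∏ a : α × β, Real.exp (t a *
      (g a.1 a.2 (ω (φ a.1 a.2)) - entryMean w φ g a.1 a.2))) ≤ Real.exp N := by
    rw [ex_prod H.weight Finset.univ (fun a : α × β => φ a.1 a.2)
      (by rintro ⟨x, y⟩ _ ⟨x', y'⟩ _ h
          obtain ⟨h1, h2⟩ := H.inj x y x' y' h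
          exact Prod.ext h1 h2)
      (fun a c => Real.exp (t a * (g a.1 a.2 c - entryMean w φ g a.1 a.2)))]
    refine (Finset.prod_le_prod (fun a _ => Finset.sum_nonneg fun c _ =>
      mul_nonneg (H.weight.nonneg _ _) (Real.exp_pos _).le)
      (fun a _ => H.mgf_entry_le a.1 a.2 (ht a))).trans ?_
    rw [← Real.exp_sum, ← Finset.sum_mul]
    refine Real.exp_le_exp.2 ?_
    calc (∑ a, t a ^ 2) * (D / N) ≤ θ ^ 2 * (D / N) := by gcongr
      _ = N := by rw [hθ, div_pow, hDD]; field_simp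
  have h1 := pr_le_of_ex_le H.weight (fun ω => Finset.prod_nonneg fun a _ => (Real.exp_pos _).le)
    (Real.exp_pos (C * N)) hex
    (P := fun ω => C * √D ≤
      lightSum N D (fun x y => g x y (ω (φ x y)) - entryMean w φ g x y) u v) (by
      intro ω hω
      rw [← Real.exp_sum]
      refine Real.exp_le_exp.2 ?_
      have : ∑ a : α × β, t a * (g a.1 a.2 (ω (φ a.1 a.2)) - entryMean w φ g a.1 a.2) =
          θ * lightSum N D (fun x y => g x y (ω (φ x y)) - entryMean w φ g x y) u v := by
        rw [lightSum, Fintype.sum_prod_type, Finset.mul_sum]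
        refine Finset.sum_congr rfl fun x _ => ?_
        rw [Finset.mul_sum]
        refine Finset.sum_congr rfl fun y _ => ?_
        simp only [t]
        split_ifs <;> ring
      rw [this]
      calc C * N = θ * (C * √D) := by rw [hθ]; field_simp
        _ ≤ _ := by gcongr)
  rwa [← Real.exp_sub] at h1

/-- All light sums over the net are small. -/
def LightBounded (N D : ℝ) (E : α → β → ℝ) : Prop :=
  ∀ z ∈ latticeBall α N, ∀ z' ∈ latticeBall β N,
    |lightSum N D E (fun x => z x / (4 * √N)) (fun y => z' y / (4 * √N))| ≤ 40 * √D

theorem sum_sq_lattice_le {N : ℝ} (hN : 0 < N) {z : α → ℤ} (hz : z ∈ latticeBall α N) :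
    ∑ x, ((z x : ℝ) / (4 * √N)) ^ 2 ≤ 1 := by
  have := mem_latticeBall.1 hz
  simp only [div_pow, mul_pow, Real.sq_sqrt hN.le]
  rw [← Finset.sum_div, div_le_one (by positivity)]
  linarith

theorem IsRandomBipartite.pr_not_lightBounded_le (H : IsRandomBipartite w φ g N D)
    (hN : 1 ≤ N) (hD : 0 < D) :
    pr w (fun ω => ¬ LightBounded N D fun x y => g x y (ω (φ x y)) - entryMean w φ g x y) ≤
      1 / N := by
  have hN0 : 0 < N := by linarith
  let Bad : (α → ℤ) × (β → ℤ) → (ι → κ) → Prop := fun p ω => 40 * √D ≤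
    lightSum N D (fun x y => g x y (ω (φ x y)) - entryMean w φ g x y)
      (fun x => p.1 x / (4 * √N)) (fun y => p.2 y / (4 * √N))
  refine (pr_mono H.weight (Q := fun ω => ∃ p ∈ latticeBall α N ×ˢ latticeBall β N, Bad p ω)
    ?_).trans ((pr_exists_le H.weight _ Bad).trans ?_)
  · intro ω hω
    unfold LightBounded at hω
    push Not at hω
    obtain ⟨z, hz, z', hz', h⟩ := hω
    rcases le_abs.1 h.le with h | h
    · exact ⟨(z, z'), Finset.mem_product.2 ⟨hz, hz'⟩, h⟩
    · refine ⟨(-z, z'), Finset.mem_product.2 ⟨?_, hz'⟩, ?_⟩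
      · rw [mem_latticeBall] at hz ⊢
        simpa using hz
      · refine h.trans (le_of_eq ?_)
        simp only [lightSum, ← Finset.sum_neg_distrib]
        refine Finset.sum_congr rfl fun x _ => Finset.sum_congr rfl fun y _ => ?_
        simp only [Pi.neg_apply, Int.cast_neg, neg_div, neg_mul, abs_neg, mul_neg]
        split_ifs <;> simp
  · have h1 : ∀ p ∈ latticeBall α N ×ˢ latticeBall β N, pr w (Bad p) ≤ Real.exp (N - 40 * N) := by
      rintro ⟨z, z'⟩ hp
      obtain ⟨hz, hz'⟩ := Finset.mem_product.1 hp
      exact H.pr_lightSum_ge_le hN0 hD _ _ (sum_sq_lattice_le hN0 hz) (sum_sq_lattice_le hN0 hz') 40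
    refine (Finset.sum_le_sum h1).trans ?_
    rw [Finset.sum_const, Finset.card_product, nsmul_eq_mul]
    push_cast
    calc _ ≤ Real.exp (19 * N) * Real.exp (19 * N) * Real.exp (N - 40 * N) := by
          gcongr
          · exact card_latticeBall_le H.card_left
          · exact card_latticeBall_le H.card_right
      _ = Real.exp (-N) := by rw [← Real.exp_add, ← Real.exp_add]; congr 1; ring
      _ ≤ 1 / N := by
          rw [Real.exp_neg, one_div]
          gcongr
          have := Real.add_one_le_exp N; linarith

/-- Discrepancy is inherited by a subgraph with bounded degrees, and extends to all sets. -/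
theorem SmallDiscrepancy.discrepancy_of_le {B B' : α → β → ℝ} (hN : 0 < N) (hD : 0 < D)
    (hB : SmallDiscrepancy 60 N D B) (h0 : ∀ x y, 0 ≤ B' x y) (hle : ∀ x y, B' x y ≤ B x y)
    (hrow : ∀ x, ∑ y, B' x y ≤ 20 * D) (hcol : ∀ y, ∑ x, B' x y ≤ 20 * D) :
    Discrepancy 60 N D B' := by
  intro S T hS hT
  have hS0 : (0 : ℝ) < #S := by exact_mod_cast hS.card_pos
  have hT0 : (0 : ℝ) < #T := by exact_mod_cast hT.card_pos
  obtain ⟨μ, hμ⟩ : ∃ μ : ℝ, μ = #S * #T * D / N := ⟨_, rfl⟩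
  have hμ0 : 0 < μ := by rw [hμ]; positivity
  by_cases hc : Real.exp 1 * (max #S #T : ℕ) ≤ N
  · have hee : edgeSum B' S T ≤ edgeSum B S T :=
      Finset.sum_le_sum fun x _ => Finset.sum_le_sum fun y _ => hle x y
    by_cases h1 : edgeSum B' S T ≤ 60 * (#S * #T * D / N)
    · exact Or.inl h1
    · right
      rcases hB S T hS hT hc with h | h
      · exact absurd (hee.trans h) h1
      · refine le_trans ?_ h
        push Not at h1
        rw [← hμ] at h1 ⊢
        have he0 : 0 < edgeSum B' S T := lt_trans (by positivity) h1
        have hl : 0 ≤ Real.log (edgeSum B' S T / μ) := by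
          refine Real.log_nonneg ?_
          rw [le_div_iff₀ hμ0]; linarith
        refine mul_le_mul hee (Real.log_le_log (by positivity) (by gcongr)) hl (he0.le.trans hee)
  · left
    push Not at hc
    have he3 := Real.exp_one_lt_three
    have r1 : edgeSum B' S T ≤ #S * (20 * D) := by
      rw [← nsmul_eq_mul, ← Finset.sum_const]
      exact Finset.sum_le_sum fun x _ => (Finset.sum_le_sum_of_subset_of_nonneg
        (Finset.subset_univ _) fun y _ _ => h0 x y).trans (hrow x)
    have r2 : edgeSum B' S T ≤ #T * (20 * D) := by
      unfold edgeSum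
      rw [Finset.sum_comm, ← nsmul_eq_mul, ← Finset.sum_const]
      exact Finset.sum_le_sum fun x _ => (Finset.sum_le_sum_of_subset_of_nonneg
        (Finset.subset_univ _) fun y _ _ => h0 y x).trans (hcol x)
    have hN3 : N ≤ 3 * (max #S #T : ℕ) := by
      have : (0 : ℝ) ≤ (max #S #T : ℕ) := Nat.cast_nonneg _
      nlinarith
    have key : ∀ s t : ℝ, 0 < s → N ≤ 3 * t → s * (20 * D) ≤ 60 * (s * t * D / N) := by
      intro s t hs ht
      rw [mul_div_assoc', le_div_iff₀ hN]
      have : 0 ≤ 20 * (s * D) := by positivity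
      nlinarith
    rcases le_total #S #T with h | h
    · rw [max_eq_right h] at hN3
      exact r1.trans (key _ _ hS0 hN3)
    · rw [max_eq_left h] at hN3
      refine r2.trans ((key _ _ hT0 hN3).trans (le_of_eq (by ring)))

theorem heavy_mean_le {p : α → β → ℝ} (hN : 0 < N) (hD : 0 < D)
    (hp : ∀ x y, p x y ≤ D / N) (u : α → ℝ) (v : β → ℝ) (hu : ∑ x, u x ^ 2 ≤ 1)
    (hv : ∑ y, v y ^ 2 ≤ 1) :
    ∑ x, ∑ y, (if √D < N * (|u x| * |v y|) then p x y * (|u x| * |v y|) else 0) ≤ √D := by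
  have hr : 0 < √D := Real.sqrt_pos.2 hD
  have hDD : √D * √D = D := Real.mul_self_sqrt hD.le
  have h1 : ∀ x y, (if √D < N * (|u x| * |v y|) then p x y * (|u x| * |v y|) else 0) ≤
      √D * (u x ^ 2 * v y ^ 2) := by
    intro x y
    have h0 : 0 ≤ |u x| * |v y| := by positivity
    have hq : u x ^ 2 * v y ^ 2 = (|u x| * |v y|) ^ 2 := by rw [mul_pow, sq_abs, sq_abs]
    rw [hq]
    split_ifs with h
    · calc p x y * (|u x| * |v y|) ≤ D / N * (|u x| * |v y|) := by gcongr; exact hp x y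
        _ = √D * (√D / N * (|u x| * |v y|)) := by
            rw [← mul_assoc (√D), ← mul_div_assoc, hDD]
        _ ≤ √D * ((|u x| * |v y|) * (|u x| * |v y|)) := by
            gcongr
            rw [div_le_iff₀ hN]; linarith
        _ = _ := by ring
    · positivity
  refine (Finset.sum_le_sum fun x _ => Finset.sum_le_sum fun y _ => h1 x y).trans ?_
  simp_rw [← Finset.mul_sum]
  rw [← Finset.sum_mul]
  refine mul_le_of_le_one_right hr.le ?_
  exact mul_le_one₀ hu (Finset.sum_nonneg fun _ _ => sq_nonneg _) hv

/-- The trimmed centred matrix has norm `O(√D)`. -/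
def TrimmedBounded (D : ℝ) (B p : α → β → ℝ) : Prop :=
  ∀ (R : Finset α) (S : Finset β), (∀ x ∈ R, ∑ y, B x y ≤ 20 * D) →
    (∀ y ∈ S, ∑ x, B x y ≤ 20 * D) → ∀ (u : α → ℝ) (v : β → ℝ),
    |∑ x ∈ R, ∑ y ∈ S, (B x y - p x y) * (u x * v y)| ≤
      150000 * √D * √(∑ x, u x ^ 2) * √(∑ y, v y ^ 2)

theorem trimmedBounded_of_light_of_discrepancy {B p : α → β → ℝ} (hN : 0 < N) (hD : 0 < D)
    (hα : (Fintype.card α : ℝ) ≤ N) (hβ : (Fintype.card β : ℝ) ≤ N)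
    (hB0 : ∀ x y, 0 ≤ B x y) (hp0 : ∀ x y, 0 ≤ p x y) (hp : ∀ x y, p x y ≤ D / N)
    (hlight : LightBounded N D fun x y => B x y - p x y) (hdisc : SmallDiscrepancy 60 N D B) :
    TrimmedBounded D B p := by
  classical
  intro R S hR hS u v
  have hr : 0 < √D := Real.sqrt_pos.2 hD
  set E : α → β → ℝ := fun x y => if x ∈ R ∧ y ∈ S then B x y - p x y else 0 with hE
  set B' : α → β → ℝ := fun x y => if x ∈ R ∧ y ∈ S then B x y else 0 with hB'
  have hB'0 : ∀ x y, 0 ≤ B' x y := fun x y => by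
    simp only [hB']; split_ifs; exacts [hB0 x y, le_rfl]
  have hB'le : ∀ x y, B' x y ≤ B x y := fun x y => by
    simp only [hB']; split_ifs; exacts [le_rfl, hB0 x y]
  have hrow : ∀ x, ∑ y, B' x y ≤ 20 * D := fun x => by
    by_cases hx : x ∈ R
    · exact (Finset.sum_le_sum fun y _ => hB'le x y).trans (hR x hx)
    · simp [hB', hx, hD.le]
  have hcol : ∀ y, ∑ x, B' x y ≤ 20 * D := fun y => by
    by_cases hy : y ∈ S
    · exact (Finset.sum_le_sum fun x _ => hB'le x y).trans (hS y hy)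
    · simp [hB', hy, hD.le]
  have hd' : Discrepancy 60 N D B' := hdisc.discrepancy_of_le hN hD hB'0 hB'le hrow hcol
  have h60 : Real.exp 1 ≤ 60 := by have := Real.exp_one_lt_three; linarith
  have hnet : ∀ z ∈ latticeBall α N, ∀ z' ∈ latticeBall β N,
      |bilin E (fun x => z x / (4 * √N)) (fun y => z' y / (4 * √N))| ≤ 18000 * √D := by
    intro z hz z' hz'
    set Z : α → ℤ := fun x => if x ∈ R then z x else 0 with hZ
    set Z' : β → ℤ := fun y => if y ∈ S then z' y else 0 with hZ'
    have hZm : Z ∈ latticeBall α N := by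
      rw [mem_latticeBall] at hz ⊢
      refine le_trans (Finset.sum_le_sum fun x _ => ?_) hz
      simp only [hZ]; split_ifs
      · exact le_rfl
      · simpa using sq_nonneg (z x : ℝ)
    have hZm' : Z' ∈ latticeBall β N := by
      rw [mem_latticeBall] at hz' ⊢
      refine le_trans (Finset.sum_le_sum fun x _ => ?_) hz'
      simp only [hZ']; split_ifs
      · exact le_rfl
      · simpa using sq_nonneg (z' x : ℝ)
    set a : α → ℝ := fun x => Z x / (4 * √N) with ha
    set b : β → ℝ := fun y => Z' y / (4 * √N) with hb
    have ha1 : ∑ x, a x ^ 2 ≤ 1 := sum_sq_lattice_le hN hZm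
    have hb1 : ∑ y, b y ^ 2 ≤ 1 := sum_sq_lattice_le hN hZm'
    have hL := hlight Z hZm Z' hZm'
    have hH := heavy_couples_le h60 hN hD hα hβ B' hB'0
      (fun x => (hrow x).trans (by linarith)) (fun y => (hcol y).trans (by linarith)) hd'
      (fun x => |a x|) (fun y => |b y|) (fun x => abs_nonneg _) (fun y => abs_nonneg _)
      (by simpa using ha1) (by simpa using hb1)
    have hM := heavy_mean_le hN hD hp a b ha1 hb1
    have hpoint : ∀ x y, |E x y * (z x / (4 * √N) * (z' y / (4 * √N))) -
        (if N * |a x * b y| ≤ √D then (B x y - p x y) * (a x * b y) else 0)| ≤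
        (if √D < N * (|a x| * |b y|) then B' x y * (|a x| * |b y|) else 0) +
        (if √D < N * (|a x| * |b y|) then p x y * (|a x| * |b y|) else 0) := by
      intro x y
      have heq : E x y * (z x / (4 * √N) * (z' y / (4 * √N))) = (B x y - p x y) * (a x * b y) := by
        simp only [hE, ha, hb, hZ, hZ']
        by_cases hx : x ∈ R <;> by_cases hy : y ∈ S <;> simp [hx, hy]
      rw [heq, ← abs_mul]
      by_cases h : N * |a x * b y| ≤ √D
      · rw [if_pos h, if_neg (not_lt.2 h), if_neg (not_lt.2 h)]; simp
      · rw [if_neg h, if_pos (not_le.1 h), if_pos (not_le.1 h), sub_zero, abs_mul]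
        rw [← add_mul]
        have hBB : B x y * |a x * b y| = B' x y * |a x * b y| := by
          simp only [hB', ha, hb, hZ, hZ']
          by_cases hx : x ∈ R <;> by_cases hy : y ∈ S <;> simp [hx, hy]
        rw [add_mul, ← hBB, ← add_mul]
        refine mul_le_mul_of_nonneg_right ?_ (abs_nonneg _)
        rw [abs_le]; constructor <;> linarith [hB0 x y, hp0 x y]
    have hdiff : |bilin E (fun x => z x / (4 * √N)) (fun y => z' y / (4 * √N)) -
        lightSum N D (fun x y => B x y - p x y) a b| ≤ 298 * 60 * √D + √D := by
      unfold bilin lightSum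
      rw [← Finset.sum_sub_distrib]
      refine (Finset.abs_sum_le_sum_abs _ _).trans ?_
      refine le_trans ?_ (add_le_add hH hM)
      rw [← Finset.sum_add_distrib]
      refine Finset.sum_le_sum fun x _ => ?_
      rw [← Finset.sum_sub_distrib]
      refine (Finset.abs_sum_le_sum_abs _ _).trans ?_
      rw [← Finset.sum_add_distrib]
      exact Finset.sum_le_sum fun y _ => hpoint x y
    have := abs_sub_abs_le_abs_sub (bilin E (fun x => z x / (4 * √N)) (fun y => z' y / (4 * √N)))
      (lightSum N D (fun x y => B x y - p x y) a b)
    have hL' : |lightSum N D (fun x y => B x y - p x y) a b| ≤ 40 * √D := hL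
    linarith
  have hfin := bilin_le_of_lattice hN hα hβ hnet u v
  have hEsum : bilin E u v = ∑ x ∈ R, ∑ y ∈ S, (B x y - p x y) * (u x * v y) := by
    unfold bilin
    rw [← Finset.sum_subset (Finset.subset_univ R) (fun x _ hx => by simp [hE, hx])]
    refine Finset.sum_congr rfl fun x hx => ?_
    rw [← Finset.sum_subset (Finset.subset_univ S) (fun y _ hy => by simp [hE, hy])]
    refine Finset.sum_congr rfl fun y hy => ?_
    simp [hE, hx, hy]
  rw [← hEsum]
  refine hfin.trans ?_
  rw [show 8 * (18000 * √D) = 144000 * √D by ring]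
  gcongr
  norm_num

theorem IsRandomBipartite.pr_not_trimmedBounded_le (H : IsRandomBipartite w φ g N D)
    (hN : 1 ≤ N) (hD : 0 < D) :
    pr w (fun ω => ¬ TrimmedBounded D (fun x y => g x y (ω (φ x y))) (entryMean w φ g)) ≤ 2 / N := by
  have h1 := H.pr_not_lightBounded_le hN hD
  have h2 := H.pr_not_smallDiscrepancy_le hN hD
  refine (pr_mono H.weight ?_).trans ((pr_or_le H.weight _ _).trans
    ((add_le_add h1 h2).trans_eq (by ring)))
  intro ω hω
  by_contra hcon
  push Not at hcon
  refine hω (trimmedBounded_of_light_of_discrepancy (by linarith) hD H.card_left H.card_right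
    (fun x y => ?_) H.mean_nonneg H.mean_le hcon.1 hcon.2)
  rcases H.zero_one x y (ω (φ x y)) with h | h <;> rw [h]
  exact zero_le_one

end Light

section Spectral

section Abstract

variable {E F : Type*} [NormedAddCommGroup E] [InnerProductSpace ℝ E] [FiniteDimensional ℝ E]
  [NormedAddCommGroup F] [InnerProductSpace ℝ F]

/-- `W` is spanned by right singular vectors of `L` for the `k` largest singular values. -/
def IsTopSingularSpace (k : ℕ) (L : E →ₗ[ℝ] F) (W : Submodule ℝ E) : Prop :=
  ∃ (u : Fin k → E) (s : Fin k → ℝ), Orthonormal ℝ u ∧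
    (∀ i, 0 ≤ s i ∧ ∀ y, inner ℝ (L (u i)) (L y) = s i ^ 2 * inner ℝ (u i) y) ∧
    W = Submodule.span ℝ (Set.range u) ∧ ∀ x ∈ Wᗮ, ∀ i, ‖L x‖ ≤ s i * ‖x‖

theorem exists_ne_zero_mem_inf {V V' : Submodule ℝ E}
    (h : Module.finrank ℝ E < Module.finrank ℝ V + Module.finrank ℝ V') :
    ∃ x ∈ V, x ∈ V' ∧ x ≠ 0 := by
  by_contra hcon
  push Not at hcon
  have hd : Disjoint V V' := by
    rw [Submodule.disjoint_def]
    exact hcon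
  have := Submodule.finrank_add_finrank_le_of_disjoint hd
  omega

theorem finrank_sup_span_singleton {V : Submodule ℝ E} {x : E} (hx : x ∈ Vᗮ) (hx0 : x ≠ 0) :
    Module.finrank ℝ (V ⊔ Submodule.span ℝ {x} : Submodule ℝ E) = Module.finrank ℝ V + 1 := by
  have hinf : V ⊓ Submodule.span ℝ {x} = ⊥ := by
    rw [← disjoint_iff, Submodule.disjoint_def]
    intro y hy hy'
    obtain ⟨c, rfl⟩ := Submodule.mem_span_singleton.1 hy'
    have h1 : inner ℝ (c • x) (c • x) = (0 : ℝ) :=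
      Submodule.inner_right_of_mem_orthogonal hy (Submodule.smul_mem _ c hx)
    exact inner_self_eq_zero.1 h1
  have := Submodule.finrank_sup_add_finrank_inf_eq V (Submodule.span ℝ {x})
  rw [hinf, finrank_bot, add_zero, finrank_span_singleton hx0] at this
  exact this

variable {k : ℕ} {L L₀ : E →ₗ[ℝ] F} {W U : Submodule ℝ E}

theorem IsTopSingularSpace.finrank_eq (hW : IsTopSingularSpace k L W) : Module.finrank ℝ W = k := by
  obtain ⟨u, s, hu, -, rfl, -⟩ := hW
  rw [finrank_span_eq_card hu.linearIndependent, Fintype.card_fin]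

theorem IsTopSingularSpace.inner_map_eq_zero (hW : IsTopSingularSpace k L W) {w y : E} (hw : w ∈ W)
    (hy : y ∈ Wᗮ) : inner ℝ (L w) (L y) = (0 : ℝ) := by
  obtain ⟨u, s, -, hs, rfl, -⟩ := hW
  induction hw using Submodule.span_induction with
  | mem x hx =>
    obtain ⟨i, rfl⟩ := hx
    rw [(hs i).2 y, Submodule.inner_right_of_mem_orthogonal
      (Submodule.subset_span (Set.mem_range_self i)) hy, mul_zero]
  | zero => simp
  | add x y _ _ hx hy => rw [map_add, inner_add_left, hx, hy, add_zero]
  | smul c x _ hx => rw [map_smul, inner_smul_left, hx, mul_zero]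

theorem IsTopSingularSpace.norm_map_mul_le (hW : IsTopSingularSpace k L W) {w x : E} (hw : w ∈ W)
    (hx : x ∈ Wᗮ) : ‖L x‖ ^ 2 * ‖w‖ ^ 2 ≤ ‖L w‖ ^ 2 * ‖x‖ ^ 2 := by
  obtain ⟨u, s, hu, hs, rfl, hle⟩ := hW
  obtain ⟨c, rfl⟩ := (Submodule.mem_span_range_iff_exists_fun ℝ).1 hw
  set w := ∑ i, c i • u i with hwd
  have hin : ∀ i, inner ℝ (u i) w = c i := fun i => hu.inner_right_fintype c i
  have h1 : ‖w‖ ^ 2 = ∑ i, c i ^ 2 := by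
    rw [← real_inner_self_eq_norm_sq]
    conv_lhs => rw [hwd, sum_inner]
    refine Finset.sum_congr rfl fun i _ => ?_
    rw [← hwd, inner_smul_left, hin]
    simp [sq]
  have h2 : ‖L w‖ ^ 2 = ∑ i, c i ^ 2 * s i ^ 2 := by
    rw [← real_inner_self_eq_norm_sq]
    have : L w = ∑ i, c i • L (u i) := by simp [hwd]
    conv_lhs => rw [this, sum_inner]
    refine Finset.sum_congr rfl fun i _ => ?_
    rw [← this, inner_smul_left, (hs i).2, hin]
    simp; ring
  rw [h1, h2, Finset.mul_sum, Finset.sum_mul]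
  refine Finset.sum_le_sum fun i _ => ?_
  have h3 : ‖L x‖ ^ 2 ≤ (s i * ‖x‖) ^ 2 := pow_le_pow_left₀ (norm_nonneg _) (hle x hx i) 2
  nlinarith [mul_le_mul_of_nonneg_left h3 (sq_nonneg (c i))]

theorem norm_add_sq_of_inner_eq_zero {G : Type*} [NormedAddCommGroup G] [InnerProductSpace ℝ G]
    {x y : G} (h : inner ℝ x y = (0 : ℝ)) : ‖x + y‖ ^ 2 = ‖x‖ ^ 2 + ‖y‖ ^ 2 := by
  rw [norm_add_sq_real, h]; ring

theorem IsTopSingularSpace.norm_map_le (hW : IsTopSingularSpace k L W) {ε : ℝ} (hε : 0 ≤ ε)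
    (hL : ∀ x, ‖L x - L₀ x‖ ≤ ε * ‖x‖) (hU : Module.finrank ℝ U = k) (hU0 : ∀ x ∈ Uᗮ, L₀ x = 0)
    {x : E} (hx : x ∈ Wᗮ) : ‖L x‖ ≤ ε * ‖x‖ := by
  by_cases hx0 : x = 0
  · simp [hx0]
  have hdim := finrank_sup_span_singleton hx hx0
  have hUd := Submodule.finrank_add_finrank_orthogonal U
  obtain ⟨y, hy, hyU, hy0⟩ := exists_ne_zero_mem_inf (V := W ⊔ Submodule.span ℝ {x}) (V' := Uᗮ)
    (by rw [hdim, hW.finrank_eq]; omega)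
  obtain ⟨w, hw, z, hz, rfl⟩ := Submodule.mem_sup.1 hy
  obtain ⟨c, rfl⟩ := Submodule.mem_span_singleton.1 hz
  have hcx : c • x ∈ Wᗮ := Submodule.smul_mem _ c hx
  have h1 : ‖L (w + c • x)‖ ≤ ε * ‖w + c • x‖ := by
    have := hL (w + c • x)
    rwa [hU0 _ hyU, sub_zero] at this
  have h2 : ‖w + c • x‖ ^ 2 = ‖w‖ ^ 2 + ‖c • x‖ ^ 2 :=
    norm_add_sq_of_inner_eq_zero (Submodule.inner_right_of_mem_orthogonal hw hcx)
  have h3 : ‖L (w + c • x)‖ ^ 2 = ‖L w‖ ^ 2 + ‖L (c • x)‖ ^ 2 := by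
    rw [map_add]
    exact norm_add_sq_of_inner_eq_zero (hW.inner_map_eq_zero hw hcx)
  have h4 := hW.norm_map_mul_le hw hx
  have h5 : ‖L (c • x)‖ = |c| * ‖L x‖ := by rw [map_smul, norm_smul, Real.norm_eq_abs]
  have h6 : ‖c • x‖ = |c| * ‖x‖ := by rw [norm_smul, Real.norm_eq_abs]
  have hpos : 0 < ‖w + c • x‖ := norm_pos_iff.2 hy0
  have h7 : ‖L x‖ ^ 2 * ‖w + c • x‖ ^ 2 ≤ (ε * ‖x‖) ^ 2 * ‖w + c • x‖ ^ 2 := by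
    calc ‖L x‖ ^ 2 * ‖w + c • x‖ ^ 2 = ‖L x‖ ^ 2 * ‖w‖ ^ 2 + |c| ^ 2 * ‖L x‖ ^ 2 * ‖x‖ ^ 2 := by
          rw [h2, h6]; ring
      _ ≤ ‖L w‖ ^ 2 * ‖x‖ ^ 2 + |c| ^ 2 * ‖L x‖ ^ 2 * ‖x‖ ^ 2 := by gcongr
      _ = ‖L (w + c • x)‖ ^ 2 * ‖x‖ ^ 2 := by rw [h3, h5]; ring
      _ ≤ (ε * ‖w + c • x‖) ^ 2 * ‖x‖ ^ 2 := by gcongr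
      _ = _ := by ring
  exact le_of_pow_le_pow_left₀ two_ne_zero (by positivity)
    (le_of_mul_le_mul_right h7 (by positivity))

/-- The top singular space is unique when there is a spectral gap. -/
theorem IsTopSingularSpace.unique {W' : Submodule ℝ E} (hW : IsTopSingularSpace k L W)
    (hW' : IsTopSingularSpace k L W') {ε σ : ℝ} (hε : 0 ≤ ε)
    (hL : ∀ x, ‖L x - L₀ x‖ ≤ ε * ‖x‖) (hU : Module.finrank ℝ U = k) (hU0 : ∀ x ∈ Uᗮ, L₀ x = 0)
    (hσ : ∀ x ∈ U, σ * ‖x‖ ≤ ‖L₀ x‖) (hgap : 2 * ε < σ) : W' = W := by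
  have hle : W' ≤ W := by
    obtain ⟨u, s, hu, hs, hspan, hbd⟩ := id hW'
    rw [hspan, Submodule.span_le]
    rintro _ ⟨i, rfl⟩
    -- the singular value `s i` exceeds `ε`
    have hsi : ε < s i := by
      have hui : u i ∈ W'ᗮᗮ := by
        rw [Submodule.orthogonal_orthogonal, hspan]
        exact Submodule.subset_span (Set.mem_range_self i)
      have hdim := finrank_sup_span_singleton hui (hu.ne_zero i)
      have hd := Submodule.finrank_add_finrank_orthogonal W'
      rw [hW'.finrank_eq] at hd
      obtain ⟨y, hy, hyU, hy0⟩ := exists_ne_zero_mem_inf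
        (V := W'ᗮ ⊔ Submodule.span ℝ {u i}) (V' := U) (by rw [hdim, hU]; omega)
      obtain ⟨z, hz, w, hw, rfl⟩ := Submodule.mem_sup.1 hy
      obtain ⟨c, rfl⟩ := Submodule.mem_span_singleton.1 hw
      have hcw : c • u i ∈ W' := by
        rw [hspan]; exact Submodule.smul_mem _ _ (Submodule.subset_span (Set.mem_range_self i))
      have h2 : ‖z + c • u i‖ ^ 2 = ‖z‖ ^ 2 + ‖c • u i‖ ^ 2 :=
        norm_add_sq_of_inner_eq_zero (Submodule.inner_left_of_mem_orthogonal hcw hz)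
      have h3 : ‖L (z + c • u i)‖ ^ 2 = ‖L z‖ ^ 2 + ‖L (c • u i)‖ ^ 2 := by
        rw [map_add]
        refine norm_add_sq_of_inner_eq_zero ?_
        rw [real_inner_comm]
        exact hW'.inner_map_eq_zero hcw hz
      have h4 : ‖L (c • u i)‖ ^ 2 = s i ^ 2 * ‖c • u i‖ ^ 2 := by
        rw [map_smul, norm_smul, norm_smul, mul_pow, mul_pow, ← real_inner_self_eq_norm_sq (L (u i)),
          (hs i).2, real_inner_self_eq_norm_sq]
        ring
      have h5 : ‖L z‖ ^ 2 ≤ s i ^ 2 * ‖z‖ ^ 2 := by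
        rw [← mul_pow]
        exact pow_le_pow_left₀ (norm_nonneg _) (hbd z hz i) 2
      have h6 : ‖L (z + c • u i)‖ ≤ s i * ‖z + c • u i‖ := by
        have h0 := (hs i).1
        refine le_of_pow_le_pow_left₀ two_ne_zero (by positivity) ?_
        rw [mul_pow, h2, h3, h4]
        linarith
      have h7 := hσ _ hyU
      have h8 := hL (z + c • u i)
      have h9 : ‖L₀ (z + c • u i)‖ ≤ ‖L (z + c • u i)‖ + ε * ‖z + c • u i‖ := by
        have := norm_sub_norm_le (L₀ (z + c • u i)) (L (z + c • u i))
        rw [norm_sub_rev] at this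
        linarith
      have hpos : 0 < ‖z + c • u i‖ := norm_pos_iff.2 hy0
      have : σ * ‖z + c • u i‖ ≤ (s i + ε) * ‖z + c • u i‖ := by linarith
      have := le_of_mul_le_mul_right this hpos
      linarith
    -- the component of `u i` in `Wᗮ` vanishes
    obtain ⟨p, hp, x, hx, hpx⟩ := Submodule.mem_sup.1
      (show u i ∈ W ⊔ Wᗮ by rw [Submodule.sup_orthogonal_of_hasOrthogonalProjection]; trivial)
    have h1 : ‖L x‖ ^ 2 = s i ^ 2 * ‖x‖ ^ 2 := by
      have e1 := (hs i).2 x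
      rw [← hpx, map_add, inner_add_left, inner_add_left, hW.inner_map_eq_zero hp hx,
        Submodule.inner_right_of_mem_orthogonal hp hx, zero_add, zero_add,
        real_inner_self_eq_norm_sq, real_inner_self_eq_norm_sq] at e1
      exact e1
    have h2 := hW.norm_map_le hε hL hU hU0 hx
    have h3 : ‖x‖ = 0 := by
      by_contra hne
      have hpos : 0 < ‖x‖ := lt_of_le_of_ne (norm_nonneg _) (Ne.symm hne)
      have h4 : ‖L x‖ ^ 2 ≤ (ε * ‖x‖) ^ 2 := pow_le_pow_left₀ (norm_nonneg _) h2 2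
      have h5 : (ε * ‖x‖) ^ 2 < (s i * ‖x‖) ^ 2 := by gcongr
      rw [mul_pow (s i)] at h5
      linarith
    rw [← hpx, norm_eq_zero.1 h3, add_zero]
    exact hp
  exact Submodule.eq_of_le_of_finrank_eq hle (by rw [hW.finrank_eq, hW'.finrank_eq])

end Abstract

variable {R S : Type*} [Fintype R] [Fintype S] [DecidableEq R] [DecidableEq S]

theorem inner_toEuclideanLin_left (B : Matrix S R ℝ) (x : EuclideanSpace ℝ R)
    (y : EuclideanSpace ℝ S) :
    inner ℝ (Matrix.toEuclideanLin B x) y = inner ℝ x (Matrix.toEuclideanLin Bᵀ y) := by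
  simp only [Matrix.toLpLin_apply, EuclideanSpace.inner_eq_star_dotProduct, star_trivial]
  rw [Matrix.mulVec_transpose, ← Matrix.dotProduct_mulVec]

theorem inner_toEuclideanLin_mul_transpose (A : Matrix R S ℝ) (x y : EuclideanSpace ℝ R) :
    inner ℝ (Matrix.toEuclideanLin (A * Aᵀ) x) y =
      inner ℝ (Matrix.toEuclideanLin Aᵀ x) (Matrix.toEuclideanLin Aᵀ y) := by
  have : Matrix.toEuclideanLin (A * Aᵀ) x = Matrix.toEuclideanLin A (Matrix.toEuclideanLin Aᵀ x) := by
    simp [Matrix.toLpLin_apply]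
  rw [this, inner_toEuclideanLin_left]

theorem isTopLeftSingularSpace_iff {A : Matrix R S ℝ} {k : ℕ}
    {W : Submodule ℝ (EuclideanSpace ℝ R)} :
    IsTopLeftSingularSpace k A W ↔ IsTopSingularSpace k (Matrix.toEuclideanLin Aᵀ) W := by
  refine exists_congr fun u => exists_congr fun s => and_congr_right fun _ =>
    and_congr_left fun _ => forall_congr' fun i => and_congr_right fun _ => ?_
  constructor
  · intro h y
    rw [← inner_toEuclideanLin_mul_transpose, h, inner_smul_left]; simp
  · intro h
    refine ext_inner_right ℝ fun y => ?_
    rw [inner_toEuclideanLin_mul_transpose, h, inner_smul_left]; simp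

/-- A top left singular space exists. -/
theorem exists_isTopLeftSingularSpace (A : Matrix R S ℝ) {k : ℕ} (hk : k ≤ Fintype.card R) :
    ∃ W, IsTopLeftSingularSpace k A W := by
  have hA : (A * Aᵀ).IsHermitian := by
    simpa using Matrix.isHermitian_mul_conjTranspose_self A
  let e : Fin (Fintype.card R) ≃ R := Fintype.equivOfCardEq (Fintype.card_fin _)
  let b := hA.eigenvectorBasis
  have hval : ∀ j, hA.eigenvalues (e j) = hA.eigenvalues₀ j := fun j => by
    simp only [Matrix.IsHermitian.eigenvalues]
    congr 1
    exact e.symm_apply_apply j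
  have hvec : ∀ j, Matrix.toEuclideanLin (A * Aᵀ) (b j) = hA.eigenvalues j • b j := by
    intro j
    rw [Matrix.toLpLin_apply, hA.mulVec_eigenvectorBasis]
    rfl
  have hnorm : ∀ j y, inner ℝ (Matrix.toEuclideanLin Aᵀ (b j)) (Matrix.toEuclideanLin Aᵀ y) =
      hA.eigenvalues j * inner ℝ (b j) y := by
    intro j y
    rw [← inner_toEuclideanLin_mul_transpose, hvec, inner_smul_left]; simp
  have hpos : ∀ j, 0 ≤ hA.eigenvalues j := by
    intro j
    have := hnorm j (b j)
    rw [real_inner_self_eq_norm_sq, real_inner_self_eq_norm_sq, b.norm_eq_one] at this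
    have h2 := sq_nonneg ‖Matrix.toEuclideanLin Aᵀ (b j)‖
    linarith
  let c : Fin k → R := fun i => e (Fin.castLE hk i)
  have hc : Function.Injective c := e.injective.comp (Fin.castLE_injective hk)
  refine ⟨_, fun i => b (c i), fun i => √(hA.eigenvalues (c i)), b.orthonormal.comp c hc,
    fun i => ⟨Real.sqrt_nonneg _, ?_⟩, rfl, ?_⟩
  · rw [hvec, Real.sq_sqrt (hpos _)]
  · intro x hx i
    refine le_of_pow_le_pow_left₀ two_ne_zero (by positivity) ?_
    rw [mul_pow, Real.sq_sqrt (hpos _)]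
    have h1 : ‖Matrix.toEuclideanLin Aᵀ x‖ ^ 2 =
        ∑ j, hA.eigenvalues j * (inner ℝ (b j) x) ^ 2 := by
      rw [← real_inner_self_eq_norm_sq]
      have hx' : Matrix.toEuclideanLin Aᵀ x =
          ∑ j, inner ℝ (b j) x • Matrix.toEuclideanLin Aᵀ (b j) := by
        conv_lhs => rw [← b.sum_repr' x]
        simp
      conv_lhs => rw [hx', sum_inner]
      refine Finset.sum_congr rfl fun j _ => ?_
      rw [← hx', inner_smul_left, hnorm]
      simp; ring
    have h2 : ‖x‖ ^ 2 = ∑ j, (inner ℝ (b j) x) ^ 2 := by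
      rw [← b.sum_sq_norm_inner_right x]
      simp
    rw [h1, h2, Finset.mul_sum]
    refine Finset.sum_le_sum fun j _ => ?_
    by_cases hj : inner ℝ (b j) x = 0
    · simp [hj]
    · refine mul_le_mul_of_nonneg_right ?_ (sq_nonneg _)
      obtain ⟨m, rfl⟩ := e.surjective j
      rw [hval, hval]
      refine hA.eigenvalues₀_antitone ?_
      by_contra hlt
      push Not at hlt
      refine hj ?_
      have hmk : (m : ℕ) < k := lt_trans (show (m : ℕ) < i from hlt) i.2
      have : b (e m) = b (c ⟨m, hmk⟩) := rfl
      rw [this]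
      exact Submodule.inner_right_of_mem_orthogonal
        (Submodule.subset_span (Set.mem_range_self (f := fun i => b (c i)) _)) hx

theorem IsTopLeftSingularSpace.unique {A M : Matrix R S ℝ} {k : ℕ}
    {W W' U : Submodule ℝ (EuclideanSpace ℝ R)}
    (hW : IsTopLeftSingularSpace k A W) (hW' : IsTopLeftSingularSpace k A W') {ε σ : ℝ}
    (hε : 0 ≤ ε)
    (hA : ∀ x, ‖Matrix.toEuclideanLin Aᵀ x - Matrix.toEuclideanLin Mᵀ x‖ ≤ ε * ‖x‖)
    (hU : Module.finrank ℝ U = k) (hU0 : ∀ x ∈ Uᗮ, Matrix.toEuclideanLin Mᵀ x = 0)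
    (hσ : ∀ x ∈ U, σ * ‖x‖ ≤ ‖Matrix.toEuclideanLin Mᵀ x‖) (hgap : 2 * ε < σ) : W' = W :=
  (isTopLeftSingularSpace_iff.1 hW).unique (isTopLeftSingularSpace_iff.1 hW') hε hA hU hU0 hσ hgap

/-- The range of `M` is almost contained in the top left singular space of a matrix close to `M`. -/
theorem IsTopLeftSingularSpace.norm_sub_proj_le {A M : Matrix R S ℝ} {k : ℕ}
    {W U : Submodule ℝ (EuclideanSpace ℝ R)}
    (hW : IsTopLeftSingularSpace k A W) {ε : ℝ} (hε : 0 ≤ ε)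
    (hA : ∀ x, ‖Matrix.toEuclideanLin Aᵀ x - Matrix.toEuclideanLin Mᵀ x‖ ≤ ε * ‖x‖)
    (hU : Module.finrank ℝ U = k) (hU0 : ∀ x ∈ Uᗮ, Matrix.toEuclideanLin Mᵀ x = 0)
    (v : EuclideanSpace ℝ S) :
    ‖Matrix.toEuclideanLin M v - W.starProjection (Matrix.toEuclideanLin M v)‖ ≤ 2 * ε * ‖v‖ := by
  set y := Matrix.toEuclideanLin M v
  set z := y - W.starProjection y with hz
  have hzW : z ∈ Wᗮ := Submodule.sub_starProjection_mem_orthogonal y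
  have h1 : ‖z‖ ^ 2 = inner ℝ (Matrix.toEuclideanLin Mᵀ z) v := by
    rw [inner_toEuclideanLin_left, Matrix.transpose_transpose, ← real_inner_self_eq_norm_sq]
    have : y = z + W.starProjection y := by rw [hz]; abel
    change inner ℝ z z = inner ℝ z y
    conv_rhs => rw [this, inner_add_right]
    rw [Submodule.inner_left_of_mem_orthogonal (Submodule.starProjection_apply_mem W y) hzW, add_zero]
  have h2 := (isTopLeftSingularSpace_iff.1 hW).norm_map_le hε hA hU hU0 hzW
  have h3 : ‖Matrix.toEuclideanLin Mᵀ z‖ ≤ 2 * ε * ‖z‖ := by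
    have := norm_sub_norm_le (Matrix.toEuclideanLin Mᵀ z) (Matrix.toEuclideanLin Aᵀ z)
    rw [norm_sub_rev] at this
    have := hA z
    linarith
  have h4 : ‖z‖ ^ 2 ≤ 2 * ε * ‖z‖ * ‖v‖ := by
    rw [h1]
    exact (real_inner_le_norm _ _).trans (by gcongr)
  rcases (norm_nonneg z).eq_or_lt with h0 | h0
  · rw [← h0]; positivity
  · have : ‖z‖ * ‖z‖ ≤ ‖z‖ * (2 * ε * ‖v‖) := by nlinarith
    exact le_of_mul_le_mul_left this h0

end Spectral

/-! ### Top coordinates -/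

section TopCoords

open Classical in
/-- The number of coordinates that come before `z` when coordinates are sorted decreasingly. -/
noncomputable def coordRank {n : ℕ} {Z : Finset (Fin n)} (w : EuclideanSpace ℝ Z) (z : Z) : ℕ :=
  #{z' : Z | w z < w z' ∨ (w z' = w z ∧ z' < z)}

variable {n : ℕ} {Z : Finset (Fin n)} (w : EuclideanSpace ℝ Z)

theorem coordRank_lt {z z' : Z} (h : w z < w z' ∨ (w z' = w z ∧ z' < z)) :
    coordRank w z' < coordRank w z := by
  classical
  refine Finset.card_lt_card (Finset.ssubset_iff_of_subset ?_ |>.2 ⟨z', ?_, ?_⟩)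
  · intro y hy
    simp only [Finset.mem_filter, Finset.mem_univ, true_and] at hy ⊢
    rcases h with h | ⟨h, h'⟩ <;> rcases hy with hy | ⟨hy, hy'⟩
    · exact Or.inl (h.trans hy)
    · exact Or.inl (hy ▸ h)
    · exact Or.inl (h ▸ hy)
    · exact Or.inr ⟨hy.trans h, hy'.trans h'⟩
  · simpa using h
  · simp

theorem coordRank_injective : Function.Injective (coordRank w) := by
  intro z z' h
  by_contra hne
  rcases lt_trichotomy (w z) (w z') with h1 | h1 | h1
  · exact (coordRank_lt w (Or.inl h1)).ne h.symm
  · rcases lt_or_gt_of_ne hne with h2 | h2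
    · exact (coordRank_lt w (Or.inr ⟨h1, h2⟩)).ne h
    · exact (coordRank_lt w (Or.inr ⟨h1.symm, h2⟩)).ne h.symm
  · exact (coordRank_lt w (Or.inl h1)).ne h

theorem coordRank_lt_card (z : Z) : coordRank w z < #Z := by
  classical
  have : coordRank w z < Fintype.card Z := by
    refine Finset.card_lt_univ_of_notMem (x := z) ?_
    simp
  simpa using this

theorem mem_topCoords {r : ℕ} {v : Fin n} :
    v ∈ topCoords r w ↔ ∃ h : v ∈ Z, coordRank w ⟨v, h⟩ < r := by
  classical
  simp only [topCoords, Finset.mem_map, Finset.mem_filter, Finset.mem_univ, true_and,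
    Function.Embedding.subtype_apply, coordRank]
  constructor
  · rintro ⟨z, hz, rfl⟩
    exact ⟨z.2, hz⟩
  · rintro ⟨h, hz⟩
    exact ⟨⟨v, h⟩, hz, rfl⟩

theorem topCoords_subset (r : ℕ) : topCoords r w ⊆ Z := fun _ hv => ((mem_topCoords w).1 hv).1

theorem card_topCoords (r : ℕ) : #(topCoords r w) = min r #Z := by
  classical
  have himg : Finset.univ.image (coordRank w) = Finset.range #Z := by
    refine Finset.eq_of_subset_of_card_le ?_ ?_
    · intro m hm
      obtain ⟨z, -, rfl⟩ := Finset.mem_image.1 hm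
      exact Finset.mem_range.2 (coordRank_lt_card w z)
    · rw [Finset.card_image_of_injective _ (coordRank_injective w)]; simp
  have h1 : #(topCoords r w) = #({z : Z | coordRank w z < r} : Finset Z) := by
    rw [topCoords, Finset.card_map]; rfl
  have h2 : ({z : Z | coordRank w z < r} : Finset Z).image (coordRank w) =
      Finset.range (min r #Z) := by
    ext m
    simp only [Finset.mem_image, Finset.mem_filter, Finset.mem_univ, true_and, Finset.mem_range,
      lt_min_iff]
    constructor
    · rintro ⟨z, hz, rfl⟩
      exact ⟨hz, coordRank_lt_card w z⟩
    · rintro ⟨hr, hZ⟩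
      have : m ∈ Finset.univ.image (coordRank w) := by rw [himg]; exact Finset.mem_range.2 hZ
      obtain ⟨z, -, rfl⟩ := Finset.mem_image.1 this
      exact ⟨z, hr, rfl⟩
  rw [h1, ← Finset.card_image_of_injective _ (coordRank_injective w), h2, Finset.card_range]

theorem le_of_mem_topCoords {r : ℕ} {x z : Z} (hx : (x : Fin n) ∈ topCoords r w)
    (hz : (z : Fin n) ∉ topCoords r w) : w z ≤ w x := by
  by_contra hlt
  push Not at hlt
  obtain ⟨_, hx⟩ := (mem_topCoords w).1 hx
  refine hz ((mem_topCoords w).2 ⟨z.2, lt_trans (coordRank_lt w (Or.inl hlt)) hx⟩)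

theorem card_mul_sq_le {Y : Finset (Fin n)} (hY : Y ⊆ Z) (e : EuclideanSpace ℝ Z)
    {h : ℝ} (hh : 0 ≤ h) (he : ∀ z : Z, (z : Fin n) ∈ Y → h ≤ |e z|) :
    (#Y : ℝ) * h ^ 2 ≤ ‖e‖ ^ 2 := by
  classical
  have h1 : (#Y : ℝ) * h ^ 2 = ∑ z : Z, if (z : Fin n) ∈ Y then h ^ 2 else 0 := by
    rw [Finset.sum_coe_sort Z (fun z => if z ∈ Y then h ^ 2 else 0), ← Finset.sum_filter,
      Finset.sum_const, nsmul_eq_mul, Finset.filter_mem_eq_inter, Finset.inter_eq_right.2 hY]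
  rw [h1, EuclideanSpace.norm_sq_eq]
  refine Finset.sum_le_sum fun z _ => ?_
  split_ifs with hz
  · exact pow_le_pow_left₀ hh (by simpa using he z hz) 2
  · positivity

/-- If `w` is close to a vector that is `h` larger on `V` than elsewhere, then few of the top
coordinates of `w` lie outside `V`, or almost all of `V` is among the top coordinates. -/
theorem topCoords_error {r : ℕ} {V : Finset (Fin n)} (hV : V ⊆ Z) (t : EuclideanSpace ℝ Z)
    {lo h τ : ℝ} (hh : 0 < h) (ht : ∀ z : Z, t z = if (z : Fin n) ∈ V then lo + h else lo)
    (hw : ‖w - t‖ ^ 2 ≤ τ) :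
    (#(topCoords r w \ V) : ℝ) * (h / 2) ^ 2 ≤ τ ∨ (#(V \ topCoords r w) : ℝ) * (h / 2) ^ 2 ≤ τ := by
  by_cases hc : ∀ z : Z, (z : Fin n) ∈ topCoords r w \ V → lo + h / 2 ≤ w z
  · left
    refine (card_mul_sq_le (Finset.sdiff_subset.trans (topCoords_subset w r)) (w - t)
      (by positivity) fun z hz => ?_).trans hw
    have h1 := hc z hz
    have h2 := ht z
    rw [if_neg (Finset.mem_sdiff.1 hz).2] at h2
    rw [PiLp.sub_apply, h2]
    exact le_trans (by linarith) (le_abs_self _)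
  · right
    push Not at hc
    obtain ⟨x, hx, hxw⟩ := hc
    refine (card_mul_sq_le (Finset.sdiff_subset.trans hV) (w - t)
      (by positivity) fun z hz => ?_).trans hw
    have h1 := le_of_mem_topCoords w (Finset.mem_sdiff.1 hx).1 (Finset.mem_sdiff.1 hz).2
    have h2 := ht z
    rw [if_pos (Finset.mem_sdiff.1 hz).1] at h2
    rw [PiLp.sub_apply, h2]
    exact le_trans (by linarith) (neg_le_abs _)

end TopCoords

/-! ### The selection step -/

section Selection

variable {n m k : ℕ} {X : Fin m → Finset (Fin n)} {score : Fin m → ℚ} {t : ℝ}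

theorem isKept_upper {G : Finset (Fin m)} (hG : m ≤ 2 * #G) :
    IsKept score {i | ∃ j ∈ G, score j ≤ score i} := by
  constructor
  · refine hG.trans (Nat.mul_le_mul_left 2 (Finset.card_le_card fun i hi => ?_))
    exact Finset.mem_filter.2 ⟨Finset.mem_univ _, i, hi, le_rfl⟩
  · intro i hi j hj
    simp only [Finset.mem_filter, Finset.mem_univ, true_and, not_exists, not_and, not_le] at hi hj
    obtain ⟨g, hg, hgi⟩ := hi
    exact (hj g hg).le.trans hgi

theorem exists_isSelection {G : Finset (Fin m)} (hG : m ≤ 2 * #G) {f : Fin k → Fin m}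
    (hf : IsSeparatedChoice X t G f) :
    ∃ U : Fin k → Finset (Fin n), IsSelection X score t U := by
  classical
  let P : Finset (Finset (Fin m)) :=
    {K | IsKept score K ∧ ∃ f : Fin k → Fin m, IsSeparatedChoice X t K f}
  have hne : P.Nonempty := by
    refine ⟨_, Finset.mem_filter.2 ⟨Finset.mem_univ _, isKept_upper hG, f, fun i => ?_, hf.2⟩⟩
    exact Finset.mem_filter.2 ⟨Finset.mem_univ _, f i, hf.1 i, le_rfl⟩
  obtain ⟨K, hK, hmin⟩ := Finset.exists_min_image P (fun K => #K) hne
  obtain ⟨-, hKk, g, hg⟩ := Finset.mem_filter.1 hK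
  exact ⟨fun i => X (g i), K, g, hKk, hg, fun _ => rfl, fun K' f' h1 h2 =>
    hmin K' (Finset.mem_filter.2 ⟨Finset.mem_univ _, h1, f', h2⟩)⟩

theorem IsSelection.exists_score_ge {G : Finset (Fin m)} (hG : m ≤ 2 * #G) {f : Fin k → Fin m}
    (hf : IsSeparatedChoice X t G f) {U : Fin k → Finset (Fin n)} (hU : IsSelection X score t U) :
    ∃ g : Fin k → Fin m, (∀ i, U i = X (g i)) ∧
      (∀ i j, i ≠ j → (#(U i ∩ U j) : ℝ) < t) ∧ ∀ i, ∃ j ∈ G, score j ≤ score (g i) := by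
  obtain ⟨K, g, hK, hg, hUg, hmin⟩ := hU
  refine ⟨g, hUg, fun i j hij => by rw [hUg, hUg]; exact hg.2 i j hij, fun i => ?_⟩
  have hle := hmin _ f (isKept_upper hG)
    ⟨fun i => Finset.mem_filter.2 ⟨Finset.mem_univ _, f i, hf.1 i, le_rfl⟩, hf.2⟩
  by_contra hcon
  push Not at hcon
  have hsub : ({i | ∃ j ∈ G, score j ≤ score i} : Finset (Fin m)) ⊆ K := by
    intro l hl
    by_contra hlK
    obtain ⟨-, j, hj, hjl⟩ := Finset.mem_filter.1 hl
    exact absurd (hK.2 _ (hg.1 i) l hlK) (not_le.2 ((hcon j hj).trans_le hjl))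
  have hss : ({i | ∃ j ∈ G, score j ≤ score i} : Finset (Fin m)) ⊂ K := by
    refine (Finset.ssubset_iff_of_subset hsub).2 ⟨g i, hg.1 i, fun h => ?_⟩
    obtain ⟨-, j, hj, hjl⟩ := Finset.mem_filter.1 h
    exact absurd hjl (not_le.2 (hcon j hj))
  exact absurd hle (not_le.2 (Finset.card_lt_card hss))

end Selection

/-! ### Correctness -/

section Correct

variable {n k : ℕ} {β : Fin n → Fin k}

/-- The part of the block `i` inside `Z`. -/
def blockIn (β : Fin n → Fin k) (Z : Finset (Fin n)) (i : Fin k) : Finset (Fin n) :=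
  {v ∈ Z | β v = i}

theorem mem_blockIn {Z : Finset (Fin n)} {i : Fin k} {v : Fin n} :
    v ∈ blockIn β Z i ↔ v ∈ Z ∧ β v = i := Finset.mem_filter

theorem sum_card_blockIn (β : Fin n → Fin k) (Z : Finset (Fin n)) :
    ∑ i, #(blockIn β Z i) = #Z :=
  (Finset.card_eq_sum_card_fiberwise (fun v _ => Finset.mem_coe.2 (Finset.mem_univ (β v)))).symm

theorem isCorrect_of_majority {γ s : ℝ} (hγ0 : 0 < γ) (hγ1 : γ ≤ 1) (hs : 0 < s)
    {Z : Finset (Fin n)} {U : Fin k → Finset (Fin n)}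
    (hZ : ∀ i, (#(blockIn β Z i) : ℝ) ≤ (1 + γ / 4) * s)
    (hU : ∀ i, ∃ l, (1 - γ / 4) * s ≤ #(blockIn β (U i) l))
    (hUZ : ∀ i, U i ⊆ Z)
    (hsep : ∀ i j, i ≠ j → (#(U i ∩ U j) : ℝ) < 0.2 * s) :
    IsCorrect γ β Z U := by
  choose l hl using hU
  have hsub : ∀ i, blockIn β (U i) (l i) ⊆ blockIn β Z (l i) := fun i v hv => by
    rw [mem_blockIn] at hv ⊢
    exact ⟨hUZ i hv.1, hv.2⟩
  have hinj : Function.Injective l := by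
    intro i j hij
    by_contra hne
    have h1 := hsep i j hne
    have h2 : #(blockIn β (U i) (l i)) + #(blockIn β (U j) (l j)) ≤
        #(blockIn β Z (l i)) + #(U i ∩ U j) := by
      rw [← Finset.card_union_add_card_inter]
      refine Nat.add_le_add (Finset.card_le_card (Finset.union_subset (hsub i) ?_))
        (Finset.card_le_card ?_)
      · rw [hij]; exact hsub j
      · exact Finset.inter_subset_inter (Finset.filter_subset _ _) (Finset.filter_subset _ _)
    have h3 : (#(blockIn β (U i) (l i)) : ℝ) + #(blockIn β (U j) (l j)) ≤
        #(blockIn β Z (l i)) + #(U i ∩ U j) := by exact_mod_cast h2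
    have := hl i
    have := hl j
    have := hZ (l i)
    nlinarith
  refine ⟨Equiv.ofBijective l (Finite.injective_iff_bijective.1 hinj), fun i => ?_⟩
  have h1 : ({v ∈ Z | β v = l i} ∩ U i : Finset (Fin n)) = blockIn β (U i) (l i) := by
    ext v
    simp only [Finset.mem_inter, Finset.mem_filter, mem_blockIn]
    exact ⟨fun h => ⟨h.2, h.1.2⟩, fun h => ⟨⟨hUZ i h.1, h.2⟩, h.1⟩⟩
  rw [Equiv.ofBijective_apply, h1]
  refine le_trans ?_ (hl i)
  calc (1 - γ) * (#{v ∈ Z | β v = l i} : ℝ) ≤ (1 - γ) * ((1 + γ / 4) * s) :=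
        mul_le_mul_of_nonneg_left (hZ (l i)) (by linarith)
    _ ≤ (1 - γ / 4) * s := by nlinarith [mul_pos hγ0 hs, mul_pos (mul_pos hγ0 hγ0) hs]

theorem edgeProb_mk (β : Fin n → Fin k) (a b : ℝ) (u v : Fin n) :
    edgeProb β a b s(u, v) = if β u = β v then a / n else b / n := by
  unfold edgeProb
  by_cases h : β u = β v
  · rw [if_pos h, if_pos]
    intro x hx y hy
    rcases Sym2.mem_iff.1 hx with rfl | rfl <;> rcases Sym2.mem_iff.1 hy with rfl | rfl <;> simp [h]
  · rw [if_neg h, if_neg]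
    intro hcon
    exact h (hcon u (Sym2.mem_mk_left _ _) v (Sym2.mem_mk_right _ _))

/-- Number of ordered pairs of adjacent vertices in `X`, in expectation when edges are present with
half the probability of the block model. -/
noncomputable def meanPairs (β : Fin n → Fin k) (a b : ℝ) (X : Finset (Fin n)) : ℝ :=
  ∑ x ∈ X, ∑ y ∈ X, if x = y then 0 else edgeProb β a b s(x, y) / 2

theorem meanPairs_eq (β : Fin n → Fin k) (a b : ℝ) (X : Finset (Fin n)) :
    meanPairs β a b X = b / (2 * n) * (#X : ℝ) ^ 2 +
      (a - b) / (2 * n) * ∑ l, (#(blockIn β X l) : ℝ) ^ 2 - #X * (a / (2 * n)) := by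
  have h1 : ∀ x ∈ X, ∑ y ∈ X, (if x = y then 0 else edgeProb β a b s(x, y) / 2) =
      b / (2 * n) * #X + (a - b) / (2 * n) * #(blockIn β X (β x)) - a / (2 * n) := by
    intro x hx
    have h2 : ∀ y ∈ X, (if x = y then 0 else edgeProb β a b s(x, y) / 2) =
        b / (2 * n) + (a - b) / (2 * n) * (if β y = β x then 1 else 0) -
          (if x = y then a / (2 * n) else 0) := by
      intro y _
      rw [edgeProb_mk]
      by_cases hxy : x = y
      · subst hxy; simp; ring
      · rw [if_neg hxy, if_neg hxy]
        by_cases hb : β x = β y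
        · rw [if_pos hb, if_pos hb.symm]; ring
        · rw [if_neg hb, if_neg (Ne.symm hb)]; ring
    rw [Finset.sum_congr rfl h2, Finset.sum_sub_distrib, Finset.sum_add_distrib, ← Finset.mul_sum,
      Finset.sum_ite_eq, if_pos hx, Finset.sum_boole, Finset.sum_const, nsmul_eq_mul]
    simp only [blockIn]
    ring
  have h3 : ∑ l, (#(blockIn β X l) : ℝ) ^ 2 = ∑ x ∈ X, (#(blockIn β X (β x)) : ℝ) := by
    rw [← Finset.sum_fiberwise X β]
    refine Finset.sum_congr rfl fun l _ => ?_
    have : ∀ x ∈ ({x ∈ X | β x = l} : Finset (Fin n)),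
        (#(blockIn β X (β x)) : ℝ) = #(blockIn β X l) := fun x hx => by
      rw [(Finset.mem_filter.1 hx).2]
    rw [Finset.sum_congr rfl this, Finset.sum_const, nsmul_eq_mul, sq]
    rfl
  rw [meanPairs, Finset.sum_congr rfl h1, Finset.sum_sub_distrib, Finset.sum_add_distrib,
    h3, Finset.sum_const, Finset.sum_const, nsmul_eq_mul, nsmul_eq_mul, Finset.mul_sum]
  ring

/-- The number of ordered pairs of adjacent vertices in `X`. -/
noncomputable def pairCount (G : SimpleGraph (Fin n)) (X : Finset (Fin n)) : ℝ :=
  haveI := Classical.decRel G.Adj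
  ∑ x ∈ X, ∑ y ∈ X, if G.Adj x y then 1 else 0

theorem density_eq (G : SimpleGraph (Fin n)) (X : Finset (Fin n)) :
    ((density G X : ℚ) : ℝ) = pairCount G X / (#X : ℝ) ^ 2 := by
  classical
  unfold density pairCount
  rw [SimpleGraph.edgeDensity_def]
  push_cast
  rw [sq]
  congr 1
  rw [SimpleGraph.interedges, Rel.interedges, ← Finset.sum_product', Finset.sum_boole]

/-- A set that is at least as dense as one concentrated on a single block is itself concentrated. -/
theorem exists_block_of_density_ge {a b Δ g : ℝ} (hn : 0 < n) (hab : b < a)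
    {G : SimpleGraph (Fin n)} {X X₀ : Finset (Fin n)} (hX : 0 < #X) (hcard : #X₀ = #X)
    (hd : density G X₀ ≤ density G X)
    (hΔ : |pairCount G X - meanPairs β a b X| ≤ Δ)
    (hΔ₀ : |pairCount G X₀ - meanPairs β a b X₀| ≤ Δ) {l₀ : Fin k}
    (hg : (#X : ℝ) - g ≤ #(blockIn β X₀ l₀)) (hgX : g ≤ #X) :
    ∃ l, (#X : ℝ) - 2 * g - 4 * n * Δ / ((a - b) * #X) ≤ #(blockIn β X l) := by
  have hξ : (0 : ℝ) < #X := by exact_mod_cast hX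
  have hn0 : (0 : ℝ) < n := by exact_mod_cast hn
  have hab0 : 0 < a - b := by linarith
  have hd' : pairCount G X₀ ≤ pairCount G X := by
    have : ((density G X₀ : ℚ) : ℝ) ≤ ((density G X : ℚ) : ℝ) := by exact_mod_cast hd
    rw [density_eq, density_eq, hcard] at this
    exact (div_le_div_iff_of_pos_right (by positivity)).1 this
  have hm : meanPairs β a b X₀ - 2 * Δ ≤ meanPairs β a b X := by
    have h1 := (abs_le.1 hΔ).2
    have h2 := (abs_le.1 hΔ₀).1
    linarith
  rw [meanPairs_eq, meanPairs_eq, hcard] at hm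
  have hΔ0 : 0 ≤ Δ := (abs_nonneg _).trans hΔ
  -- compare the sums of squares
  have hsq : (a - b) / (2 * n) * (#X - g) ^ 2 - 2 * Δ ≤
      (a - b) / (2 * n) * ∑ l, (#(blockIn β X l) : ℝ) ^ 2 := by
    have h1 : ((#X : ℝ) - g) ^ 2 ≤ ∑ l, (#(blockIn β X₀ l) : ℝ) ^ 2 := by
      refine (pow_le_pow_left₀ (by linarith) hg 2).trans ?_
      exact Finset.single_le_sum (f := fun l => (#(blockIn β X₀ l) : ℝ) ^ 2)
        (fun _ _ => sq_nonneg _) (Finset.mem_univ l₀)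
    have h2 := mul_le_mul_of_nonneg_left h1 (by positivity : 0 ≤ (a - b) / (2 * n))
    linarith
  by_contra hcon
  push Not at hcon
  obtain ⟨q, hq⟩ : ∃ q : ℝ, q = #X - 2 * g - 4 * n * Δ / ((a - b) * #X) := ⟨_, rfl⟩
  rw [← hq] at hcon
  -- the inequality is strict on a nonempty block
  obtain ⟨x, hx⟩ := Finset.card_pos.1 hX
  have hlt : ∑ l, (#(blockIn β X l) : ℝ) ^ 2 < q * #X := by
    rw [← sum_card_blockIn β X]
    push_cast
    rw [Finset.mul_sum]
    refine Finset.sum_lt_sum (fun l _ => ?_) ⟨β x, Finset.mem_univ _, ?_⟩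
    · rw [sq]
      exact mul_le_mul_of_nonneg_right (hcon l).le (Nat.cast_nonneg _)
    · rw [sq]
      refine mul_lt_mul_of_pos_right (hcon _) ?_
      exact_mod_cast Finset.card_pos.2 ⟨x, mem_blockIn.2 ⟨hx, rfl⟩⟩
  have h3 : (a - b) / (2 * n) * (q * #X) =
      (a - b) / (2 * n) * ((#X - 2 * g) * #X) - 2 * Δ := by
    rw [hq]; field_simp; ring
  have h4 : (a - b) / (2 * n) * ∑ l, (#(blockIn β X l) : ℝ) ^ 2 <
      (a - b) / (2 * n) * (q * #X) := by gcongr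
  have h5 : (a - b) / (2 * n) * ((#X - 2 * g) * #X) ≤ (a - b) / (2 * n) * (#X - g) ^ 2 := by
    gcongr
    nlinarith [sq_nonneg g]
  linarith

end Correct

section Edges

variable {n k : ℕ} {β : Fin n → Fin k} {a b : ℝ}

/-- The standing assumptions on the parameters. -/
structure Params (n k : ℕ) (a b : ℝ) : Prop where
  n_pos : 0 < n
  k_pos : 0 < k
  b_pos : 0 < b
  b_lt : b < a
  a_le : a ≤ n
  sq_le : (k : ℝ) ^ 2 ≤ a

/-- The law of the edge coin and the colour coin of a pair of vertices. -/
noncomputable def edgeWeight (β : Fin n → Fin k) (a b : ℝ) (e : Sym2 (Fin n)) (x : Bool × Bool) : ℝ :=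
  (if x.1 then edgeProb β a b e else 1 - edgeProb β a b e) * (1 / 2)

theorem edgeProb_nonneg (H : Params n k a b) (e : Sym2 (Fin n)) : 0 ≤ edgeProb β a b e := by
  have := H.b_pos; have := H.b_lt
  unfold edgeProb
  split_ifs <;> exact div_nonneg (by linarith) (Nat.cast_nonneg _)

theorem edgeProb_le (H : Params n k a b) (e : Sym2 (Fin n)) : edgeProb β a b e ≤ a / n := by
  have := H.b_lt
  unfold edgeProb
  split_ifs
  · exact le_rfl
  · gcongr

theorem edgeProb_le_one (H : Params n k a b) (e : Sym2 (Fin n)) : edgeProb β a b e ≤ 1 := by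
  refine (edgeProb_le H e).trans ?_
  rw [div_le_one (by exact_mod_cast H.n_pos)]
  exact H.a_le

theorem isWeight_edgeWeight (H : Params n k a b) : IsWeight (edgeWeight β a b) where
  nonneg e x := by
    have h0 := edgeProb_nonneg (β := β) H e
    have h1 := edgeProb_le_one (β := β) H e
    unfold edgeWeight
    split_ifs <;> refine mul_nonneg ?_ (by norm_num) <;> linarith
  sum_eq e := by
    simp [Fintype.sum_prod_type, edgeWeight]; ring

/-- Indicator of a Red edge. -/
def redVal (x : Bool × Bool) : ℝ := if x.1 = true ∧ x.2 = true then 1 else 0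

/-- Indicator of a Blue edge. -/
def blueVal (x : Bool × Bool) : ℝ := if x.1 = true ∧ x.2 = false then 1 else 0

theorem redVal_zero_one (x : Bool × Bool) : redVal x = 0 ∨ redVal x = 1 := by
  unfold redVal; split_ifs <;> simp

theorem redVal_nonneg (x : Bool × Bool) : 0 ≤ redVal x := by
  unfold redVal; split_ifs <;> norm_num

theorem sum_edgeWeight_redVal (e : Sym2 (Fin n)) :
    ∑ x, edgeWeight β a b e x * redVal x = edgeProb β a b e / 2 := by
  simp [Fintype.sum_prod_type, edgeWeight, redVal]; ring

theorem sum_edgeWeight_blueVal (e : Sym2 (Fin n)) :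
    ∑ x, edgeWeight β a b e x * blueVal x = edgeProb β a b e / 2 := by
  simp [Fintype.sum_prod_type, edgeWeight, blueVal]; ring

theorem sum_edgeWeight_centred_sq_le (H : Params n k a b) (e : Sym2 (Fin n)) {f : Bool × Bool → ℝ}
    (h01 : ∀ x, f x = 0 ∨ f x = 1)
    (hf : ∑ x, edgeWeight β a b e x * f x = edgeProb β a b e / 2) :
    ∑ x, edgeWeight β a b e x * (f x - edgeProb β a b e / 2) ^ 2 ≤ a / (2 * n) := by
  have h1 : ∀ x, edgeWeight β a b e x * (f x - edgeProb β a b e / 2) ^ 2 =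
      (1 - edgeProb β a b e) * (edgeWeight β a b e x * f x) +
        (edgeProb β a b e / 2) ^ 2 * edgeWeight β a b e x := by
    intro x
    rcases h01 x with h | h <;> rw [h] <;> ring
  simp_rw [h1]
  rw [Finset.sum_add_distrib, ← Finset.mul_sum, ← Finset.mul_sum, hf,
    (isWeight_edgeWeight H).sum_eq]
  have h2 := edgeProb_le (β := β) H e
  have h3 : a / (2 * n) = a / n / 2 := by ring
  rw [h3]
  nlinarith [sq_nonneg (edgeProb β a b e)]

theorem sum_edgeWeight_centred (H : Params n k a b) (e : Sym2 (Fin n)) {f : Bool × Bool → ℝ}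
    (hf : ∑ x, edgeWeight β a b e x * f x = edgeProb β a b e / 2) :
    ∑ x, edgeWeight β a b e x * (f x - edgeProb β a b e / 2) = 0 := by
  simp_rw [mul_sub]
  rw [Finset.sum_sub_distrib, hf, ← Finset.sum_mul, (isWeight_edgeWeight H).sum_eq]
  ring

theorem card_block (hβ : EqualBlocks β) (hk : 0 < k) (i : Fin k) :
    (#{v | β v = i} : ℝ) = n / k := by
  have := hβ i
  rw [eq_div_iff (by positivity), mul_comm]
  exact_mod_cast this

theorem card_blockIn_le (hβ : EqualBlocks β) (hk : 0 < k) (Z : Finset (Fin n)) (i : Fin k) :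
    (#(blockIn β Z i) : ℝ) ≤ n / k := by
  rw [← card_block hβ hk i]
  exact_mod_cast Finset.card_le_card (Finset.filter_subset_filter _ (Finset.subset_univ Z))

theorem sum_edgeProb (H : Params n k a b) (hβ : EqualBlocks β) (u : Fin n) :
    ∑ v, edgeProb β a b s(u, v) = avgDegree k a b := by
  have hk : (0 : ℝ) < k := by exact_mod_cast H.k_pos
  have hn : (0 : ℝ) < n := by exact_mod_cast H.n_pos
  have h1 : ∀ v, edgeProb β a b s(u, v) = b / n + (a / n - b / n) * if β v = β u then 1 else 0 := by
    intro v
    rw [edgeProb_mk]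
    by_cases h : β u = β v
    · rw [if_pos h, if_pos h.symm]; ring
    · rw [if_neg h, if_neg (Ne.symm h)]; ring
  simp_rw [h1]
  rw [Finset.sum_add_distrib, ← Finset.mul_sum, Finset.sum_boole, card_block hβ H.k_pos,
    Finset.sum_const, Finset.card_univ, Fintype.card_fin, nsmul_eq_mul, avgDegree]
  field_simp
  ring

theorem Params.le_avgDegree (H : Params n k a b) : a / k ≤ avgDegree k a b := by
  have hk : (1 : ℝ) ≤ k := by exact_mod_cast H.k_pos
  have := H.b_pos
  unfold avgDegree
  gcongr
  nlinarith

theorem Params.b_le_avgDegree (H : Params n k a b) : b ≤ avgDegree k a b := by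
  have hk : (0 : ℝ) < k := by exact_mod_cast H.k_pos
  have := H.b_lt
  unfold avgDegree
  rw [le_div_iff₀ hk]
  nlinarith

theorem Params.avgDegree_le (H : Params n k a b) : avgDegree k a b ≤ a := by
  have hk : (1 : ℝ) ≤ k := by exact_mod_cast H.k_pos
  have := H.b_lt
  unfold avgDegree
  rw [div_le_iff₀ (by linarith)]
  nlinarith

theorem Params.a_pos (H : Params n k a b) : 0 < a := H.b_pos.trans H.b_lt

theorem Params.avgDegree_pos (H : Params n k a b) : 0 < avgDegree k a b :=
  H.b_pos.trans_le H.b_le_avgDegree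

theorem Params.k_le_avgDegree (H : Params n k a b) : (k : ℝ) ≤ avgDegree k a b := by
  have hk : (0 : ℝ) < k := by exact_mod_cast H.k_pos
  refine le_trans ?_ H.le_avgDegree
  rw [le_div_iff₀ hk]
  have := H.sq_le
  nlinarith

/-! ### The norm of the noise -/

/-- The bilinear form of the centred Red matrix, restricted to vertices of moderate degree, has
norm `O(√d)`. -/
def NoiseBounded (β : Fin n → Fin k) (a b : ℝ) (Z Y : Finset (Fin n))
    (η : Sym2 (Fin n) → Bool × Bool) : Prop :=
  ∀ R ⊆ Z, ∀ S ⊆ Y, (∀ z ∈ R, ∑ y ∈ Y, redVal (η s(z, y)) ≤ 20 * avgDegree k a b) →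
    (∀ y ∈ S, ∑ z ∈ Z, redVal (η s(z, y)) ≤ 20 * avgDegree k a b) → ∀ u v : Fin n → ℝ,
    |∑ z ∈ R, ∑ y ∈ S, (redVal (η s(z, y)) - edgeProb β a b s(z, y) / 2) * (u z * v y)| ≤
      300000 * √(avgDegree k a b) * √(∑ z ∈ Z, u z ^ 2) * √(∑ y ∈ Y, v y ^ 2)

theorem sum_filter_coe {M : Type*} [AddCommMonoid M] (A R : Finset (Fin n)) (f : Fin n → M) :
    ∑ x ∈ ({x : A | (x : Fin n) ∈ R} : Finset A), f x = ∑ x ∈ A with x ∈ R, f x := by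
  rw [Finset.sum_filter, Finset.sum_filter]
  exact Finset.sum_coe_sort A fun x => if x ∈ R then f x else 0

theorem sum_filter_coe_of_subset {M : Type*} [AddCommMonoid M] {A R : Finset (Fin n)} (h : R ⊆ A)
    (f : Fin n → M) : ∑ x ∈ ({x : A | (x : Fin n) ∈ R} : Finset A), f x = ∑ x ∈ R, f x := by
  rw [sum_filter_coe, Finset.filter_mem_eq_inter, Finset.inter_eq_right.2 h]

theorem sym2_eq_of_disjoint {Z Y : Finset (Fin n)} (hZY : Disjoint Z Y) {z y z' y' : Fin n}
    (hz : z ∈ Z) (hy' : y' ∈ Y) (h : s(z, y) = s(z', y')) : z = z' ∧ y = y' := by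
  rcases Sym2.eq_iff.1 h with h | ⟨rfl, rfl⟩
  · exact h
  · exact absurd hy' (Finset.disjoint_left.1 hZY hz)

theorem noiseBounded_of_blocks {Z Y : Finset (Fin n)} {η : Sym2 (Fin n) → Bool × Bool}
    (hdiag : ∀ i, TrimmedBounded (avgDegree k a b)
      (fun (x : blockIn β Z i) (y : blockIn β Y i) => redVal (η s(x, y)))
      (fun x y => edgeProb β a b s((x : Fin n), (y : Fin n)) / 2))
    (hoff : TrimmedBounded (avgDegree k a b)
      (fun (x : Z) (y : Y) => if β x = β y then 0 else redVal (η s(x, y)))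
      (fun x y => if β x = β y then 0 else edgeProb β a b s((x : Fin n), (y : Fin n)) / 2)) :
    NoiseBounded β a b Z Y η := by
  classical
  intro R hR S hS hrow hcol u v
  set d := avgDegree k a b
  set T : Fin n → Fin n → ℝ := fun z y =>
    (redVal (η s(z, y)) - edgeProb β a b s(z, y) / 2) * (u z * v y) with hT
  have hsplit : ∑ z ∈ R, ∑ y ∈ S, T z y =
      (∑ i, ∑ z ∈ blockIn β Z i with z ∈ R, ∑ y ∈ blockIn β Y i with y ∈ S, T z y) +
      ∑ z ∈ R, ∑ y ∈ S, if β z = β y then 0 else T z y := by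
    have h1 : ∑ i, ∑ z ∈ blockIn β Z i with z ∈ R, ∑ y ∈ blockIn β Y i with y ∈ S, T z y =
        ∑ z ∈ R, ∑ y ∈ S, if β z = β y then T z y else 0 := by
      rw [← Finset.sum_fiberwise R β]
      refine Finset.sum_congr rfl fun i _ => ?_
      have e1 : ({z ∈ blockIn β Z i | z ∈ R} : Finset (Fin n)) = {z ∈ R | β z = i} := by
        ext z
        simp only [Finset.mem_filter, mem_blockIn]
        exact ⟨fun h => ⟨h.2, h.1.2⟩, fun h => ⟨⟨hR h.1, h.2⟩, h.1⟩⟩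
      rw [e1]
      refine Finset.sum_congr rfl fun z hz => ?_
      obtain ⟨-, rfl⟩ := Finset.mem_filter.1 hz
      rw [← Finset.sum_filter]
      congr 1
      ext y
      simp only [Finset.mem_filter, mem_blockIn]
      exact ⟨fun h => ⟨h.2, h.1.2.symm⟩, fun h => ⟨⟨hS h.1, h.2.symm⟩, h.1⟩⟩
    rw [h1, ← Finset.sum_add_distrib]
    refine Finset.sum_congr rfl fun z _ => ?_
    rw [← Finset.sum_add_distrib]
    refine Finset.sum_congr rfl fun y _ => ?_
    split_ifs <;> simp
  have hd : ∀ i, |∑ z ∈ blockIn β Z i with z ∈ R, ∑ y ∈ blockIn β Y i with y ∈ S, T z y| ≤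
      150000 * √d * (√(∑ z ∈ blockIn β Z i, u z ^ 2) * √(∑ y ∈ blockIn β Y i, v y ^ 2)) := by
    intro i
    have h := hdiag i ({x : blockIn β Z i | (x : Fin n) ∈ R} : Finset _)
      ({y : blockIn β Y i | (y : Fin n) ∈ S} : Finset _) (fun x hx => ?_) (fun y hy => ?_)
      (fun x => u x) (fun y => v y)
    · rw [Finset.sum_coe_sort (blockIn β Z i) (fun z => u z ^ 2),
        Finset.sum_coe_sort (blockIn β Y i) (fun z => v z ^ 2)] at h
      rw [← mul_assoc]
      refine le_trans (le_of_eq ?_) h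
      rw [← sum_filter_coe]
      congr 1
      refine Finset.sum_congr rfl fun x _ => ?_
      rw [← sum_filter_coe]
    · refine le_trans ?_ (hrow x (Finset.mem_filter.1 hx).2)
      rw [Finset.sum_coe_sort (blockIn β Y i) (fun y => redVal (η s((x : Fin n), y)))]
      exact Finset.sum_le_sum_of_subset_of_nonneg (Finset.filter_subset _ _)
        fun _ _ _ => redVal_nonneg _
    · refine le_trans ?_ (hcol y (Finset.mem_filter.1 hy).2)
      rw [Finset.sum_coe_sort (blockIn β Z i) (fun x => redVal (η s(x, (y : Fin n))))]
      exact Finset.sum_le_sum_of_subset_of_nonneg (Finset.filter_subset _ _)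
        fun _ _ _ => redVal_nonneg _
  have ho : |∑ z ∈ R, ∑ y ∈ S, if β z = β y then 0 else T z y| ≤
      150000 * √d * √(∑ z ∈ Z, u z ^ 2) * √(∑ y ∈ Y, v y ^ 2) := by
    have h := hoff ({x : Z | (x : Fin n) ∈ R} : Finset _)
      ({y : Y | (y : Fin n) ∈ S} : Finset _) (fun x hx => ?_) (fun y hy => ?_)
      (fun x => u x) (fun y => v y)
    · rw [Finset.sum_coe_sort Z (fun z => u z ^ 2),
        Finset.sum_coe_sort Y (fun z => v z ^ 2)] at h
      refine le_trans (le_of_eq ?_) h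
      rw [← sum_filter_coe_of_subset hR]
      congr 1
      refine Finset.sum_congr rfl fun x _ => ?_
      rw [← sum_filter_coe_of_subset hS]
      refine Finset.sum_congr rfl fun y _ => ?_
      simp only [hT]
      split_ifs <;> ring
    · refine le_trans ?_ (hrow x (Finset.mem_filter.1 hx).2)
      rw [Finset.sum_coe_sort Y (fun y => if β x = β y then 0 else redVal (η s((x : Fin n), y)))]
      refine Finset.sum_le_sum fun y _ => ?_
      split_ifs; exacts [redVal_nonneg _, le_rfl]
    · refine le_trans ?_ (hcol y (Finset.mem_filter.1 hy).2)
      rw [Finset.sum_coe_sort Z (fun x => if β x = β y then 0 else redVal (η s(x, (y : Fin n))))]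
      refine Finset.sum_le_sum fun y _ => ?_
      split_ifs; exacts [redVal_nonneg _, le_rfl]
  have hsum : ∑ i, 150000 * √d * (√(∑ z ∈ blockIn β Z i, u z ^ 2) *
      √(∑ y ∈ blockIn β Y i, v y ^ 2)) ≤
      150000 * √d * (√(∑ z ∈ Z, u z ^ 2) * √(∑ y ∈ Y, v y ^ 2)) := by
    rw [← Finset.mul_sum, ← Finset.sum_fiberwise Z β, ← Finset.sum_fiberwise Y β]
    refine mul_le_mul_of_nonneg_left ?_ (by positivity)
    exact Real.sum_sqrt_mul_sqrt_le _ (fun i => Finset.sum_nonneg fun _ _ => sq_nonneg _)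
      (fun i => Finset.sum_nonneg fun _ _ => sq_nonneg _)
  rw [hsplit]
  refine (abs_add_le _ _).trans ?_
  have := (Finset.abs_sum_le_sum_abs (fun i => ∑ z ∈ blockIn β Z i with z ∈ R,
    ∑ y ∈ blockIn β Y i with y ∈ S, T z y) Finset.univ).trans
    ((Finset.sum_le_sum fun i _ => hd i).trans hsum)
  linarith

theorem pr_not_noiseBounded_le (H : Params n k a b) (hβ : EqualBlocks β) {Z Y : Finset (Fin n)}
    (hZY : Disjoint Z Y) :
    pr (edgeWeight β a b) (fun η => ¬ NoiseBounded β a b Z Y η) ≤ 4 * (k : ℝ) ^ 2 / n := by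
  have hw := isWeight_edgeWeight (β := β) H
  have hn : (0 : ℝ) < n := by exact_mod_cast H.n_pos
  have hk : (1 : ℝ) ≤ k := by exact_mod_cast H.k_pos
  have hk0 : (0 : ℝ) < k := by linarith
  have hd := H.avgDegree_pos
  have hsub : ∀ (A : Finset (Fin n)) i, blockIn β A i ⊆ A := fun A i => Finset.filter_subset _ _
  have hdiag : ∀ i, IsRandomBipartite (edgeWeight β a b)
      (fun (x : blockIn β Z i) (y : blockIn β Y i) => s((x : Fin n), (y : Fin n)))
      (fun _ _ => redVal) (n / k) (avgDegree k a b) := by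
    intro i
    refine ⟨hw, ?_, fun _ _ => redVal_zero_one, ?_, ?_, ?_⟩
    · intro x y x' y' h
      obtain ⟨h1, h2⟩ := sym2_eq_of_disjoint hZY (hsub Z i x.2) (hsub Y i y'.2) h
      exact ⟨Subtype.ext h1, Subtype.ext h2⟩
    · intro x y
      rw [sum_edgeWeight_redVal]
      have h1 := edgeProb_le (β := β) H s((x : Fin n), (y : Fin n))
      have h2 := H.le_avgDegree
      rw [div_le_iff₀ hk0] at h2
      have h3 : a / n ≤ avgDegree k a b / (n / k) := by
        rw [div_div_eq_mul_div]; gcongr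
      have h4 := edgeProb_nonneg (β := β) H s((x : Fin n), (y : Fin n))
      linarith
    · simpa using card_blockIn_le hβ H.k_pos Z i
    · simpa using card_blockIn_le hβ H.k_pos Y i
  have hmask : ∀ x y : Fin n, ∑ c, edgeWeight β a b s(x, y) c *
      (if β x = β y then 0 else redVal c) = if β x = β y then 0 else edgeProb β a b s(x, y) / 2 := by
    intro x y
    split_ifs
    · simp
    · exact sum_edgeWeight_redVal _
  have hoff : IsRandomBipartite (edgeWeight β a b)
      (fun (x : Z) (y : Y) => s((x : Fin n), (y : Fin n)))
      (fun x y c => if β x = β y then 0 else redVal c) n (avgDegree k a b) := by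
    refine ⟨hw, ?_, fun x y c => ?_, ?_, ?_, ?_⟩
    · intro x y x' y' h
      obtain ⟨h1, h2⟩ := sym2_eq_of_disjoint hZY x.2 y'.2 h
      exact ⟨Subtype.ext h1, Subtype.ext h2⟩
    · split_ifs
      · exact Or.inl rfl
      · exact redVal_zero_one c
    · intro x y
      rw [hmask]
      split_ifs with h
      · positivity
      · rw [edgeProb_mk, if_neg h]
        have h1 := H.b_le_avgDegree
        have h2 := H.b_pos
        rw [div_div]
        exact div_le_div₀ hd.le h1 hn (by linarith)
    · simpa using Finset.card_le_univ Z
    · simpa using Finset.card_le_univ Y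
  -- `n / k` is the size of a block, hence at least one when there are vertices
  have hnk : (1 : ℝ) ≤ n / k := by
    let v₀ : Fin n := ⟨0, H.n_pos⟩
    rw [← card_block hβ H.k_pos (β v₀)]
    exact_mod_cast Finset.card_pos.2 ⟨v₀, by simp⟩
  have p1 := fun i => (hdiag i).pr_not_trimmedBounded_le hnk hd
  have p2 := hoff.pr_not_trimmedBounded_le (by exact_mod_cast H.n_pos) hd
  refine (pr_mono hw (Q := fun η => (∃ i ∈ (Finset.univ : Finset (Fin k)), ¬ TrimmedBounded (avgDegree k a b)
      (fun (x : blockIn β Z i) (y : blockIn β Y i) => redVal (η s(x, y)))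
      (entryMean (edgeWeight β a b)
        (fun (x : blockIn β Z i) (y : blockIn β Y i) => s((x : Fin n), (y : Fin n)))
        (fun _ _ => redVal))) ∨ ¬ TrimmedBounded (avgDegree k a b)
      (fun (x : Z) (y : Y) => if β x = β y then 0 else redVal (η s(x, y)))
      (entryMean (edgeWeight β a b) (fun (x : Z) (y : Y) => s((x : Fin n), (y : Fin n)))
        (fun x y c => if β x = β y then 0 else redVal c))) ?_).trans
    ((pr_or_le hw _ _).trans ((add_le_add ((pr_exists_le hw _ _).trans
      (Finset.sum_le_sum fun i _ => p1 i)) p2).trans ?_))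
  · intro η hη
    by_contra hcon
    push Not at hcon
    refine hη (noiseBounded_of_blocks (fun i => ?_) ?_)
    · have := hcon.1 i (Finset.mem_univ _)
      convert this using 1
      funext x y
      exact (sum_edgeWeight_redVal _).symm
    · have := hcon.2
      convert this using 1
      funext x y
      exact (hmask _ _).symm
  · rw [Finset.sum_const, Finset.card_univ, Fintype.card_fin, nsmul_eq_mul]
    have e1 : (k : ℝ) * (2 / (n / k)) + 2 / n = (2 * k ^ 2 + 2) / n := by field_simp
    rw [e1]
    gcongr
    nlinarith

/-! ### Vertices of large degree -/

theorem exp_one_sub_one_le : Real.exp 1 - 1 ≤ 2 := by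
  have := Real.exp_one_lt_three; linarith

theorem resample_eq_of_notMem {J : Finset (Sym2 (Fin n))} {η ω : Sym2 (Fin n) → Bool × Bool}
    {e : Sym2 (Fin n)} (he : e ∉ J) : J.piecewise η ω e = ω e := Finset.piecewise_eq_of_notMem _ _ _ he

theorem pr_many_large_degrees_le (H : Params n k a b) (hβ : EqualBlocks β) {Z Y : Finset (Fin n)}
    (hZY : Disjoint Z Y) :
    pr (edgeWeight β a b) (fun η => (n / a : ℝ) ≤
      #{z ∈ Z | 20 * avgDegree k a b < ∑ y ∈ Y, redVal (η s(z, y))}) ≤ k / n := by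
  classical
  have hw := isWeight_edgeWeight (β := β) H
  have hn : (0 : ℝ) < n := by exact_mod_cast H.n_pos
  have hk0 : (0 : ℝ) < k := by exact_mod_cast H.k_pos
  have ha := H.a_pos
  set d := avgDegree k a b with hdd
  have hd : 0 < d := H.avgDegree_pos
  let J : Fin n → Finset (Sym2 (Fin n)) := fun z => Y.image fun y => s(z, y)
  have hmem : ∀ z, ∀ y ∈ Y, s(z, y) ∈ J z := fun z y hy => Finset.mem_image_of_mem _ hy
  have h1 := pr_card_le hw Z J (fun z η => 20 * d < ∑ y ∈ Y, redVal (η s(z, y)))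
    (q := Real.exp (-(19 * d))) (Λ := Real.exp (9 * d)) (Real.one_le_exp (by positivity))
    (by
      intro z hz z' hz' hne ω η
      have : ∀ y ∈ Y, (J z).piecewise η ω s(z', y) = ω s(z', y) := by
        intro y hy
        refine resample_eq_of_notMem fun hmem => ?_
        obtain ⟨y', hy', h⟩ := Finset.mem_image.1 hmem
        exact hne (sym2_eq_of_disjoint hZY hz hy h).1
      rw [Finset.sum_congr rfl fun y hy => by rw [this y hy]])
    (by
      intro z hz ω
      have e1 : ∀ η, ∑ y ∈ Y, redVal ((J z).piecewise η ω s(z, y)) = ∑ y ∈ Y, redVal (η s(z, y)) :=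
        fun η => Finset.sum_congr rfl fun y hy => by
          rw [Finset.piecewise_eq_of_mem _ _ _ (hmem z y hy)]
      simp only [e1]
      have := pr_sum_ge_le hw Y (fun y => s(z, y))
        (fun y hy y' hy' h => (sym2_eq_of_disjoint hZY hz hy' h).2) (fun _ => redVal)
        (fun _ => redVal_zero_one) (θ := 1) (μ := d / 2) zero_le_one (by
          simp only [sum_edgeWeight_redVal]
          rw [← Finset.sum_div, hdd, ← sum_edgeProb H hβ z]
          exact div_le_div_of_nonneg_right (Finset.sum_le_sum_of_subset_of_nonneg
            (Finset.subset_univ Y) fun _ _ _ => edgeProb_nonneg H _) zero_le_two) (20 * d)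
      refine (pr_mono hw fun η hη => le_of_lt hη).trans (this.trans (Real.exp_le_exp.2 ?_))
      nlinarith [exp_one_sub_one_le])
    (n / a)
  refine h1.trans ?_
  have hcard : (#Z : ℝ) ≤ n := by
    have := Finset.card_le_univ Z
    rw [Fintype.card_fin] at this
    exact_mod_cast this
  have h2 : (1 + (Real.exp (9 * d) - 1) * Real.exp (-(19 * d))) ^ #Z ≤
      Real.exp (n * Real.exp (-(10 * d))) := by
    have h3 : 1 + (Real.exp (9 * d) - 1) * Real.exp (-(19 * d)) ≤ Real.exp (Real.exp (-(10 * d))) := by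
      have e1 : Real.exp (9 * d) * Real.exp (-(19 * d)) = Real.exp (-(10 * d)) := by
        rw [← Real.exp_add]; congr 1; ring
      have e2 := Real.add_one_le_exp (Real.exp (-(10 * d)))
      have e3 := (Real.exp_pos (-(19 * d))).le
      rw [sub_mul, e1]; linarith
    have h4 : 0 ≤ 1 + (Real.exp (9 * d) - 1) * Real.exp (-(19 * d)) := by
      have : 0 ≤ Real.exp (9 * d) - 1 := by
        have := Real.one_le_exp (show 0 ≤ 9 * d by positivity); linarith
      positivity
    calc _ ≤ Real.exp (Real.exp (-(10 * d))) ^ #Z := pow_le_pow_left₀ h4 h3 _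
      _ = Real.exp (#Z * Real.exp (-(10 * d))) := by rw [← Real.exp_nat_mul]
      _ ≤ _ := by gcongr
  have h5 : Real.exp (9 * d) ^ ((n : ℝ) / a) = Real.exp (9 * d * (n / a)) := (Real.exp_mul _ _).symm
  rw [h5, div_le_iff₀ (Real.exp_pos _)]
  refine h2.trans ?_
  have h6 : n * Real.exp (-(10 * d)) ≤ n / k := by
    rw [Real.exp_neg, ← div_eq_mul_inv]
    have hkd := H.k_le_avgDegree
    have := Real.add_one_le_exp (10 * d)
    gcongr
    linarith
  have h7 : 9 * (n / k : ℝ) ≤ 9 * d * (n / a) := by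
    have := H.le_avgDegree
    rw [mul_assoc]
    refine mul_le_mul_of_nonneg_left ?_ (by norm_num)
    rw [mul_div_assoc', le_div_iff₀ ha]
    calc (n / k : ℝ) * a = (a / k) * n := by ring
      _ ≤ d * n := by gcongr
  have h8 : (n / k : ℝ) ≤ Real.exp (n / k) := by
    have := Real.add_one_le_exp (n / k : ℝ); linarith
  have h9 : 1 ≤ k / n * Real.exp (n / k) := by
    calc (1 : ℝ) = k / n * (n / k) := by field_simp
      _ ≤ _ := by gcongr
  calc Real.exp (n * Real.exp (-(10 * d))) ≤ Real.exp (n / k) := Real.exp_le_exp.2 h6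
    _ ≤ Real.exp (n / k) * (k / n * Real.exp (n / k)) := le_mul_of_one_le_right (Real.exp_pos _).le h9
    _ = k / n * Real.exp (n / k + n / k) := by rw [Real.exp_add]; ring
    _ ≤ k / n * Real.exp (9 * d * (n / a)) := by
        gcongr
        have : (0 : ℝ) ≤ n / k := by positivity
        linarith

end Edges

section OperatorNorm

variable {R S : Type*} [Fintype R] [Fintype S] [DecidableEq R] [DecidableEq S]

theorem norm_toEuclideanLin_transpose_le (D : Matrix R S ℝ) {C : ℝ} (hC : 0 ≤ C)
    (h : ∀ (u : R → ℝ) (v : S → ℝ), |∑ x, ∑ y, D x y * (u x * v y)| ≤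
      C * √(∑ x, u x ^ 2) * √(∑ y, v y ^ 2)) (x : EuclideanSpace ℝ R) :
    ‖Matrix.toEuclideanLin Dᵀ x‖ ≤ C * ‖x‖ := by
  set v := Matrix.toEuclideanLin Dᵀ x with hv
  have h1 : ‖v‖ ^ 2 = ∑ z, ∑ y, D z y * (x z * v y) := by
    rw [EuclideanSpace.real_norm_sq_eq, Finset.sum_comm]
    refine Finset.sum_congr rfl fun y _ => ?_
    have : v y = ∑ z, D z y * x z := by
      simp [hv, Matrix.toLpLin_apply, Matrix.mulVec, dotProduct]
    rw [sq]
    nth_rw 1 [this]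
    rw [Finset.sum_mul]
    exact Finset.sum_congr rfl fun z _ => by ring
  have h2 := (le_abs_self _).trans (h (fun z => x z) (fun y => v y))
  rw [← h1, ← EuclideanSpace.real_norm_sq_eq, ← EuclideanSpace.real_norm_sq_eq,
    Real.sqrt_sq (norm_nonneg _), Real.sqrt_sq (norm_nonneg _), sq] at h2
  rcases (norm_nonneg v).eq_or_lt with h0 | h0
  · rw [← h0]; positivity
  · exact le_of_mul_le_mul_right h2 h0

theorem abs_sum_sum_mul_le (F : R → S → ℝ) (u : R → ℝ) (v : S → ℝ) :
    |∑ x, ∑ y, F x y * (u x * v y)| ≤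
      √(∑ x, ∑ y, F x y ^ 2) * √(∑ x, u x ^ 2) * √(∑ y, v y ^ 2) := by
  rw [← Real.sqrt_mul (Finset.sum_nonneg fun _ _ => Finset.sum_nonneg fun _ _ => sq_nonneg _),
    ← Real.sqrt_mul (mul_nonneg (Finset.sum_nonneg fun _ _ => Finset.sum_nonneg fun _ _ => sq_nonneg _)
      (Finset.sum_nonneg fun _ _ => sq_nonneg _))]
  refine Real.abs_le_sqrt ?_
  have := Finset.sum_mul_sq_le_sq_mul_sq Finset.univ (fun p : R × S => F p.1 p.2)
    (fun p => u p.1 * v p.2)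
  rw [Fintype.sum_prod_type, Fintype.sum_prod_type, Fintype.sum_prod_type] at this
  refine this.trans_eq ?_
  rw [mul_assoc]
  congr 1
  rw [Finset.sum_mul_sum]
  simp only [mul_pow]

end OperatorNorm

section Geometry

variable {n k : ℕ} {β : Fin n → Fin k} {a b : ℝ}

/-- The Red matrix with rows `Z` and columns `Y`. -/
noncomputable def redMat (η : Sym2 (Fin n) → Bool × Bool) (Z Y : Finset (Fin n)) : Matrix Z Y ℝ :=
  Matrix.of fun z y => redVal (η s((z : Fin n), (y : Fin n)))

/-- The mean of the Red matrix. -/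
noncomputable def meanMat (β : Fin n → Fin k) (a b : ℝ) (Z Y : Finset (Fin n)) : Matrix Z Y ℝ :=
  Matrix.of fun z y => edgeProb β a b s((z : Fin n), (y : Fin n)) / 2

theorem norm_trim_sub_le (H : Params n k a b) (hβ : EqualBlocks β) {Z Y : Finset (Fin n)}
    {η : Sym2 (Fin n) → Bool × Bool} (hη : NoiseBounded β a b Z Y η)
    (hr : (#{z ∈ Z | 20 * avgDegree k a b < ∑ y ∈ Y, redVal (η s(z, y))} : ℝ) ≤ n / a)
    (hc : (#{y ∈ Y | 20 * avgDegree k a b < ∑ z ∈ Z, redVal (η s(z, y))} : ℝ) ≤ n / a)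
    (x : EuclideanSpace ℝ Z) :
    ‖Matrix.toEuclideanLin (trim (20 * avgDegree k a b) (redMat η Z Y))ᵀ x -
      Matrix.toEuclideanLin (meanMat β a b Z Y)ᵀ x‖ ≤ 300001 * √(avgDegree k a b) * ‖x‖ := by
  classical
  have hn : (0 : ℝ) < n := by exact_mod_cast H.n_pos
  have ha := H.a_pos
  set d := avgDegree k a b with hd
  have hd0 : 0 < d := H.avgDegree_pos
  set M := meanMat β a b Z Y with hM
  set A := trim (20 * d) (redMat η Z Y) with hA
  have hp0 : ∀ z y, 0 ≤ edgeProb β a b s(z, y) := fun z y => edgeProb_nonneg H _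
  have hpa : ∀ z y, edgeProb β a b s(z, y) ≤ a / n := fun z y => edgeProb_le H _
  let R : Finset (Fin n) := {z ∈ Z | ∑ y ∈ Y, redVal (η s(z, y)) ≤ 20 * d}
  let S : Finset (Fin n) := {y ∈ Y | ∑ z ∈ Z, redVal (η s(z, y)) ≤ 20 * d}
  have hsub : Matrix.toEuclideanLin Aᵀ x - Matrix.toEuclideanLin Mᵀ x =
      Matrix.toEuclideanLin (A - M)ᵀ x := by
    rw [Matrix.transpose_sub, map_sub, LinearMap.sub_apply]
  rw [hsub]
  refine norm_toEuclideanLin_transpose_le _ (by positivity) (fun u v => ?_) x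
  let u' : Fin n → ℝ := fun z => if h : z ∈ Z then u ⟨z, h⟩ else 0
  let v' : Fin n → ℝ := fun z => if h : z ∈ Y then v ⟨z, h⟩ else 0
  have hu' : ∀ z : Z, u' z = u z := fun z => by simp [u']
  have hv' : ∀ z : Y, v' z = v z := fun z => by simp [v']
  let F : Z → Y → ℝ := fun z y => if (z : Fin n) ∈ R ∧ (y : Fin n) ∈ S then 0 else M z y
  have hAM : ∀ z y, (A - M) z y * (u z * v y) =
      (if (z : Fin n) ∈ R then if (y : Fin n) ∈ S then
        (redVal (η s((z : Fin n), (y : Fin n))) - edgeProb β a b s((z : Fin n), (y : Fin n)) / 2) *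
          (u' z * v' y) else 0 else 0) - F z y * (u z * v y) := by
    intro z y
    have e1 : (z : Fin n) ∈ R ↔ ¬ 20 * d < ∑ y' : Y, redMat η Z Y z y' := by
      simp only [R, Finset.mem_filter, z.2, true_and, not_lt, redMat, Matrix.of_apply]
      rw [Finset.sum_coe_sort Y fun y' => redVal (η s((z : Fin n), y'))]
    have e2 : (y : Fin n) ∈ S ↔ ¬ 20 * d < ∑ x' : Z, redMat η Z Y x' y := by
      simp only [S, Finset.mem_filter, y.2, true_and, not_lt, redMat, Matrix.of_apply]
      rw [Finset.sum_coe_sort Z fun x' => redVal (η s(x', (y : Fin n)))]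
    have e3 : A z y = if (z : Fin n) ∈ R ∧ (y : Fin n) ∈ S then redMat η Z Y z y else 0 := by
      simp only [hA, trim, Matrix.of_apply, e1, e2]
      split_ifs with h1 h2 h2 <;> tauto
    rw [Matrix.sub_apply, e3]
    simp only [F, hu', hv']
    by_cases h1 : (z : Fin n) ∈ R <;> by_cases h2 : (y : Fin n) ∈ S <;>
      simp [h1, h2, hM, meanMat, redMat]
  have hnoise : |∑ z : Z, ∑ y : Y, (if (z : Fin n) ∈ R then if (y : Fin n) ∈ S then
        (redVal (η s((z : Fin n), (y : Fin n))) - edgeProb β a b s((z : Fin n), (y : Fin n)) / 2) *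
          (u' z * v' y) else 0 else 0)| ≤ 300000 * √d * √(∑ x, u x ^ 2) * √(∑ y, v y ^ 2) := by
    have h := hη R (Finset.filter_subset _ _) S (Finset.filter_subset _ _)
      (fun z hz => (Finset.mem_filter.1 hz).2) (fun z hz => (Finset.mem_filter.1 hz).2) u' v'
    rw [← Finset.sum_coe_sort Z fun z => u' z ^ 2, ← Finset.sum_coe_sort Y fun z => v' z ^ 2] at h
    simp only [hu', hv'] at h
    refine le_trans (le_of_eq ?_) h
    congr 1
    rw [← sum_filter_coe_of_subset (Finset.filter_subset _ _), Finset.sum_filter]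
    refine Finset.sum_congr rfl fun z _ => ?_
    by_cases hz : (z : Fin n) ∈ R
    · have hz' : (z : Fin n) ∈ ({z ∈ Z | ∑ y ∈ Y, redVal (η s(z, y)) ≤ 20 * d} : Finset _) := hz
      simp only [hz, hz', if_true]
      rw [← sum_filter_coe_of_subset (Finset.filter_subset _ _), Finset.sum_filter]
    · have hz' : (z : Fin n) ∉ ({z ∈ Z | ∑ y ∈ Y, redVal (η s(z, y)) ≤ 20 * d} : Finset _) := hz
      simp [hz, hz']
  have hF : ∑ z, ∑ y, F z y ^ 2 ≤ d := by
    have hZrow : ∀ z : Fin n, ∀ T : Finset (Fin n), ∑ y ∈ T, (edgeProb β a b s(z, y) / 2) ^ 2 ≤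
        a / n / 4 * d := by
      intro z T
      have h1 : ∀ y ∈ T, (edgeProb β a b s(z, y) / 2) ^ 2 ≤ a / n / 4 * edgeProb β a b s(z, y) :=
        fun y _ => by nlinarith [hp0 z y, hpa z y]
      refine (Finset.sum_le_sum h1).trans ?_
      rw [← Finset.mul_sum, hd, ← sum_edgeProb H hβ z]
      refine mul_le_mul_of_nonneg_left ?_ (by positivity)
      exact Finset.sum_le_sum_of_subset_of_nonneg (Finset.subset_univ T) fun _ _ _ => hp0 _ _
    have h1 : ∀ (z : Z) (y : Y), F z y ^ 2 ≤
        (if (z : Fin n) ∈ Z \ R then (edgeProb β a b s((z : Fin n), (y : Fin n)) / 2) ^ 2 else 0) +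
        (if (y : Fin n) ∈ Y \ S then (edgeProb β a b s((z : Fin n), (y : Fin n)) / 2) ^ 2 else 0) := by
      intro z y
      have hsq := sq_nonneg (edgeProb β a b s((z : Fin n), (y : Fin n)) / 2)
      by_cases h1 : (z : Fin n) ∈ R <;> by_cases h2 : (y : Fin n) ∈ S <;>
        (simp [F, h1, h2, hM, meanMat, z.2, y.2]; try positivity)
    refine (Finset.sum_le_sum fun z _ => Finset.sum_le_sum fun y _ => h1 z y).trans ?_
    simp only [Finset.sum_add_distrib]
    have hcr : (#(Z \ R) : ℝ) ≤ n / a := by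
      refine le_trans (le_of_eq ?_) hr
      congr 2
      ext z; simp only [R, Finset.mem_sdiff, Finset.mem_filter, not_and, not_le]; tauto
    have hcs : (#(Y \ S) : ℝ) ≤ n / a := by
      refine le_trans (le_of_eq ?_) hc
      congr 2
      ext z; simp only [S, Finset.mem_sdiff, Finset.mem_filter, not_and, not_le]; tauto
    have h2 : ∑ z : Z, ∑ y : Y, (if (z : Fin n) ∈ Z \ R then
        (edgeProb β a b s((z : Fin n), (y : Fin n)) / 2) ^ 2 else 0) ≤ d / 4 := by
      have e1 : ∑ z : Z, ∑ y : Y, (if (z : Fin n) ∈ Z \ R then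
          (edgeProb β a b s((z : Fin n), (y : Fin n)) / 2) ^ 2 else 0) =
          ∑ z ∈ Z \ R, ∑ y ∈ Y, (edgeProb β a b s(z, y) / 2) ^ 2 := by
        rw [← sum_filter_coe_of_subset Finset.sdiff_subset, Finset.sum_filter]
        refine Finset.sum_congr rfl fun z _ => ?_
        rw [← Finset.sum_coe_sort Y]
        split_ifs
        · rfl
        · simp
      rw [e1]
      refine (Finset.sum_le_sum fun z _ => hZrow z Y).trans ?_
      rw [Finset.sum_const, nsmul_eq_mul]
      calc (#(Z \ R) : ℝ) * (a / n / 4 * d) ≤ n / a * (a / n / 4 * d) := by gcongr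
        _ = d / 4 := by field_simp
    have h3 : ∑ z : Z, ∑ y : Y, (if (y : Fin n) ∈ Y \ S then
        (edgeProb β a b s((z : Fin n), (y : Fin n)) / 2) ^ 2 else 0) ≤ d / 4 := by
      rw [Finset.sum_comm]
      have e1 : ∑ y : Y, ∑ z : Z, (if (y : Fin n) ∈ Y \ S then
          (edgeProb β a b s((z : Fin n), (y : Fin n)) / 2) ^ 2 else 0) =
          ∑ y ∈ Y \ S, ∑ z ∈ Z, (edgeProb β a b s(y, z) / 2) ^ 2 := by
        rw [← sum_filter_coe_of_subset Finset.sdiff_subset, Finset.sum_filter]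
        refine Finset.sum_congr rfl fun y _ => ?_
        rw [← Finset.sum_coe_sort Z]
        split_ifs
        · exact Finset.sum_congr rfl fun z _ => by rw [Sym2.eq_swap]
        · simp
      rw [e1]
      refine (Finset.sum_le_sum fun z _ => hZrow z Z).trans ?_
      rw [Finset.sum_const, nsmul_eq_mul]
      calc (#(Y \ S) : ℝ) * (a / n / 4 * d) ≤ n / a * (a / n / 4 * d) := by gcongr
        _ = d / 4 := by field_simp
    linarith
  simp only [hAM, Finset.sum_sub_distrib]
  refine (abs_sub _ _).trans ?_
  have h4 : |∑ z, ∑ y, F z y * (u z * v y)| ≤ √d * √(∑ x, u x ^ 2) * √(∑ y, v y ^ 2) := by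
    refine (abs_sum_sum_mul_le F u v).trans ?_
    gcongr
  linarith

end Geometry

section BlockGeometry

variable {n k : ℕ} {β : Fin n → Fin k} {a b : ℝ}

/-- The vector that is constant on blocks. -/
noncomputable def blockVec (β : Fin n → Fin k) (Z : Finset (Fin n)) :
    (Fin k → ℝ) →ₗ[ℝ] EuclideanSpace ℝ Z where
  toFun c := WithLp.toLp 2 fun z => c (β z)
  map_add' c c' := by ext z; simp
  map_smul' t c := by ext z; simp

@[simp] theorem blockVec_apply (Z : Finset (Fin n)) (c : Fin k → ℝ) (z : Z) :
    blockVec β Z c z = c (β z) := rfl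

theorem finrank_range_blockVec {Z : Finset (Fin n)} (hZ : ∀ i, 0 < #(blockIn β Z i)) :
    Module.finrank ℝ (LinearMap.range (blockVec β Z)) = k := by
  rw [LinearMap.finrank_range_of_inj, Module.finrank_fin_fun]
  intro c c' h
  ext i
  obtain ⟨z, hz⟩ := Finset.card_pos.1 (hZ i)
  obtain ⟨hz', rfl⟩ := mem_blockIn.1 hz
  exact congr_arg (fun v : EuclideanSpace ℝ Z => v ⟨z, hz'⟩) h

theorem sum_block_eq (Z : Finset (Fin n)) (f : Fin n → ℝ) (c : Fin k → ℝ) (hf : ∀ z, f z = c (β z)) :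
    ∑ z : Z, f z = ∑ i, (#(blockIn β Z i) : ℝ) * c i := by
  rw [Finset.sum_coe_sort Z f, ← Finset.sum_fiberwise Z β]
  refine Finset.sum_congr rfl fun i _ => ?_
  rw [Finset.sum_congr rfl (g := fun _ => c i) fun z hz => by rw [hf, (Finset.mem_filter.1 hz).2],
    Finset.sum_const, nsmul_eq_mul, blockIn]

theorem norm_sq_blockVec (Z : Finset (Fin n)) (c : Fin k → ℝ) :
    ‖blockVec β Z c‖ ^ 2 = ∑ i, (#(blockIn β Z i) : ℝ) * c i ^ 2 := by
  rw [EuclideanSpace.real_norm_sq_eq]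
  exact sum_block_eq Z (fun z => c (β z) ^ 2) (fun i => c i ^ 2) fun _ => rfl

theorem meanMat_apply (Z Y : Finset (Fin n)) (z : Z) (y : Y) :
    meanMat β a b Z Y z y = b / (2 * n) + if β z = β y then (a - b) / (2 * n) else 0 := by
  rw [meanMat, Matrix.of_apply, edgeProb_mk]
  split_ifs <;> ring

theorem toEuclideanLin_meanMat_transpose (Z Y : Finset (Fin n)) (c : Fin k → ℝ) :
    Matrix.toEuclideanLin (meanMat β a b Z Y)ᵀ (blockVec β Z c) =
      blockVec β Y fun j => b / (2 * n) * (∑ i, #(blockIn β Z i) * c i) +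
        (a - b) / (2 * n) * (#(blockIn β Z j) * c j) := by
  ext y
  rw [blockVec_apply]
  simp only [Matrix.toLpLin_apply, Matrix.mulVec, dotProduct, Matrix.transpose_apply,
    meanMat_apply]
  change ∑ z : Z, (b / (2 * n) + if β z = β y then (a - b) / (2 * n) else 0) * c (β z) = _
  rw [sum_block_eq Z (fun z => (b / (2 * n) + if β z = β y then (a - b) / (2 * n) else 0) * c (β z))
    (fun i => (b / (2 * n) + if i = β y then (a - b) / (2 * n) else 0) * c i) fun _ => rfl]
  simp only [add_mul, mul_add, Finset.sum_add_distrib, ite_mul, zero_mul, mul_ite, mul_zero,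
    Finset.sum_ite_eq', Finset.mem_univ, if_true]
  rw [Finset.mul_sum]
  congr 1
  · exact Finset.sum_congr rfl fun i _ => by ring
  · ring

theorem toEuclideanLin_meanMat (Z Y : Finset (Fin n)) (c : Fin k → ℝ) :
    Matrix.toEuclideanLin (meanMat β a b Z Y) (blockVec β Y c) =
      blockVec β Z fun j => b / (2 * n) * (∑ i, #(blockIn β Y i) * c i) +
        (a - b) / (2 * n) * (#(blockIn β Y j) * c j) := by
  have h := toEuclideanLin_meanMat_transpose (β := β) (a := a) (b := b) Y Z c
  rwa [show (meanMat β a b Y Z)ᵀ = meanMat β a b Z Y from ?_] at h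
  ext z y
  simp [meanMat, Sym2.eq_swap]

theorem toEuclideanLin_meanMat_transpose_eq_zero {Z Y : Finset (Fin n)} {x : EuclideanSpace ℝ Z}
    (hx : x ∈ (LinearMap.range (blockVec β Z))ᗮ) :
    Matrix.toEuclideanLin (meanMat β a b Z Y)ᵀ x = 0 := by
  ext y
  have h := (Submodule.mem_orthogonal _ _).1 hx
    (blockVec β Z fun i => b / (2 * n) + if i = β y then (a - b) / (2 * n) else 0) ⟨_, rfl⟩
  rw [EuclideanSpace.inner_eq_star_dotProduct] at h
  simp only [Matrix.toLpLin_apply, Matrix.mulVec, dotProduct, Matrix.transpose_apply, meanMat_apply]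
  simp only [dotProduct, star_trivial] at h
  refine Eq.trans (Finset.sum_congr rfl fun z _ => ?_) h
  rw [mul_comm]
  rfl

theorem sq_mul_sum_sq_le {q h : ℝ} (hq : 0 ≤ q) (hh : 0 ≤ h) (s : Fin k → ℝ) :
    h ^ 2 * ∑ j, s j ^ 2 ≤ ∑ j, (q * (∑ i, s i) + h * s j) ^ 2 := by
  have e : ∀ j, (q * (∑ i, s i) + h * s j) ^ 2 =
      (q * ∑ i, s i) ^ 2 + (2 * q * h * ∑ i, s i) * s j + h ^ 2 * s j ^ 2 := fun j => by ring
  rw [Finset.sum_congr rfl fun j _ => e j, Finset.sum_add_distrib, Finset.sum_add_distrib,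
    ← Finset.mul_sum, ← Finset.mul_sum]
  have e3 : 0 ≤ ∑ j : Fin k, (q * ∑ i, s i) ^ 2 := Finset.sum_nonneg fun _ _ => sq_nonneg _
  have e4 : 0 ≤ 2 * q * h * (∑ i, s i) * ∑ i, s i := by
    rw [mul_assoc _ (∑ i, s i)]
    exact mul_nonneg (by positivity) (mul_self_nonneg _)
  linarith

theorem weighted_sum_sq_ge {q h l m : ℝ} (hq : 0 ≤ q) (hh : 0 ≤ h) (hl : 0 ≤ l) (hm : 0 ≤ m)
    {z w : Fin k → ℝ} (hz : ∀ i, l ≤ z i) (hw : ∀ i, m ≤ w i) (c : Fin k → ℝ) :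
    m * h ^ 2 * l * ∑ i, z i * c i ^ 2 ≤ ∑ j, w j * (q * (∑ i, z i * c i) + h * (z j * c j)) ^ 2 := by
  have h1 : l * ∑ i, z i * c i ^ 2 ≤ ∑ i, (z i * c i) ^ 2 := by
    rw [Finset.mul_sum]
    refine Finset.sum_le_sum fun i _ => ?_
    rw [show (z i * c i) ^ 2 = z i * (z i * c i ^ 2) by ring]
    exact mul_le_mul_of_nonneg_right (hz i) (mul_nonneg (hl.trans (hz i)) (sq_nonneg _))
  have h2 := sq_mul_sum_sq_le hq hh fun i => z i * c i
  have h3 : m * ∑ j, (q * (∑ i, z i * c i) + h * (z j * c j)) ^ 2 ≤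
      ∑ j, w j * (q * (∑ i, z i * c i) + h * (z j * c j)) ^ 2 := by
    rw [Finset.mul_sum]
    exact Finset.sum_le_sum fun j _ => mul_le_mul_of_nonneg_right (hw j) (sq_nonneg _)
  refine le_trans ?_ h3
  rw [mul_assoc, mul_assoc]
  exact mul_le_mul_of_nonneg_left (le_trans (mul_le_mul_of_nonneg_left h1 (sq_nonneg h)) h2) hm

theorem sigma_mul_norm_le (H : Params n k a b) {Z Y : Finset (Fin n)}
    (hZ : ∀ i, (n / (4 * k) : ℝ) ≤ #(blockIn β Z i)) (hY : ∀ i, (n / (8 * k) : ℝ) ≤ #(blockIn β Y i))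
    {x : EuclideanSpace ℝ Z} (hx : x ∈ LinearMap.range (blockVec β Z)) :
    (a - b) / (12 * k) * ‖x‖ ≤ ‖Matrix.toEuclideanLin (meanMat β a b Z Y)ᵀ x‖ := by
  obtain ⟨c, rfl⟩ := hx
  have hn : (0 : ℝ) < n := by exact_mod_cast H.n_pos
  have hk : (0 : ℝ) < k := by exact_mod_cast H.k_pos
  have hab : 0 < a - b := sub_pos.2 H.b_lt
  have hb := H.b_pos
  have h1 := weighted_sum_sq_ge (q := b / (2 * n)) (h := (a - b) / (2 * n)) (by positivity)
    (by positivity) (by positivity) (by positivity) hZ hY c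
  refine le_of_sq_le_sq ?_ (norm_nonneg _)
  rw [toEuclideanLin_meanMat_transpose, norm_sq_blockVec, mul_pow, norm_sq_blockVec]
  refine le_trans (mul_le_mul_of_nonneg_right ?_ ?_) h1
  · have e1 : (n / (8 * k) * ((a - b) / (2 * n)) ^ 2 * (n / (4 * k)) : ℝ) =
      (a - b) ^ 2 / k ^ 2 / 128 := by field_simp; norm_num
    have e2 : ((a - b) / (12 * k)) ^ 2 = (a - b) ^ 2 / k ^ 2 / 144 := by field_simp; norm_num
    have e3 : 0 ≤ (a - b) ^ 2 / k ^ 2 := by positivity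
    rw [e1, e2]
    linarith
  · exact Finset.sum_nonneg fun _ _ => by positivity

/-- The expectation of a centred column. -/
noncomputable def signal (β : Fin n → Fin k) (a b : ℝ) (Z : Finset (Fin n)) (y : Fin n) :
    EuclideanSpace ℝ Z :=
  WithLp.toLp 2 fun z => edgeProb β a b s((z : Fin n), y) / 2 - (a + b) / (2 * n)

theorem exists_preimage_signal (H : Params n k a b) (Z : Finset (Fin n)) {Y : Finset (Fin n)}
    (hY : ∀ i, (n / (8 * k) : ℝ) ≤ #(blockIn β Y i)) (y : Fin n) :
    ∃ v, Matrix.toEuclideanLin (meanMat β a b Z Y) v = signal β a b Z y ∧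
      avgDegree k a b * ‖v‖ ^ 2 ≤ 80 * k * a / n := by
  have hn : (0 : ℝ) < n := by exact_mod_cast H.n_pos
  have hk : (0 : ℝ) < k := by exact_mod_cast H.k_pos
  have hk1 : (1 : ℝ) ≤ k := by exact_mod_cast H.k_pos
  have hb := H.b_pos
  have hba := H.b_lt
  have ha := H.a_pos
  have hpos : ∀ i, (0 : ℝ) < #(blockIn β Y i) := fun i => lt_of_lt_of_le (by positivity) (hY i)
  set d := avgDegree k a b with hd
  have hd0 : 0 < d := H.avgDegree_pos
  have hkd : k * d = a + (k - 1) * b := by rw [hd, avgDegree]; field_simp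
  have hkda : a ≤ k * d := by rw [hkd]; nlinarith
  have hda : d ≤ a := H.avgDegree_le
  set t := (a + b) / (k * d) with ht
  have ht0 : 0 ≤ t := by positivity
  have htd : t ^ 2 * (k * d) ≤ 4 * a := by
    have : t ^ 2 * (k * d) = (a + b) ^ 2 / (k * d) := by rw [ht]; field_simp
    rw [this, div_le_iff₀ (by positivity)]
    nlinarith
  refine ⟨blockVec β Y fun i => ((if i = β y then 1 else 0) - t) / #(blockIn β Y i), ?_, ?_⟩
  · rw [toEuclideanLin_meanMat]
    ext z
    rw [blockVec_apply]
    have h1 : ∀ i, (#(blockIn β Y i) : ℝ) * (((if i = β y then 1 else 0) - t) / #(blockIn β Y i)) =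
        (if i = β y then 1 else 0) - t := fun i => mul_div_cancel₀ _ (hpos i).ne'
    simp only [h1, Finset.sum_sub_distrib, Finset.sum_ite_eq', Finset.mem_univ, if_true,
      Finset.sum_const, Finset.card_univ, Fintype.card_fin, nsmul_eq_mul]
    change _ = edgeProb β a b s((z : Fin n), y) / 2 - (a + b) / (2 * n)
    rw [edgeProb_mk]
    have h2 : t * (a + (k - 1) * b) = a + b := by
      rw [← hkd, ht]; field_simp
    have h3 : b / (2 * n) * (1 - k * t) + (a - b) / (2 * n) * (0 - t) =
        b / (2 * n) - t * (a + (k - 1) * b) / (2 * n) := by ring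
    rw [h2] at h3
    split_ifs
    · rw [show b / (2 * n) * (1 - k * t) + (a - b) / (2 * n) * (1 - t) =
        b / (2 * n) * (1 - k * t) + (a - b) / (2 * n) * (0 - t) + (a - b) / (2 * n) by ring, h3]
      ring
    · rw [h3]; ring
  · rw [norm_sq_blockVec]
    have h1 : ∀ i, (#(blockIn β Y i) : ℝ) *
        (((if i = β y then 1 else 0) - t) / #(blockIn β Y i)) ^ 2 ≤
        8 * k / n * (2 * (if i = β y then 1 else 0) + 2 * t ^ 2) := by
      intro i
      have e : (#(blockIn β Y i) : ℝ) * (((if i = β y then 1 else 0) - t) / #(blockIn β Y i)) ^ 2 =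
          1 / #(blockIn β Y i) * ((if i = β y then 1 else 0) - t) ^ 2 := by
        have := (hpos i).ne'
        field_simp
      rw [e]
      have e1 : 1 / (#(blockIn β Y i) : ℝ) ≤ 8 * k / n := by
        rw [div_le_div_iff₀ (hpos i) hn]
        have := hY i
        rw [div_le_iff₀ (by positivity)] at this
        linarith
      refine mul_le_mul e1 ?_ (sq_nonneg _) (by positivity)
      split_ifs <;> nlinarith [sq_nonneg (1 + t)]
    have h2 := Finset.sum_le_sum fun i (_ : i ∈ Finset.univ) => h1 i
    rw [← Finset.mul_sum, Finset.sum_add_distrib, ← Finset.mul_sum, Finset.sum_ite_eq',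
      if_pos (Finset.mem_univ _), Finset.sum_const, Finset.card_univ, Fintype.card_fin,
      nsmul_eq_mul] at h2
    calc d * _ ≤ d * (8 * k / n * (2 * 1 + k * (2 * t ^ 2))) := by gcongr
      _ = (16 * k * d + 16 * k * (t ^ 2 * (k * d))) / n := by ring
      _ ≤ (16 * k * a + 16 * k * (4 * a)) / n := by gcongr
      _ = _ := by ring

end BlockGeometry

section TopSpace

variable {R S : Type*} [Fintype R] [Fintype S] [DecidableEq R] [DecidableEq S]

open Classical in
/-- Some top left singular space, chosen as a function of the matrix. -/
noncomputable def topSpace (k : ℕ) (A : Matrix R S ℝ) : Submodule ℝ (EuclideanSpace ℝ R) :=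
  if h : ∃ W, IsTopLeftSingularSpace k A W then h.choose else ⊥

theorem isTopLeftSingularSpace_topSpace {k : ℕ} {A : Matrix R S ℝ} (hk : k ≤ Fintype.card R) :
    IsTopLeftSingularSpace k A (topSpace k A) := by
  have h := exists_isTopLeftSingularSpace A hk
  rw [topSpace, dif_pos h]
  exact h.choose_spec

theorem finrank_topSpace_le (k : ℕ) (A : Matrix R S ℝ) : Module.finrank ℝ (topSpace k A) ≤ k := by
  by_cases h : ∃ W, IsTopLeftSingularSpace k A W
  · rw [topSpace, dif_pos h]
    exact (isTopLeftSingularSpace_iff.1 h.choose_spec).finrank_eq.le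
  · rw [topSpace, dif_neg h, finrank_bot]
    exact Nat.zero_le k

theorem norm_sq_starProjection_eq {E : Type*} [NormedAddCommGroup E] [InnerProductSpace ℝ E]
    [FiniteDimensional ℝ E] (W : Submodule ℝ E) (x : E) :
    ‖W.starProjection x‖ ^ 2 =
      ∑ i, inner ℝ ((stdOrthonormalBasis ℝ W i : W) : E) x ^ 2 := by
  have h := (stdOrthonormalBasis ℝ W).sum_sq_norm_inner_right (W.orthogonalProjectionOnto x)
  have h2 : ‖W.starProjection x‖ = ‖W.orthogonalProjectionOnto x‖ := rfl
  rw [h2, ← h]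
  refine Finset.sum_congr rfl fun i _ => ?_
  rw [Real.norm_eq_abs, sq_abs, Submodule.coe_inner]
  congr 1
  change inner ℝ _ (W.starProjection x) = _
  rw [← Submodule.inner_starProjection_left_eq_right, Submodule.starProjection_eq_self_iff.2]
  exact Subtype.coe_prop _

end TopSpace

section Noise

variable {n k : ℕ} {β : Fin n → Fin k} {a b : ℝ}

/-- The top left singular space of the trimmed Red matrix. -/
noncomputable def redSpace (k : ℕ) (a b : ℝ) (Z Y : Finset (Fin n))
    (η : Sym2 (Fin n) → Bool × Bool) : Submodule ℝ (EuclideanSpace ℝ Z) :=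
  topSpace k (trim (20 * avgDegree k a b) (redMat η Z Y))

theorem redSpace_congr {Z Y : Finset (Fin n)} {η η' : Sym2 (Fin n) → Bool × Bool}
    (h : ∀ z ∈ Z, ∀ y ∈ Y, η s(z, y) = η' s(z, y)) : redSpace k a b Z Y η = redSpace k a b Z Y η' := by
  have : redMat η Z Y = redMat η' Z Y := by
    ext z y
    simp only [redMat, Matrix.of_apply]
    rw [h z z.2 y y.2]
  rw [redSpace, redSpace, this]

/-- If the noise is bounded and few degrees are large, then the top singular space is unique and
almost contains the signals. -/
theorem redSpace_spec (H : Params n k a b) (hβ : EqualBlocks β)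
    (hC : 10 ^ 14 * (k : ℝ) ^ 2 * a ≤ (a - b) ^ 2) {Z Y : Finset (Fin n)}
    {η : Sym2 (Fin n) → Bool × Bool} (hη : NoiseBounded β a b Z Y η)
    (hr : (#{z ∈ Z | 20 * avgDegree k a b < ∑ y ∈ Y, redVal (η s(z, y))} : ℝ) ≤ n / a)
    (hc : (#{y ∈ Y | 20 * avgDegree k a b < ∑ z ∈ Z, redVal (η s(z, y))} : ℝ) ≤ n / a)
    (hZ : ∀ i, (n / (4 * k) : ℝ) ≤ #(blockIn β Z i)) (hY : ∀ i, (n / (8 * k) : ℝ) ≤ #(blockIn β Y i)) :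
    (∀ W, IsTopLeftSingularSpace k (trim (20 * avgDegree k a b) (redMat η Z Y)) W ↔
      W = redSpace k a b Z Y η) ∧
    ∀ y, ‖signal β a b Z y - (redSpace k a b Z Y η).starProjection (signal β a b Z y)‖ ^ 2 ≤
      3 * 10 ^ 13 * (k * a / n) := by
  have hn : (0 : ℝ) < n := by exact_mod_cast H.n_pos
  have hk : (0 : ℝ) < k := by exact_mod_cast H.k_pos
  have ha := H.a_pos
  have hab : 0 < a - b := sub_pos.2 H.b_lt
  have hd := H.avgDegree_pos
  have hnorm := norm_trim_sub_le H hβ hη hr hc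
  have hpos : ∀ i, 0 < #(blockIn β Z i) := fun i => by
    have : (0 : ℝ) < #(blockIn β Z i) := lt_of_lt_of_le (by positivity) (hZ i)
    exact_mod_cast this
  have hU := finrank_range_blockVec hpos
  have hU0 : ∀ x ∈ (LinearMap.range (blockVec β Z))ᗮ,
      Matrix.toEuclideanLin (meanMat β a b Z Y)ᵀ x = 0 :=
    fun x hx => toEuclideanLin_meanMat_transpose_eq_zero hx
  have hkZ : k ≤ Fintype.card Z := by
    have h := Submodule.finrank_le (LinearMap.range (blockVec β Z))
    rwa [hU, finrank_euclideanSpace] at h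
  have htop := isTopLeftSingularSpace_topSpace
    (A := trim (20 * avgDegree k a b) (redMat η Z Y)) hkZ
  have hε : 0 ≤ 300001 * √(avgDegree k a b) := by positivity
  have hgap : 2 * (300001 * √(avgDegree k a b)) < (a - b) / (12 * k) := by
    rw [lt_div_iff₀ (by positivity)]
    refine lt_of_pow_lt_pow_left₀ 2 hab.le ?_
    have e : (2 * (300001 * √(avgDegree k a b)) * (12 * k)) ^ 2 =
        (24 * 300001) ^ 2 * k ^ 2 * avgDegree k a b := by
      rw [show (2 * (300001 * √(avgDegree k a b)) * (12 * k)) ^ 2 =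
        (24 * 300001) ^ 2 * k ^ 2 * (√(avgDegree k a b)) ^ 2 by ring, Real.sq_sqrt hd.le]
    rw [e]
    refine lt_of_lt_of_le ?_ hC
    have h2 := H.avgDegree_le
    calc (24 * 300001) ^ 2 * (k : ℝ) ^ 2 * avgDegree k a b
        ≤ (24 * 300001) ^ 2 * (k : ℝ) ^ 2 * a := by gcongr
      _ < 10 ^ 14 * (k : ℝ) ^ 2 * a := by gcongr; norm_num
  refine ⟨fun W => ⟨fun hW => ?_, ?_⟩, fun y => ?_⟩
  · exact htop.unique hW hε hnorm hU hU0 (fun x hx => sigma_mul_norm_le H hZ hY hx) hgap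
  · rintro rfl; exact htop
  · obtain ⟨v, hv, hvn⟩ := exists_preimage_signal H Z hY y
    rw [← hv]
    have h := htop.norm_sub_proj_le hε hnorm hU hU0 v
    refine (pow_le_pow_left₀ (norm_nonneg _) h 2).trans ?_
    have e : (2 * (300001 * √(avgDegree k a b)) * ‖v‖) ^ 2 =
        (2 * 300001) ^ 2 * (avgDegree k a b * ‖v‖ ^ 2) := by
      rw [show (2 * (300001 * √(avgDegree k a b)) * ‖v‖) ^ 2 =
        (2 * 300001) ^ 2 * ((√(avgDegree k a b)) ^ 2 * ‖v‖ ^ 2) by ring, Real.sq_sqrt hd.le]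
    rw [e]
    have h3 : 0 < k * a / n := by positivity
    have h4 : 80 * k * a / n = 80 * (k * a / n) := by ring
    rw [h4] at hvn
    nlinarith

/-- The centred Red column of `y`. -/
noncomputable def noiseCol (β : Fin n → Fin k) (a b : ℝ) (Z : Finset (Fin n)) (y : Fin n)
    (η : Sym2 (Fin n) → Bool × Bool) : EuclideanSpace ℝ Z :=
  WithLp.toLp 2 fun z => redVal (η s((z : Fin n), y)) - edgeProb β a b s((z : Fin n), y) / 2

theorem noiseCol_congr {Z : Finset (Fin n)} {y : Fin n} {η η' : Sym2 (Fin n) → Bool × Bool}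
    (h : ∀ z ∈ Z, η s(z, y) = η' s(z, y)) : noiseCol β a b Z y η = noiseCol β a b Z y η' := by
  unfold noiseCol
  congr 1
  ext z
  rw [h z z.2]

theorem ex_norm_proj_noiseCol_le (H : Params n k a b) (Z : Finset (Fin n)) {y : Fin n} (hy : y ∉ Z)
    (W : Submodule ℝ (EuclideanSpace ℝ Z)) (hW : Module.finrank ℝ W ≤ k) :
    ex (edgeWeight β a b) (fun η => ‖W.starProjection (noiseCol β a b Z y η)‖ ^ 2) ≤
      k * (a / (2 * n)) := by
  have hw := isWeight_edgeWeight (β := β) H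
  have ha := H.a_pos
  have hn : (0 : ℝ) < n := by exact_mod_cast H.n_pos
  simp_rw [norm_sq_starProjection_eq]
  rw [ex_sum]
  have h1 : ∀ i, ex (edgeWeight β a b) (fun η =>
      inner ℝ ((stdOrthonormalBasis ℝ W i : W) : EuclideanSpace ℝ Z) (noiseCol β a b Z y η) ^ 2) ≤
      a / (2 * n) := by
    intro i
    set e : EuclideanSpace ℝ Z := ((stdOrthonormalBasis ℝ W i : W) : EuclideanSpace ℝ Z) with he
    have hnorm : ∑ z, e z ^ 2 = 1 := by
      have h1 : ‖e‖ = 1 := (stdOrthonormalBasis ℝ W).orthonormal.1 i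
      rw [← EuclideanSpace.real_norm_sq_eq, h1, one_pow]
    let g : Z → Bool × Bool → ℝ := fun z x =>
      e z * (redVal x - edgeProb β a b s((z : Fin n), y) / 2)
    have hinner : ∀ η, inner ℝ e (noiseCol β a b Z y η) = ∑ z : Z, g z (η s((z : Fin n), y)) := by
      intro η
      rw [EuclideanSpace.inner_eq_star_dotProduct]
      simp only [dotProduct, star_trivial, noiseCol, g]
      exact Finset.sum_congr rfl fun z _ => by ring
    simp_rw [hinner]
    rw [ex_sq_sum hw Finset.univ (fun z : Z => s((z : Fin n), y)) _ g]
    · rw [← one_mul (a / (2 * n)), ← hnorm, Finset.sum_mul]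
      refine Finset.sum_le_sum fun z _ => ?_
      refine le_trans (le_of_eq ?_) (mul_le_mul_of_nonneg_left
        (sum_edgeWeight_centred_sq_le (β := β) H s((z : Fin n), y) redVal_zero_one
          (sum_edgeWeight_redVal _)) (sq_nonneg (e z)))
      rw [Finset.mul_sum]
      exact Finset.sum_congr rfl fun x _ => by ring
    · intro z _
      rw [← mul_zero (e z), ← sum_edgeWeight_centred (β := β) H s((z : Fin n), y)
        (sum_edgeWeight_redVal _), Finset.mul_sum]
      exact Finset.sum_congr rfl fun x _ => by ring
    · intro z _ z' _ h
      rcases Sym2.eq_iff.1 h with h | ⟨h, -⟩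
      · exact Subtype.ext h.1
      · exact absurd (h ▸ z.2) hy
  refine (Finset.sum_le_sum fun i _ => h1 i).trans ?_
  rw [Finset.sum_const, Finset.card_univ, Fintype.card_fin, nsmul_eq_mul]
  gcongr

/-- The projected noise of the column of `y` is large. -/
def NoisyColumn (β : Fin n → Fin k) (a b : ℝ) (Z Y : Finset (Fin n)) (y : Fin n)
    (η : Sym2 (Fin n) → Bool × Bool) : Prop :=
  2 ^ 15 * (k * a / n) ≤ ‖(redSpace k a b Z Y η).starProjection (noiseCol β a b Z y η)‖ ^ 2

open Classical in
theorem pr_many_noisyColumns_le (H : Params n k a b) {Z Y S : Finset (Fin n)}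
    (hZY : Disjoint Z Y) (hZS : Disjoint Z S) (hYS : Disjoint Y S) :
    pr (edgeWeight β a b) (fun η => (#S / 8 : ℝ) ≤ #{y ∈ S | NoisyColumn β a b Z Y y η}) ≤ (1 / 2) ^ #S := by
  have hw := isWeight_edgeWeight (β := β) H
  have hn : (0 : ℝ) < n := by exact_mod_cast H.n_pos
  have hk : (0 : ℝ) < k := by exact_mod_cast H.k_pos
  have ha := H.a_pos
  let J : Fin n → Finset (Sym2 (Fin n)) := fun y => Z.image fun z => s(z, y)
  have hJ : ∀ y ∈ S, ∀ z ∈ Z, ∀ y', y' ∉ Z → y' ≠ y → s(z, y') ∉ J y := by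
    intro y hy z hz y' hy' hne hmem
    obtain ⟨z', hz', h⟩ := Finset.mem_image.1 hmem
    rcases Sym2.eq_iff.1 h with h | ⟨h, -⟩
    · exact hne h.2.symm
    · exact hy' (h ▸ hz')
  have hspace : ∀ y ∈ S, ∀ η ω, redSpace k a b Z Y ((J y).piecewise η ω) = redSpace k a b Z Y ω := by
    intro y hy η ω
    refine redSpace_congr fun z hz y' hy' => resample_eq_of_notMem (hJ y hy z hz y' ?_ ?_)
    · exact Finset.disjoint_right.1 hZY hy'
    · rintro rfl; exact Finset.disjoint_left.1 hYS hy' hy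
  have h1 := pr_card_le hw S J (NoisyColumn β a b Z Y) (q := 1 / 2 ^ 16) (Λ := 2 ^ 16) (by norm_num)
    (by
      intro y hy y' hy' hne ω η
      unfold NoisyColumn
      simp only [hspace y hy]
      rw [noiseCol_congr (η := (J y).piecewise η ω) (η' := ω) fun z hz =>
        resample_eq_of_notMem (hJ y hy z hz y' (Finset.disjoint_right.1 hZS hy') hne.symm)])
    (by
      intro y hy ω
      have e1 : ∀ η, NoisyColumn β a b Z Y y ((J y).piecewise η ω) ↔ 2 ^ 15 * (k * a / n) ≤
          ‖(redSpace k a b Z Y ω).starProjection (noiseCol β a b Z y η)‖ ^ 2 := by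
        intro η
        unfold NoisyColumn
        simp only [hspace y hy]
        rw [noiseCol_congr (η := (J y).piecewise η ω) (η' := η) fun z hz =>
          Finset.piecewise_eq_of_mem _ _ _ (Finset.mem_image_of_mem _ hz)]
      simp only [e1]
      refine (pr_le_of_ex_le hw (fun _ => sq_nonneg _) (by positivity)
        (ex_norm_proj_noiseCol_le H Z (Finset.disjoint_right.1 hZS hy) (redSpace k a b Z Y ω)
          (finrank_topSpace_le _ _)) fun η h => h).trans (le_of_eq ?_)
      field_simp)
    (#S / 8)
  refine le_trans (le_of_eq ?_) (h1.trans ?_)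
  · congr!
  · have e1 : (2 ^ 16 : ℝ) ^ (#S / 8 : ℝ) = 4 ^ #S := by
      rw [show (2 ^ 16 : ℝ) = 4 ^ (8 : ℝ) by norm_num, ← Real.rpow_mul (by norm_num),
        mul_div_cancel₀ _ (by norm_num : (8 : ℝ) ≠ 0), Real.rpow_natCast]
    rw [e1, ← div_pow]
    refine pow_le_pow_left₀ (by norm_num) (by norm_num) _

end Noise

section Blue

variable {n k : ℕ} {β : Fin n → Fin k} {a b : ℝ}

/-- The set of vertices that the column of `y` suggests. -/
noncomputable def redSet (β : Fin n → Fin k) (a b : ℝ) (Z Y : Finset (Fin n)) (y : Fin n)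
    (η : Sym2 (Fin n) → Bool × Bool) : Finset (Fin n) :=
  topCoords (n / (2 * k))
    ((redSpace k a b Z Y η).starProjection (signal β a b Z y + noiseCol β a b Z y η))

theorem redSet_congr {Z Y : Finset (Fin n)} {y : Fin n} {η η' : Sym2 (Fin n) → Bool × Bool}
    (h : ∀ z ∈ Z, ∀ y' ∈ Y, η s(z, y') = η' s(z, y')) (hy : ∀ z ∈ Z, η s(z, y) = η' s(z, y)) :
    redSet β a b Z Y y η = redSet β a b Z Y y η' := by
  unfold redSet
  simp only [redSpace_congr h]
  rw [noiseCol_congr hy]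

theorem redSet_subset (Z Y : Finset (Fin n)) (y : Fin n) (η : Sym2 (Fin n) → Bool × Bool) :
    redSet β a b Z Y y η ⊆ Z := topCoords_subset _ _

theorem card_redSet_le (Z Y : Finset (Fin n)) (y : Fin n)
    (η : Sym2 (Fin n) → Bool × Bool) : (#(redSet β a b Z Y y η) : ℝ) ≤ n / (2 * k) := by
  rw [redSet, card_topCoords]
  refine le_trans (Nat.cast_le.2 (min_le_left _ _)) (Nat.cast_div_le.trans_eq ?_)
  push_cast
  rfl

/-- The number of ordered pairs in `X` joined by a Blue edge. -/
noncomputable def blueCount (X : Finset (Fin n)) (η : Sym2 (Fin n) → Bool × Bool) : ℝ :=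
  ∑ x ∈ X, ∑ y ∈ X, if x = y then 0 else blueVal (η s(x, y))

theorem blueVal_zero_one (x : Bool × Bool) : blueVal x = 0 ∨ blueVal x = 1 := by
  unfold blueVal; split_ifs <;> simp

theorem sum_sum_ne_eq_two_mul (X : Finset (Fin n)) (f : Sym2 (Fin n) → ℝ) :
    (∑ x ∈ X, ∑ y ∈ X, if x = y then 0 else f s(x, y)) =
      2 * ∑ p ∈ X ×ˢ X with p.1 < p.2, f s(p.1, p.2) := by
  have h1 : ∀ x y, (if x = y then 0 else f s(x, y)) =
      (if x < y then f s(x, y) else 0) + (if y < x then f s(y, x) else 0) := by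
    intro x y
    rcases lt_trichotomy x y with h | h | h
    · simp [h, h.ne, h.not_gt]
    · simp [h]
    · simp [h, h.ne', h.not_gt, Sym2.eq_swap]
  simp only [h1, Finset.sum_add_distrib]
  rw [Finset.sum_comm (f := fun x y => if y < x then f s(y, x) else 0), Finset.sum_filter,
    Finset.sum_product]
  ring

theorem ex_blueCount_sub_sq_le (H : Params n k a b) (X : Finset (Fin n)) :
    ex (edgeWeight β a b) (fun η => (blueCount X η - meanPairs β a b X) ^ 2) ≤
      2 * (#X : ℝ) ^ 2 * (a / n) := by
  have hw := isWeight_edgeWeight (β := β) H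
  have ha := H.a_pos
  have hn : (0 : ℝ) < n := by exact_mod_cast H.n_pos
  let h : Fin n × Fin n → Bool × Bool → ℝ := fun p x => blueVal x - edgeProb β a b s(p.1, p.2) / 2
  let S : Finset (Fin n × Fin n) := {p ∈ X ×ˢ X | p.1 < p.2}
  have e1 : ∀ η, (blueCount X η - meanPairs β a b X) ^ 2 =
      4 * (∑ p ∈ S, h p (η s(p.1, p.2))) ^ 2 := by
    intro η
    have h1 := sum_sum_ne_eq_two_mul X fun e => blueVal (η e)
    have h2 := sum_sum_ne_eq_two_mul X fun e => edgeProb β a b e / 2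
    simp only [blueCount, meanPairs]
    rw [h1, h2, ← mul_sub, ← Finset.sum_sub_distrib]
    ring
  simp_rw [e1]
  rw [ex_const_mul, ex_sq_sum hw S (fun p => s(p.1, p.2)) _ h]
  · have h1 : ∀ p ∈ S, ∑ x, edgeWeight β a b s(p.1, p.2) x * h p x ^ 2 ≤ a / (2 * n) :=
      fun p _ => sum_edgeWeight_centred_sq_le H _ blueVal_zero_one (sum_edgeWeight_blueVal _)
    have h2 := Finset.sum_le_sum h1
    rw [Finset.sum_const, nsmul_eq_mul] at h2
    have h3 : (#S : ℝ) ≤ (#X : ℝ) ^ 2 := by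
      have := Finset.card_filter_le (X ×ˢ X) fun p : Fin n × Fin n => p.1 < p.2
      rw [Finset.card_product, ← sq] at this
      exact_mod_cast this
    calc 4 * _ ≤ 4 * ((#S : ℝ) * (a / (2 * n))) := mul_le_mul_of_nonneg_left h2 (by norm_num)
      _ ≤ 4 * ((#X : ℝ) ^ 2 * (a / (2 * n))) := by gcongr
      _ = _ := by ring
  · intro p _
    exact sum_edgeWeight_centred H _ (sum_edgeWeight_blueVal _)
  · rintro ⟨x, y⟩ hp ⟨x', y'⟩ hp' he
    have h1 := (Finset.mem_filter.1 hp).2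
    have h2 := (Finset.mem_filter.1 hp').2
    rcases Sym2.eq_iff.1 he with ⟨h3, h4⟩ | ⟨h3, h4⟩
    · exact Prod.ext h3 h4
    · simp only at h1 h2 h3 h4
      subst h3 h4
      exact absurd h1 h2.not_gt

/-- The Blue density of the set suggested by `y` is far from its mean. -/
def BlueDeviates (β : Fin n → Fin k) (a b γ : ℝ) (Z Y : Finset (Fin n)) (y : Fin n)
    (η : Sym2 (Fin n) → Bool × Bool) : Prop :=
  γ * (a - b) * (n / (2 * k)) ^ 2 / (100 * n) ≤
    |blueCount (redSet β a b Z Y y η) η - meanPairs β a b (redSet β a b Z Y y η)|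

theorem pr_blueDeviates_le (H : Params n k a b) {γ : ℝ} (hγ : 0 < γ)
    (hC : 10 ^ 18 * (k : ℝ) ^ 2 * a ≤ γ * (a - b) ^ 2) {Z Y : Finset (Fin n)} (hZY : Disjoint Z Y)
    {y : Fin n} (hy : y ∉ Z) :
    pr (edgeWeight β a b) (BlueDeviates β a b γ Z Y y) ≤ 1 / (γ * n) := by
  classical
  have hw := isWeight_edgeWeight (β := β) H
  have ha := H.a_pos
  have hn : (0 : ℝ) < n := by exact_mod_cast H.n_pos
  have hk : (0 : ℝ) < k := by exact_mod_cast H.k_pos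
  have hab : 0 < a - b := sub_pos.2 H.b_lt
  let J : Finset (Sym2 (Fin n)) := (Z ×ˢ Z).image fun p => s(p.1, p.2)
  have hJ : ∀ z, ∀ y ∉ Z, s(z, y) ∉ J := by
    intro z y hy hmem
    obtain ⟨⟨z', z''⟩, hz, h⟩ := Finset.mem_image.1 hmem
    have hz := Finset.mem_product.1 hz
    rcases Sym2.eq_iff.1 h with h | h
    · exact hy (h.2 ▸ hz.2)
    · exact hy (h.1 ▸ hz.1)
  refine ex_le_of_resample hw J fun ω => ?_
  set X := redSet β a b Z Y y ω with hX
  have hset : ∀ η, redSet β a b Z Y y (J.piecewise η ω) = X := fun η =>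
    redSet_congr (fun z _ y' hy' => resample_eq_of_notMem (hJ z y' (Finset.disjoint_right.1 hZY hy')))
      fun z _ => resample_eq_of_notMem (hJ z y hy)
  have hXZ : X ⊆ Z := redSet_subset _ _ _ _
  have hcount : ∀ η, blueCount X (J.piecewise η ω) = blueCount X η := by
    intro η
    refine Finset.sum_congr rfl fun x hx => Finset.sum_congr rfl fun x' hx' => ?_
    rw [Finset.piecewise_eq_of_mem _ _ _ (Finset.mem_image.2
      ⟨(x, x'), Finset.mem_product.2 ⟨hXZ hx, hXZ hx'⟩, rfl⟩)]
  simp only [BlueDeviates, hset, hcount]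
  have h1 := pr_le_of_ex_le hw (f := fun η => (blueCount X η - meanPairs β a b X) ^ 2)
    (fun _ => sq_nonneg _) (t := (γ * (a - b) * (n / (2 * k)) ^ 2 / (100 * n)) ^ 2) (by positivity)
    (ex_blueCount_sub_sq_le H X)
    (P := fun η => γ * (a - b) * (n / (2 * k)) ^ 2 / (100 * n) ≤ |blueCount X η - meanPairs β a b X|)
    (fun η h => by rw [← sq_abs (_ - _)]; exact pow_le_pow_left₀ (by positivity) h 2)
  refine h1.trans ?_
  have hs := card_redSet_le (β := β) (a := a) (b := b) Z Y y ω
  rw [← hX] at hs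
  calc 2 * (#X : ℝ) ^ 2 * (a / n) / (γ * (a - b) * (n / (2 * k)) ^ 2 / (100 * n)) ^ 2
      ≤ 2 * (n / (2 * k) : ℝ) ^ 2 * (a / n) / (γ * (a - b) * (n / (2 * k)) ^ 2 / (100 * n)) ^ 2 := by
        gcongr
    _ = 80000 * (k ^ 2 * a) / (γ * (γ * (a - b) ^ 2) * n) := by field_simp; norm_num
    _ ≤ 1 / (γ * n) := by
        rw [div_le_div_iff₀ (by positivity) (by positivity)]
        have : 80000 * (k ^ 2 * a) ≤ γ * (a - b) ^ 2 := by
          have : 0 < k ^ 2 * a := by positivity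
          nlinarith
        calc 80000 * (k ^ 2 * a) * (γ * n) ≤ γ * (a - b) ^ 2 * (γ * n) := by gcongr
          _ = _ := by ring

end Blue

section Conclusion

variable {n k : ℕ} {β : Fin n → Fin k} {a b γ : ℝ} {Z Y : Finset (Fin n)}
  {η : Sym2 (Fin n) → Bool × Bool}

/-- The red set of a column that is not noisy nearly agrees with a block. -/
theorem sub_le_card_blockIn_redSet (H : Params n k a b) (hγ : 0 < γ)
    (hC : 10 ^ 18 * (k : ℝ) ^ 2 * a ≤ γ * (a - b) ^ 2)
    (hZ : ∀ i, (1 - γ / 1000) * (n / (2 * k)) ≤ (#(blockIn β Z i) : ℝ)) {y : Fin n}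
    (hsig : ‖signal β a b Z y - (redSpace k a b Z Y η).starProjection (signal β a b Z y)‖ ^ 2 ≤
      3 * 10 ^ 13 * (k * a / n))
    (hy : ¬ NoisyColumn β a b Z Y y η) :
    (#(redSet β a b Z Y y η) : ℝ) - γ / 200 * (n / (2 * k)) ≤
      #(blockIn β (redSet β a b Z Y y η) (β y)) := by
  classical
  have ha := H.a_pos
  have hn : (0 : ℝ) < n := by exact_mod_cast H.n_pos
  have hk : (0 : ℝ) < k := by exact_mod_cast H.k_pos
  have hab : 0 < a - b := sub_pos.2 H.b_lt
  set P := (redSpace k a b Z Y η).starProjection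
  set X := redSet β a b Z Y y η with hX
  set V := blockIn β Z (β y) with hV
  set s : ℝ := n / (2 * k) with hs
  have hs0 : 0 < s := by positivity
  have hXZ : X ⊆ Z := redSet_subset _ _ _ _
  have hXs : (#X : ℝ) ≤ s := card_redSet_le _ _ _ _
  have hw : ‖P (signal β a b Z y + noiseCol β a b Z y η) - signal β a b Z y‖ ^ 2 ≤
      61 * 10 ^ 12 * (k * a / n) := by
    have e : P (signal β a b Z y + noiseCol β a b Z y η) - signal β a b Z y =
        P (noiseCol β a b Z y η) - (signal β a b Z y - P (signal β a b Z y)) := by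
      rw [map_add]; abel
    rw [e]
    have h1 := norm_sub_le (P (noiseCol β a b Z y η)) (signal β a b Z y - P (signal β a b Z y))
    have h2 : ‖P (noiseCol β a b Z y η)‖ ^ 2 ≤ 2 ^ 15 * (k * a / n) := (not_le.1 hy).le
    have h3 := pow_le_pow_left₀ (norm_nonneg _) h1 2
    have h4 : 0 < k * a / n := by positivity
    nlinarith [sq_nonneg (‖P (noiseCol β a b Z y η)‖ - ‖signal β a b Z y - P (signal β a b Z y)‖)]
  have herr := topCoords_error (r := n / (2 * k)) (V := V) _ (Finset.filter_subset _ _)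
    (signal β a b Z y) (lo := b / (2 * n) - (a + b) / (2 * n)) (h := (a - b) / (2 * n))
    (by positivity) (fun z => by
      simp only [hV, mem_blockIn, z.2, true_and]
      change edgeProb β a b s((z : Fin n), y) / 2 - (a + b) / (2 * n) = _
      rw [edgeProb_mk]
      split_ifs <;> ring) hw
  have hbd : ∀ c : ℝ, c * ((a - b) / (2 * n) / 2) ^ 2 ≤ 61 * 10 ^ 12 * (k * a / n) →
      c ≤ γ / 500 * s := by
    intro c hc
    have h1 : γ / 500 * s * ((a - b) / (2 * n) / 2) ^ 2 = γ * (a - b) ^ 2 / (16000 * n * k) := by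
      rw [hs]; field_simp; norm_num
    have h2 : 61 * 10 ^ 12 * (k * a / n) ≤ γ * (a - b) ^ 2 / (16000 * n * k) := by
      rw [le_div_iff₀ (by positivity)]
      have h3 : 61 * 10 ^ 12 * (k * a / n) * (16000 * n * k) = 976 * 10 ^ 15 * (k ^ 2 * a) := by
        field_simp; norm_num
      rw [h3]
      have : 0 < k ^ 2 * a := by positivity
      nlinarith
    rw [← h1] at h2
    exact le_of_mul_le_mul_right (hc.trans h2) (by positivity)
  have hblock : blockIn β X (β y) = X ∩ V := by
    ext v
    simp only [mem_blockIn, hV, Finset.mem_inter]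
    exact ⟨fun h => ⟨h.1, hXZ h.1, h.2⟩, fun h => ⟨h.1, h.2.2⟩⟩
  rw [hblock]
  rcases herr with h | h
  · have h1 := hbd _ h
    change (#(X \ V) : ℝ) ≤ _ at h1
    have h2 : (#(X \ V) : ℝ) + #(X ∩ V) = #X := by
      exact_mod_cast Finset.card_sdiff_add_card_inter X V
    nlinarith
  · have h1 := hbd _ h
    change (#(V \ X) : ℝ) ≤ _ at h1
    have h2 : (#(V \ X) : ℝ) + #(X ∩ V) = #V := by
      rw [Finset.inter_comm]
      exact_mod_cast Finset.card_sdiff_add_card_inter V X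
    have h3 := hZ (β y)
    nlinarith

theorem card_inter_le_of_ne {X X' : Finset (Fin n)} {i j : Fin k} (hij : i ≠ j) {g : ℝ}
    (h : (#X : ℝ) - g ≤ #(blockIn β X i)) (h' : (#X' : ℝ) - g ≤ #(blockIn β X' j)) :
    (#(X ∩ X') : ℝ) ≤ 2 * g := by
  classical
  have h1 : X ∩ X' ⊆ (X \ blockIn β X i) ∪ (X' \ blockIn β X' j) := by
    intro v hv
    obtain ⟨hv, hv'⟩ := Finset.mem_inter.1 hv
    by_cases h : β v = i
    · refine Finset.mem_union_right _ (Finset.mem_sdiff.2 ⟨hv', fun hcon => hij ?_⟩)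
      rw [← h, (mem_blockIn.1 hcon).2]
    · exact Finset.mem_union_left _ (Finset.mem_sdiff.2 ⟨hv, fun hcon => h (mem_blockIn.1 hcon).2⟩)
  have h2 := (Finset.card_le_card h1).trans (Finset.card_union_le _ _)
  have e1 : #(X \ blockIn β X i) + #(blockIn β X i) = #X :=
    Finset.card_sdiff_add_card_eq_card (Finset.filter_subset _ _)
  have e2 : #(X' \ blockIn β X' j) + #(blockIn β X' j) = #X' :=
    Finset.card_sdiff_add_card_eq_card (Finset.filter_subset _ _)
  have h2' : (#(X ∩ X') : ℝ) ≤ #(X \ blockIn β X i) + #(X' \ blockIn β X' j) := by exact_mod_cast h2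
  have e1' : (#(X \ blockIn β X i) : ℝ) + #(blockIn β X i) = #X := by exact_mod_cast e1
  have e2' : (#(X' \ blockIn β X' j) : ℝ) + #(blockIn β X' j) = #X' := by exact_mod_cast e2
  linarith

/-- If the edges behave well and the sampled columns are typical, then the selection from
the red sets exists and every possible selection is correct. -/
theorem isSelection_redSet {G : SimpleGraph (Fin n)} (H : Params n k a b) (hγ : 0 < γ) (hγ1 : γ ≤ 1)
    (hC : 10 ^ 18 * (k : ℝ) ^ 2 * a ≤ γ * (a - b) ^ 2) (hnγ : 2000 * k / γ ≤ (n : ℝ))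
    (hG : ∀ X, pairCount G X = blueCount X η)
    (hZ : ∀ i, |(#(blockIn β Z i) : ℝ) - n / (2 * k)| ≤ γ / 1000 * (n / (2 * k)))
    (hsig : ∀ y, ‖signal β a b Z y - (redSpace k a b Z Y η).starProjection (signal β a b Z y)‖ ^ 2 ≤
      3 * 10 ^ 13 * (k * a / n)) {m : ℕ} {c : Fin m → Fin n}
    (hblue : ∀ i, ¬ BlueDeviates β a b γ Z Y (c i) η)
    (hblock : ∀ j, ∃ i, β (c i) = j ∧ ¬ NoisyColumn β a b Z Y (c i) η)
    {K : Finset (Fin m)} (hK : ∀ i ∈ K, ¬ NoisyColumn β a b Z Y (c i) η) (hKm : m ≤ 2 * #K) :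
    (∃ U : Fin k → Finset (Fin n), IsSelection (fun i => redSet β a b Z Y (c i) η)
      (fun i => density G (redSet β a b Z Y (c i) η)) (0.2 * (n / (2 * k))) U) ∧
    ∀ U : Fin k → Finset (Fin n), IsSelection (fun i => redSet β a b Z Y (c i) η)
      (fun i => density G (redSet β a b Z Y (c i) η)) (0.2 * (n / (2 * k))) U →
      IsCorrect γ β Z U := by
  classical
  have ha := H.a_pos
  have hn : (0 : ℝ) < n := by exact_mod_cast H.n_pos
  have hk : (0 : ℝ) < k := by exact_mod_cast H.k_pos
  have hab : 0 < a - b := sub_pos.2 H.b_lt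
  set s : ℝ := n / (2 * k) with hs
  have hs0 : 0 < s := by positivity
  have hγs : 1 ≤ γ / 1000 * s := by
    rw [div_le_iff₀ hγ] at hnγ
    rw [hs, div_mul_div_comm, le_div_iff₀ (by positivity)]
    linarith
  let G' : Finset (Fin m) := {i | ¬ NoisyColumn β a b Z Y (c i) η}
  have hG' : m ≤ 2 * #G' := hKm.trans (Nat.mul_le_mul_left 2 (Finset.card_le_card fun i hi =>
    Finset.mem_filter.2 ⟨Finset.mem_univ _, hK i hi⟩))
  let X : Fin m → Finset (Fin n) := fun i => redSet β a b Z Y (c i) η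
  have hgood : ∀ i ∈ G', (#(X i) : ℝ) - γ / 200 * s ≤ #(blockIn β (X i) (β (c i))) :=
    fun i hi => sub_le_card_blockIn_redSet H hγ hC
      (fun j => by have := (abs_le.1 (hZ j)).1; rw [← hs]; linarith) (hsig _)
      (Finset.mem_filter.1 hi).2
  choose f hf hfn using hblock
  have hf' : ∀ j, f j ∈ G' := fun j => Finset.mem_filter.2 ⟨Finset.mem_univ _, hfn j⟩
  have hsep : IsSeparatedChoice X (0.2 * s) G' f := by
    refine ⟨hf', fun i j hij => ?_⟩
    have h1 := hgood _ (hf' i)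
    have h2 := hgood _ (hf' j)
    rw [hf] at h1 h2
    refine (card_inter_le_of_ne hij h1 h2).trans_lt ?_
    have : γ * s ≤ 1 * s := by gcongr
    norm_num
    linarith
  have hXcard : ∀ i, #(X i) = min (n / (2 * k)) #Z := fun i => card_topCoords _ _
  have hXle : ∀ i, (#(X i) : ℝ) ≤ s := fun i => card_redSet_le _ _ _ _
  have hXge : ∀ i, (1 - γ / 1000) * s ≤ #(X i) := by
    intro i
    rw [hXcard, Nat.cast_min, le_min_iff]
    constructor
    · have h1 : s < ((n / (2 * k) : ℕ) : ℝ) + 1 := by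
        have := Nat.lt_div_mul_add (a := n) (b := 2 * k) (by have := H.k_pos; lia)
        rw [hs, div_lt_iff₀ (by positivity)]
        have h3 : (n : ℝ) < ((n / (2 * k) * (2 * k) + 2 * k : ℕ) : ℝ) := by exact_mod_cast this
        push_cast at h3
        linarith
      linarith
    · have h1 := (abs_le.1 (hZ ⟨0, H.k_pos⟩)).1
      have h2 : (#(blockIn β Z ⟨0, H.k_pos⟩) : ℝ) ≤ #Z := by
        exact_mod_cast Finset.card_le_card (Finset.filter_subset _ _)
      linarith
  refine ⟨exists_isSelection hG' hsep, fun U hU => ?_⟩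
  obtain ⟨g, hUg, hUsep, hscore⟩ := hU.exists_score_ge hG' hsep
  refine isCorrect_of_majority hγ hγ1 hs0 (fun i => ?_) (fun i => ?_) (fun i => ?_) hUsep
  · have := (abs_le.1 (hZ i)).2
    nlinarith
  · obtain ⟨j, hj, hjs⟩ := hscore i
    have hXpos : (0 : ℝ) < #(X (g i)) := lt_of_lt_of_le (by nlinarith) (hXge (g i))
    have hΔ : ∀ i, |pairCount G (X i) - meanPairs β a b (X i)| ≤
        γ * (a - b) * s ^ 2 / (100 * n) := fun i => by
      rw [hG]; exact (not_le.1 (hblue i)).le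
    have hg1 : γ / 200 * s ≤ #(X (g i)) := by
      have := hXge (g i); nlinarith
    have hcardeq : #(X j) = #(X (g i)) := by rw [hXcard, hXcard]
    obtain ⟨l, hl⟩ := exists_block_of_density_ge H.n_pos H.b_lt (by exact_mod_cast hXpos) hcardeq hjs
      (hΔ _) (hΔ _) (g := γ / 200 * s) (by rw [← hcardeq]; exact hgood j hj) hg1
    refine ⟨l, le_trans ?_ (hl.trans_eq (by rw [hUg]))⟩
    have h1 := hXge (g i)
    have h2 : 4 * n * (γ * (a - b) * s ^ 2 / (100 * n)) / ((a - b) * #(X (g i))) ≤ γ / 10 * s := by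
      have e : 4 * n * (γ * (a - b) * s ^ 2 / (100 * n)) / ((a - b) * #(X (g i))) =
          γ * s ^ 2 / 25 / #(X (g i)) := by field_simp; norm_num
      rw [e, div_le_iff₀ hXpos]
      have h3 : s / 2 ≤ #(X (g i)) := by nlinarith
      have h4 : γ / 10 * s * (s / 2) ≤ γ / 10 * s * #(X (g i)) := by gcongr
      nlinarith [mul_pos hγ (pow_pos hs0 2)]
    nlinarith [mul_pos hγ hs0]
  · rw [hUg]; exact redSet_subset _ _ _ _

end Conclusion

section Outcome

variable {n k : ℕ} {β : Fin n → Fin k} {a b γ : ℝ} (ω : Outcome n)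

/-- The edge coins of an outcome. -/
def edgeCoins (e : Sym2 (Fin n)) : Bool × Bool := (ω.1 e, ω.2.1 e)

theorem disjoint_Z_Y₁ : Disjoint ω.Z ω.Y₁ :=
  Finset.disjoint_left.2 fun v h h' => by
    simp only [Outcome.Z, Outcome.Y₁, Finset.mem_filter] at h h'
    simp [h.2] at h'

theorem disjoint_Z_Y₂ : Disjoint ω.Z ω.Y₂ :=
  Finset.disjoint_left.2 fun v h h' => by
    simp only [Outcome.Z, Outcome.Y₂, Finset.mem_filter] at h h'
    simp [h.2] at h'

theorem disjoint_Y₁_Y₂ : Disjoint ω.Y₁ ω.Y₂ :=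
  Finset.disjoint_left.2 fun v h h' => by
    simp only [Outcome.Y₁, Outcome.Y₂, Finset.mem_filter] at h h'
    simp [h.2.2] at h'

theorem red_adj {u v : Fin n} : ω.red.Adj u v ↔ redVal (edgeCoins ω s(u, v)) = 1 ∧ u ≠ v := by
  unfold Outcome.red redVal edgeCoins
  simp [SimpleGraph.fromEdgeSet_adj]

open Classical in
theorem ite_red_adj {u v : Fin n} (h : u ≠ v) :
    (if ω.red.Adj u v then (1 : ℝ) else 0) = redVal (edgeCoins ω s(u, v)) := by
  rw [red_adj]
  rcases redVal_zero_one (edgeCoins ω s(u, v)) with h' | h' <;> simp [h, h']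

theorem biadj_red : biadj ω.red ω.Z ω.Y₁ = redMat (edgeCoins ω) ω.Z ω.Y₁ := by
  ext z y
  rw [biadj, redMat, Matrix.of_apply, Matrix.of_apply]
  exact ite_red_adj ω fun h => Finset.disjoint_left.1 (disjoint_Z_Y₁ ω) z.2 (h ▸ y.2)

theorem centredColumn_red {y : Fin n} (hy : y ∉ ω.Z) :
    centredColumn ω.red ω.Z a b y = signal β a b ω.Z y + noiseCol β a b ω.Z y (edgeCoins ω) := by
  ext z
  have h := ite_red_adj ω (u := z) (v := y) fun h => hy (h ▸ z.2)
  simp only [centredColumn, signal, noiseCol, PiLp.add_apply]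
  rw [h]
  ring

theorem pairCount_blue (X : Finset (Fin n)) : pairCount ω.blue X = blueCount X (edgeCoins ω) := by
  classical
  refine Finset.sum_congr rfl fun x _ => Finset.sum_congr rfl fun y _ => ?_
  unfold Outcome.blue blueVal edgeCoins
  by_cases h : x = y
  · simp [h]
  · simp [SimpleGraph.fromEdgeSet_adj, h]

theorem succeeds_of_typical (H : Params n k a b) (hβ : EqualBlocks β) (hγ : 0 < γ) (hγ1 : γ ≤ 1)
    (hC : 10 ^ 18 * (k : ℝ) ^ 2 * a ≤ γ * (a - b) ^ 2) (hnγ : 2000 * k / γ ≤ (n : ℝ))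
    (hnoise : NoiseBounded β a b ω.Z ω.Y₁ (edgeCoins ω))
    (hr : (#{z ∈ ω.Z | 20 * avgDegree k a b < ∑ y ∈ ω.Y₁, redVal (edgeCoins ω s(z, y))} : ℝ) ≤ n / a)
    (hc : (#{y ∈ ω.Y₁ | 20 * avgDegree k a b < ∑ z ∈ ω.Z, redVal (edgeCoins ω s(z, y))} : ℝ) ≤ n / a)
    (hZ : ∀ i, |(#(blockIn β ω.Z i) : ℝ) - n / (2 * k)| ≤ γ / 1000 * (n / (2 * k)))
    (hY : ∀ i, (n / (8 * k) : ℝ) ≤ #(blockIn β ω.Y₁ i))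
    {c : Fin (numSamples n) → Fin n} (hcY : ∀ i, c i ∈ ω.Y₂)
    (hblue : ∀ i, ¬ BlueDeviates β a b γ ω.Z ω.Y₁ (c i) (edgeCoins ω))
    (hblock : ∀ j, ∃ i, β (c i) = j ∧ ¬ NoisyColumn β a b ω.Z ω.Y₁ (c i) (edgeCoins ω))
    {K : Finset (Fin (numSamples n))}
    (hK : ∀ i ∈ K, ¬ NoisyColumn β a b ω.Z ω.Y₁ (c i) (edgeCoins ω))
    (hKm : numSamples n ≤ 2 * #K) :
    Succeeds γ β a b ω c := by
  have ha := H.a_pos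
  have hn : (0 : ℝ) < n := by exact_mod_cast H.n_pos
  have hk : (0 : ℝ) < k := by exact_mod_cast H.k_pos
  have hC' : 10 ^ 14 * (k : ℝ) ^ 2 * a ≤ (a - b) ^ 2 := by
    have h1 : 0 < (k : ℝ) ^ 2 * a := by positivity
    nlinarith [sq_nonneg (a - b)]
  have hZ' : ∀ i, (n / (4 * k) : ℝ) ≤ #(blockIn β ω.Z i) := by
    intro i
    have h1 := (abs_le.1 (hZ i)).1
    have h2 : (n / (4 * k) : ℝ) = 1 / 2 * (n / (2 * k)) := by field_simp; norm_num
    have h3 : (0 : ℝ) < n / (2 * k) := by positivity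
    rw [h2]
    nlinarith
  obtain ⟨hW, hsig⟩ := redSpace_spec H hβ hC' hnoise hr hc hZ' hY
  obtain ⟨hex, hall⟩ := isSelection_redSet (G := ω.blue) H hγ hγ1 hC hnγ (pairCount_blue ω) hZ hsig
    hblue hblock hK hKm
  have hset : ∀ i, topCoords (n / (2 * k)) ((redSpace k a b ω.Z ω.Y₁ (edgeCoins ω)).starProjection
      (centredColumn ω.red ω.Z a b (c i))) = redSet β a b ω.Z ω.Y₁ (c i) (edgeCoins ω) := by
    intro i
    rw [centredColumn_red (β := β) ω (Finset.disjoint_right.1 (disjoint_Z_Y₂ ω) (hcY i)), redSet]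
  have hiff : ∀ U : Fin k → Finset (Fin n), IsSpectralOutput k a b ω c U ↔
      IsSelection (fun i => redSet β a b ω.Z ω.Y₁ (c i) (edgeCoins ω))
        (fun i => density ω.blue (redSet β a b ω.Z ω.Y₁ (c i) (edgeCoins ω)))
        (0.2 * (n / (2 * k))) U := by
    intro U
    unfold IsSpectralOutput
    rw [biadj_red]
    simp only [hW, exists_eq_left, hset]
  refine ⟨?_, fun U hU => hall U ((hiff U).1 hU)⟩
  obtain ⟨U, hU⟩ := hex
  exact ⟨U, (hiff U).2 hU⟩

end Outcome

section Coins

variable {n k : ℕ} {β : Fin n → Fin k} {a b γ : ℝ}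

/-! ### The vertex coins -/

/-- The law of the two coins of a vertex. -/
noncomputable def vertexWeight (n : ℕ) (_ : Fin n) (_ : Bool × Bool) : ℝ := 1 / 4

theorem isWeight_vertexWeight : IsWeight (vertexWeight n) where
  nonneg _ _ := by norm_num [vertexWeight]
  sum_eq _ := by simp [vertexWeight]

/-- The outcome with given edge and vertex coins. -/
def ofCoins (η : Sym2 (Fin n) → Bool × Bool) (ζ : Fin n → Bool × Bool) : Outcome n :=
  (fun e => (η e).1, fun e => (η e).2, fun v => (ζ v).1, fun v => (ζ v).2)

theorem mem_ofCoins_Z {η : Sym2 (Fin n) → Bool × Bool} {ζ : Fin n → Bool × Bool} {v : Fin n} :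
    v ∈ (ofCoins η ζ).Z ↔ (ζ v).1 = true := by
  rw [Outcome.Z, Finset.mem_filter]; simp [ofCoins]

theorem mem_ofCoins_Y₁ {η : Sym2 (Fin n) → Bool × Bool} {ζ : Fin n → Bool × Bool} {v : Fin n} :
    v ∈ (ofCoins η ζ).Y₁ ↔ (ζ v).1 = false ∧ (ζ v).2 = true := by
  rw [Outcome.Y₁, Finset.mem_filter]; simp [ofCoins]

theorem mem_ofCoins_Y₂ {η : Sym2 (Fin n) → Bool × Bool} {ζ : Fin n → Bool × Bool} {v : Fin n} :
    v ∈ (ofCoins η ζ).Y₂ ↔ (ζ v).1 = false ∧ (ζ v).2 = false := by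
  rw [Outcome.Y₂, Finset.mem_filter]; simp [ofCoins]

/-- The parts of the blocks in `Z`, `Y₁` and `Y₂` have about the expected size. -/
def VerticesTypical (β : Fin n → Fin k) (γ : ℝ) (Z Y₁ Y₂ : Finset (Fin n)) : Prop :=
  ∀ i, |(#(blockIn β Z i) : ℝ) - n / (2 * k)| ≤ γ / 1000 * (n / (2 * k)) ∧
    (n / (8 * k) : ℝ) ≤ #(blockIn β Y₁ i) ∧ (n / (8 * k) : ℝ) ≤ #(blockIn β Y₂ i)

theorem pr_card_deviates_le (S : Finset (Fin n)) (f : Bool × Bool → Bool) {p t : ℝ} (ht : 0 < t)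
    (hp : ∑ x, (1 / 4 : ℝ) * (if f x then 1 else 0) = p) :
    pr (vertexWeight n) (fun ζ => t ≤ |(#{v ∈ S | f (ζ v)} : ℝ) - p * #S|) ≤ #S / t ^ 2 := by
  have hw := isWeight_vertexWeight (n := n)
  have e : ∀ ζ : Fin n → Bool × Bool, (#{v ∈ S | f (ζ v)} : ℝ) - p * #S =
      ∑ v ∈ S, ((if f (ζ v) then 1 else 0) - p) := by
    intro ζ
    rw [Finset.sum_sub_distrib, Finset.sum_boole, Finset.sum_const, nsmul_eq_mul, mul_comm p]
  have hsum : ∑ x : Bool × Bool, (1 / 4 : ℝ) = 1 := by simp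
  simp only [e]
  refine pr_le_of_ex_le hw
    (f := fun ζ => (∑ v ∈ S, ((if f (ζ v) then 1 else 0) - p)) ^ 2) (fun _ => sq_nonneg _)
    (by positivity) ?_ (fun ζ h => by rw [← sq_abs (∑ v ∈ S, _)]; exact pow_le_pow_left₀ ht.le h 2)
  have hp0 : 0 ≤ p := by
    rw [← hp]
    exact Finset.sum_nonneg fun x _ => by split_ifs <;> norm_num
  have hp1 : p ≤ 1 := by
    rw [← hp, ← hsum]
    exact Finset.sum_le_sum fun x _ => by split_ifs <;> norm_num
  refine (ex_sq_sum hw S id (fun _ _ _ _ h => h) (fun _ x => (if f x then 1 else 0) - p)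
    fun v _ => ?_).trans_le ?_
  · simp only [vertexWeight, mul_sub, Finset.sum_sub_distrib, hp]
    rw [← Finset.sum_mul, hsum]; ring
  · refine (Finset.sum_le_sum fun v _ => ?_).trans_eq (by
      rw [Finset.sum_const, nsmul_eq_mul, mul_one] : ∑ _ ∈ S, (1 : ℝ) = #S)
    refine (Finset.sum_le_sum fun x _ => ?_).trans_eq hsum
    simp only [vertexWeight]
    have h2 : ((if f x then 1 else 0) - p) ^ 2 ≤ 1 := by split_ifs <;> nlinarith
    linarith

theorem pr_not_verticesTypical_le (hβ : EqualBlocks β) (hk : 0 < k) (hn : 0 < n) (hγ : 0 < γ)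
    (hγ1 : γ ≤ 1) (η : Sym2 (Fin n) → Bool × Bool) :
    pr (vertexWeight n) (fun ζ => ¬ VerticesTypical β γ (ofCoins η ζ).Z (ofCoins η ζ).Y₁
      (ofCoins η ζ).Y₂) ≤ 12 * 10 ^ 6 * k ^ 2 / (γ ^ 2 * n) := by
  have hw := isWeight_vertexWeight (n := n)
  have hn0 : (0 : ℝ) < n := by exact_mod_cast hn
  have hk0 : (0 : ℝ) < k := by exact_mod_cast hk
  set t : ℝ := γ / 1000 * (n / (2 * k)) with ht
  have ht0 : 0 < t := by positivity
  let B : Fin k → Finset (Fin n) := fun i => {v | β v = i}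
  have hB : ∀ i, (#(B i) : ℝ) = n / k := fun i => card_block hβ hk i
  let F : Fin 3 → Bool × Bool → Bool := ![fun x => x.1, fun x => !x.1 && x.2, fun x => !x.1 && !x.2]
  let p : Fin 3 → ℝ := ![1 / 2, 1 / 4, 1 / 4]
  have hF : ∀ j, ∑ x, (1 / 4 : ℝ) * (if F j x then 1 else 0) = p j := by
    intro j
    fin_cases j <;> (simp [F, p, Fintype.sum_prod_type]; try norm_num)
  have h1 : ∀ i j, pr (vertexWeight n) (fun ζ => t ≤ |(#{v ∈ B i | F j (ζ v)} : ℝ) - p j * #(B i)|) ≤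
      4 * 10 ^ 6 * k / (γ ^ 2 * n) := by
    intro i j
    refine (pr_card_deviates_le (B i) (F j) ht0 (hF j)).trans (le_of_eq ?_)
    rw [hB, ht]; field_simp; norm_num
  have h2 : pr (vertexWeight n) (fun ζ => ∃ q ∈ (Finset.univ : Finset (Fin k × Fin 3)),
      t ≤ |(#{v ∈ B q.1 | F q.2 (ζ v)} : ℝ) - p q.2 * #(B q.1)|) ≤
      12 * 10 ^ 6 * k ^ 2 / (γ ^ 2 * n) := by
    refine (pr_exists_le hw _ _).trans ((Finset.sum_le_sum fun q _ => h1 q.1 q.2).trans_eq ?_)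
    rw [Finset.sum_const, Finset.card_univ, Fintype.card_prod, Fintype.card_fin, Fintype.card_fin,
      nsmul_eq_mul]
    push_cast; ring
  refine le_trans (pr_mono hw fun ζ hζ => ?_) h2
  by_contra hcon
  refine hζ fun i => ?_
  have h3 : ∀ j, |(#{v ∈ B i | F j (ζ v)} : ℝ) - p j * (n / k)| < t := fun j => by
    by_contra h
    rw [← hB i] at h
    exact hcon ⟨(i, j), Finset.mem_univ _, not_lt.1 h⟩
  have htn : t ≤ n / (8 * k) := by
    have e : t = γ / 2000 * (n / k) := by rw [ht]; field_simp; norm_num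
    have e' : (n / (8 * k) : ℝ) = 1 / 8 * (n / k) := by field_simp
    rw [e, e']
    gcongr
    linarith
  have e4 : (n / (8 * k) : ℝ) = 1 / 4 * (n / k) - n / (8 * k) := by field_simp; norm_num
  have hZ : blockIn β (ofCoins η ζ).Z i = {v ∈ B i | F 0 (ζ v)} := by
    ext v; simp [mem_blockIn, mem_ofCoins_Z, B, F, and_comm]
  have hY₁ : blockIn β (ofCoins η ζ).Y₁ i = {v ∈ B i | F 1 (ζ v)} := by
    ext v; simp [mem_blockIn, mem_ofCoins_Y₁, B, F, and_comm]
  have hY₂ : blockIn β (ofCoins η ζ).Y₂ i = {v ∈ B i | F 2 (ζ v)} := by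
    ext v; simp [mem_blockIn, mem_ofCoins_Y₂, B, F, and_comm]
  refine ⟨?_, ?_, ?_⟩
  · have h := (h3 0).le
    rw [← hZ] at h
    have e5 : p 0 * (n / k) = (n / (2 * k) : ℝ) := by
      have : p 0 = 1 / 2 := rfl
      rw [this]; field_simp
    rw [e5] at h
    exact h
  · have h := (abs_lt.1 (h3 1)).1
    rw [← hY₁] at h
    have : p 1 = 1 / 4 := rfl
    rw [this] at h
    linarith
  · have h := (abs_lt.1 (h3 2)).1
    rw [← hY₂] at h
    have : p 2 = 1 / 4 := rfl
    rw [this] at h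
    linarith

/-! ### The edge coins -/

open Classical in
/-- The conditions on the edges under which typical samples lead to success. -/
def EdgesTypical (β : Fin n → Fin k) (a b γ : ℝ) (Z Y₁ Y₂ : Finset (Fin n))
    (η : Sym2 (Fin n) → Bool × Bool) : Prop :=
  NoiseBounded β a b Z Y₁ η ∧
  (#{z ∈ Z | 20 * avgDegree k a b < ∑ y ∈ Y₁, redVal (η s(z, y))} : ℝ) ≤ n / a ∧
  (#{y ∈ Y₁ | 20 * avgDegree k a b < ∑ z ∈ Z, redVal (η s(z, y))} : ℝ) ≤ n / a ∧
  (∀ i, (#{y ∈ blockIn β Y₂ i | NoisyColumn β a b Z Y₁ y η} : ℝ) ≤ #(blockIn β Y₂ i) / 8) ∧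
  (#{y ∈ Y₂ | BlueDeviates β a b γ Z Y₁ y η} : ℝ) ≤ #Y₂ / √n

open Classical in
theorem pr_many_blueDeviates_le (H : Params n k a b) (hγ : 0 < γ)
    (hC : 10 ^ 18 * (k : ℝ) ^ 2 * a ≤ γ * (a - b) ^ 2) {Z Y₁ Y₂ : Finset (Fin n)}
    (hZY₁ : Disjoint Z Y₁) (hZY₂ : Disjoint Z Y₂) (hY₂ : 0 < #Y₂) :
    pr (edgeWeight β a b) (fun η => (#Y₂ / √n : ℝ) ≤ #{y ∈ Y₂ | BlueDeviates β a b γ Z Y₁ y η}) ≤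
      1 / (γ * √n) := by
  have hw := isWeight_edgeWeight (β := β) H
  have hn : (0 : ℝ) < n := by exact_mod_cast H.n_pos
  have hY : (0 : ℝ) < #Y₂ := by exact_mod_cast hY₂
  refine (pr_le_of_ex_le hw (fun _ => Nat.cast_nonneg _) (by positivity)
    (c := #Y₂ * (1 / (γ * n))) ?_ fun _ h => h).trans (le_of_eq ?_)
  · have e : ∀ η, (#{y ∈ Y₂ | BlueDeviates β a b γ Z Y₁ y η} : ℝ) =
        ∑ y ∈ Y₂, if BlueDeviates β a b γ Z Y₁ y η then 1 else 0 := fun η => by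
      rw [Finset.sum_boole]
    simp only [e]
    rw [ex_sum]
    refine (Finset.sum_le_sum fun y hy =>
      pr_blueDeviates_le H hγ hC hZY₁ (Finset.disjoint_right.1 hZY₂ hy)).trans_eq ?_
    rw [Finset.sum_const, nsmul_eq_mul]
  · have h2 : (n : ℝ) = √n * √n := (Real.mul_self_sqrt hn.le).symm
    have h3 : 0 < √(n : ℝ) := Real.sqrt_pos.2 hn
    generalize √(n : ℝ) = r at h2 h3
    rw [h2]
    field_simp

theorem pr_not_edgesTypical_le (H : Params n k a b) (hβ : EqualBlocks β) (hγ : 0 < γ) (hγ1 : γ ≤ 1)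
    (hC : 10 ^ 18 * (k : ℝ) ^ 2 * a ≤ γ * (a - b) ^ 2) {Z Y₁ Y₂ : Finset (Fin n)}
    (hZY₁ : Disjoint Z Y₁) (hZY₂ : Disjoint Z Y₂) (hY₁Y₂ : Disjoint Y₁ Y₂)
    (hV : VerticesTypical β γ Z Y₁ Y₂) :
    pr (edgeWeight β a b) (fun η => ¬ EdgesTypical β a b γ Z Y₁ Y₂ η) ≤ 15 * k ^ 2 / (γ * √n) := by
  classical
  have hw := isWeight_edgeWeight (β := β) H
  have hn : (0 : ℝ) < n := by exact_mod_cast H.n_pos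
  have hn1 : (1 : ℝ) ≤ n := by exact_mod_cast H.n_pos
  have hk : (1 : ℝ) ≤ k := by exact_mod_cast H.k_pos
  have hk0 : (0 : ℝ) < k := by linarith
  have hY₂ : 0 < #Y₂ := by
    have h1 := (hV ⟨0, H.k_pos⟩).2.2
    have h2 : 0 < #(blockIn β Y₂ ⟨0, H.k_pos⟩) := by
      have : (0 : ℝ) < #(blockIn β Y₂ ⟨0, H.k_pos⟩) := lt_of_lt_of_le (by positivity) h1
      exact_mod_cast this
    exact h2.trans_le (Finset.card_le_card (Finset.filter_subset _ _))
  have p1 := pr_not_noiseBounded_le (a := a) (b := b) H hβ hZY₁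
  have p2 := pr_many_large_degrees_le (a := a) (b := b) H hβ hZY₁
  have p3 := pr_many_large_degrees_le (a := a) (b := b) H hβ hZY₁.symm
  have p4 : pr (edgeWeight β a b) (fun η => ∃ i ∈ Finset.univ, (#(blockIn β Y₂ i) / 8 : ℝ) ≤
      #{y ∈ blockIn β Y₂ i | NoisyColumn β a b Z Y₁ y η}) ≤ 8 * k ^ 2 / n := by
    refine (pr_exists_le hw _ _).trans ((Finset.sum_le_sum (g := fun _ => 8 * k / (n : ℝ))
      fun i _ => ?_).trans_eq ?_)
    · refine (pr_many_noisyColumns_le H hZY₁ (hZY₂.mono_right (Finset.filter_subset _ _))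
        (hY₁Y₂.mono_right (Finset.filter_subset _ _))).trans ?_
      have h1 := (hV i).2.2
      have h2 : (#(blockIn β Y₂ i) : ℝ) ≤ 2 ^ #(blockIn β Y₂ i) := by
        exact_mod_cast Nat.lt_two_pow_self.le
      rw [one_div, inv_pow, inv_le_comm₀ (by positivity) (by positivity), inv_div]
      exact h1.trans h2
    · rw [Finset.sum_const, Finset.card_univ, Fintype.card_fin, nsmul_eq_mul]; ring
  have p5 := pr_many_blueDeviates_le (β := β) H hγ hC hZY₁ hZY₂ hY₂
  have hor := (pr_or_le hw _ _).trans (add_le_add ((pr_or_le hw _ _).trans (add_le_add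
    ((pr_or_le hw _ _).trans (add_le_add ((pr_or_le hw _ _).trans (add_le_add p1 p2)) p3)) p4)) p5)
  refine le_trans (pr_mono hw fun η hη => ?_) (hor.trans ?_)
  · by_contra hcon
    simp only [not_or, not_not, not_exists, not_and, not_le] at hcon
    obtain ⟨⟨⟨⟨h1, h2⟩, h3⟩, h4⟩, h5⟩ := hcon
    refine hη ⟨h1, h2.le, ?_, fun i => (h4 i (Finset.mem_univ i)).le, h5.le⟩
    refine le_trans (le_of_eq ?_) h3.le
    congr! 7
    rw [Sym2.eq_swap]
  · have h3 : 1 ≤ √(n : ℝ) := Real.one_le_sqrt.2 hn1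
    have h4 : (n : ℝ) = √n * √n := (Real.mul_self_sqrt hn.le).symm
    have h5 : γ * √n ≤ n := by
      nth_rw 2 [h4]
      gcongr
      linarith
    have h6 : ∀ x : ℝ, 0 ≤ x → x / n ≤ x / (γ * √n) := fun x hx => by gcongr
    have h7 := h6 (4 * k ^ 2) (by positivity)
    have h8 := h6 k hk0.le
    have h9 := h6 (8 * k ^ 2) (by positivity)
    have h10 : 4 * k ^ 2 / (γ * √n) + k / (γ * √n) + k / (γ * √n) + 8 * k ^ 2 / (γ * √n) +
        1 / (γ * √n) = (12 * (k : ℝ) ^ 2 + 2 * k + 1) / (γ * √n) := by ring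
    have h11 : (12 * (k : ℝ) ^ 2 + 2 * k + 1) / (γ * √n) ≤ 15 * k ^ 2 / (γ * √n) := by
      gcongr
      nlinarith
    linarith

end Coins

section Sampling

variable {n k m : ℕ} {β : Fin n → Fin k}

/-- The weight of the uniform distribution on `Y`. -/
noncomputable def uniformWeight (m : ℕ) (Y : Finset (Fin n)) (_ : Fin m) (y : Fin n) : ℝ :=
  if y ∈ Y then 1 / #Y else 0

open Classical in
theorem sum_uniformWeight (Y : Finset (Fin n)) (i : Fin m) (P : Fin n → Prop) :
    ∑ y, uniformWeight m Y i y * (if P y then 1 else 0) = #{y ∈ Y | P y} / #Y := by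
  have h : ∀ y, uniformWeight m Y i y * (if P y then 1 else 0) =
      (if y ∈ Y ∧ P y then 1 else 0) / #Y := by
    intro y
    unfold uniformWeight
    by_cases h1 : y ∈ Y <;> by_cases h2 : P y <;> simp [h1, h2]
  simp only [h]
  rw [← Finset.sum_div, Finset.sum_boole]
  congr 2
  rw [← Finset.filter_filter, Finset.filter_univ_mem]

theorem isWeight_uniformWeight {Y : Finset (Fin n)} (hY : 0 < #Y) :
    IsWeight (uniformWeight m Y) where
  nonneg _ _ := by unfold uniformWeight; split_ifs <;> positivity
  sum_eq i := by
    classical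
    have h := sum_uniformWeight Y i fun _ => True
    have hY' : (#Y : ℝ) ≠ 0 := by exact_mod_cast hY.ne'
    simpa [hY'] using h

open Classical in
theorem pr_coord {ι κ : Type*} [Fintype ι] [DecidableEq ι] [Fintype κ] {w : ι → κ → ℝ}
    (hw : IsWeight w) (i : ι) (P : κ → Prop) :
    pr w (fun c => P (c i)) = ∑ y, w i y * (if P y then 1 else 0) := by
  have h := ex_prod hw {i} id (by simp) fun _ y => if P y then (1 : ℝ) else 0
  unfold pr
  simpa using h

theorem pr_forall_not_le {Y : Finset (Fin n)} (hY : 0 < #Y) (P : Fin n → Prop) {q : ℝ}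
    (hq : haveI := Classical.decPred P; q ≤ #{y ∈ Y | P y} / #Y) :
    pr (uniformWeight m Y) (fun c => ∀ i, ¬ P (c i)) ≤ (1 - q) ^ m := by
  classical
  have hw := isWeight_uniformWeight (m := m) hY
  have h := ex_prod hw Finset.univ id (fun _ _ _ _ h => h) fun _ y => if P y then (0 : ℝ) else 1
  have e : ∀ i, ∑ y, uniformWeight m Y i y * (if P y then (0 : ℝ) else 1) =
      1 - #{y ∈ Y | P y} / #Y := by
    intro i
    rw [← sum_uniformWeight Y i P, eq_sub_iff_add_eq, ← Finset.sum_add_distrib]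
    refine (Finset.sum_congr rfl fun y _ => ?_).trans (hw.sum_eq i)
    split_ifs <;> ring
  simp only [id, e, Finset.prod_const, Finset.card_univ, Fintype.card_fin] at h
  have e2 : pr (uniformWeight m Y) (fun c => ∀ i, ¬ P (c i)) =
      ex (uniformWeight m Y) fun c => ∏ i, if P (c i) then (0 : ℝ) else 1 := by
    unfold pr
    congr 1
    ext c
    by_cases hc : ∀ i, ¬ P (c i)
    · rw [if_pos hc, Finset.prod_eq_one fun i _ => if_neg (hc i)]
    · rw [if_neg hc]
      push Not at hc
      obtain ⟨i, hi⟩ := hc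
      have h0 : (if P (c i) then (0 : ℝ) else 1) = 0 := if_pos hi
      exact (Finset.prod_eq_zero (f := fun i => if P (c i) then (0 : ℝ) else 1)
        (Finset.mem_univ i) h0).symm
  rw [e2, h]
  have h1 : (#{y ∈ Y | P y} : ℝ) / #Y ≤ 1 := by
    rw [div_le_one (by exact_mod_cast hY)]
    exact_mod_cast Finset.card_filter_le _ _
  refine pow_le_pow_left₀ (by linarith) ?_ _
  have : q ≤ (#{y ∈ Y | P y} : ℝ) / #Y := by convert hq
  linarith

open Classical in
theorem pr_half_le {Y : Finset (Fin n)} (hY : 0 < #Y) (P : Fin n → Prop)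
    (hq : (#{y ∈ Y | P y} : ℝ) / #Y ≤ 1 / 8) :
    pr (uniformWeight m Y) (fun c => m < 2 * #{i | P (c i)}) ≤ (2 / 3) ^ m := by
  have hw := isWeight_uniformWeight (m := m) hY
  have h := ex_prod hw Finset.univ id (fun _ _ _ _ h => h) fun _ y => if P y then (9 : ℝ) else 1
  have e : ∀ i, ∑ y, uniformWeight m Y i y * (if P y then (9 : ℝ) else 1) =
      1 + 8 * (#{y ∈ Y | P y} / #Y) := by
    intro i
    rw [← sum_uniformWeight Y i P]
    refine Eq.trans ?_ (congrArg (· + 8 * _) (hw.sum_eq i))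
    rw [Finset.mul_sum, ← Finset.sum_add_distrib]
    refine Finset.sum_congr rfl fun y _ => ?_
    split_ifs <;> ring
  simp only [id, e, Finset.prod_const, Finset.card_univ, Fintype.card_fin] at h
  rw [div_pow]
  refine pr_le_of_ex_le hw (f := fun c => ∏ i, if P (c i) then (9 : ℝ) else 1)
    (fun c => Finset.prod_nonneg fun i _ => by split_ifs <;> norm_num) (by positivity)
    (h.trans_le (pow_le_pow_left₀ (by positivity) (by linarith) _)) fun c hc => ?_
  rw [Finset.prod_ite, Finset.prod_const, Finset.prod_const_one, mul_one,
    show (9 : ℝ) = 3 ^ 2 by norm_num, ← pow_mul]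
  exact pow_le_pow_right₀ (by norm_num) hc.le

open Classical in
/-- With high probability the samples avoid `Q`, meet each block outside `P`, and at least half of
them avoid `P`. -/
theorem pr_not_samplesTypical_le {Y : Finset (Fin n)} {P Q : Fin n → Prop} (hn : 0 < n) (hk : 0 < k)
    (hQ : (#{y ∈ Y | Q y} : ℝ) ≤ #Y / √n)
    (hP : ∀ i, (#{y ∈ blockIn β Y i | P y} : ℝ) ≤ #(blockIn β Y i) / 8)
    (hY : ∀ i, (n / (8 * k) : ℝ) ≤ #(blockIn β Y i)) :
    pr (uniformWeight m Y) (fun c => ¬ ((∀ i, c i ∈ Y) ∧ (∀ i, ¬ Q (c i)) ∧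
      (∀ j, ∃ i, β (c i) = j ∧ ¬ P (c i)) ∧ m ≤ 2 * #{i | ¬ P (c i)})) ≤
      m / √n + k * (1 - 7 / (64 * k)) ^ m + (2 / 3) ^ m := by
  have hn0 : (0 : ℝ) < n := by exact_mod_cast hn
  have hk0 : (0 : ℝ) < k := by exact_mod_cast hk
  have hY0 : 0 < #Y := by
    have h2 : (0 : ℝ) < #(blockIn β Y ⟨0, hk⟩) := lt_of_lt_of_le (by positivity) (hY ⟨0, hk⟩)
    exact (Nat.cast_pos.1 h2).trans_le (Finset.card_le_card (Finset.filter_subset _ _))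
  have hYr : (0 : ℝ) < #Y := by exact_mod_cast hY0
  have hw := isWeight_uniformWeight (m := m) hY0
  have hYn : (#Y : ℝ) ≤ n := by
    have := Finset.card_le_univ Y
    rw [Fintype.card_fin] at this
    exact_mod_cast this
  have p1 : pr (uniformWeight m Y) (fun c => ∃ i ∈ Finset.univ, c i ∉ Y) ≤ 0 := by
    refine (pr_exists_le hw _ _).trans (Finset.sum_nonpos fun i _ => ?_)
    rw [pr_coord hw i fun y => y ∉ Y]
    refine Finset.sum_nonpos fun y _ => ?_
    by_cases h : y ∈ Y <;> simp [uniformWeight, h]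
  have p2 : pr (uniformWeight m Y) (fun c => ∃ i ∈ Finset.univ, Q (c i)) ≤ m / √n := by
    refine (pr_exists_le hw _ _).trans ((Finset.sum_le_sum (g := fun _ => 1 / √(n : ℝ))
      fun i _ => ?_).trans_eq ?_)
    · rw [pr_coord hw i Q, sum_uniformWeight, div_le_iff₀ hYr]
      refine hQ.trans_eq ?_
      ring
    · rw [Finset.sum_const, Finset.card_univ, Fintype.card_fin, nsmul_eq_mul]; ring
  have p3 : pr (uniformWeight m Y) (fun c => ∃ j ∈ Finset.univ, ∀ i, ¬ (β (c i) = j ∧ ¬ P (c i))) ≤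
      k * (1 - 7 / (64 * k)) ^ m := by
    refine (pr_exists_le hw _ _).trans ((Finset.sum_le_sum
      (g := fun _ => (1 - 7 / (64 * k) : ℝ) ^ m) fun j _ => ?_).trans_eq ?_)
    · refine pr_forall_not_le hY0 (fun y => β y = j ∧ ¬ P y) ?_
      have h1 : ({y ∈ Y | β y = j ∧ ¬ P y} : Finset (Fin n)) = {y ∈ blockIn β Y j | ¬ P y} := by
        rw [blockIn, Finset.filter_filter]
      have h2 : (#{y ∈ blockIn β Y j | P y} : ℝ) + #{y ∈ blockIn β Y j | ¬ P y} =
          #(blockIn β Y j) := by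
        exact_mod_cast Finset.card_filter_add_card_filter_not (s := blockIn β Y j) P
      have h3 := hP j
      have h4 := hY j
      have h5 : (7 / (64 * k) * n : ℝ) = 7 / 8 * (n / (8 * k)) := by field_simp; norm_num
      have h6 : 7 / (64 * k) ≤ (#{y ∈ Y | β y = j ∧ ¬ P y} : ℝ) / #Y := by
        rw [le_div_iff₀ hYr, h1]
        have : (7 / (64 * k) * #Y : ℝ) ≤ 7 / (64 * k) * n := by gcongr
        linarith
      convert h6
    · rw [Finset.sum_const, Finset.card_univ, Fintype.card_fin, nsmul_eq_mul]
  have p4 : pr (uniformWeight m Y) (fun c => m < 2 * #{i | P (c i)}) ≤ (2 / 3) ^ m := by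
    refine pr_half_le hY0 P ?_
    rw [div_le_iff₀ hYr]
    have e1 : (#Y : ℝ) = ∑ j, (#(blockIn β Y j) : ℝ) := by exact_mod_cast (sum_card_blockIn β Y).symm
    have e2 : (#{y ∈ Y | P y} : ℝ) = ∑ j, (#{y ∈ blockIn β Y j | P y} : ℝ) := by
      have := sum_card_blockIn β ({y ∈ Y | P y} : Finset (Fin n))
      rw [← this]
      push_cast
      refine Finset.sum_congr rfl fun j _ => ?_
      rw [blockIn, blockIn, Finset.filter_comm]
    rw [e1, e2, Finset.mul_sum]
    refine Finset.sum_le_sum fun j _ => (hP j).trans_eq (by ring)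
  have hor := (pr_or_le hw _ _).trans (add_le_add ((pr_or_le hw _ _).trans (add_le_add
    ((pr_or_le hw _ _).trans (add_le_add p1 p2)) p3)) p4)
  rw [zero_add] at hor
  refine le_trans (pr_mono hw fun c hc => ?_) hor
  by_contra hcon
  simp only [not_or, not_exists, not_and, not_not, not_lt, not_forall, Finset.mem_univ,
    forall_true_left] at hcon
  obtain ⟨⟨⟨h1, h2⟩, h3⟩, h4⟩ := hcon
  refine hc ⟨h1, h2, fun j => ?_, ?_⟩
  · obtain ⟨i, hi, hi'⟩ := h3 j
    exact ⟨i, hi, hi'⟩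
  · have h5 := Finset.card_filter_add_card_filter_not (s := (Finset.univ : Finset (Fin m)))
      fun i => P (c i)
    rw [Finset.card_univ, Fintype.card_fin] at h5
    lia

theorem uniformOn_eq_ofReal_pr {Y : Finset (Fin n)} (hY : 0 < #Y) (T : Set (Fin m → Fin n)) :
    uniformOn {c : Fin m → Fin n | ∀ i, c i ∈ Y} T =
      ENNReal.ofReal (pr (uniformWeight m Y) (· ∈ T)) := by
  classical
  have hYr : (0 : ℝ) < #Y := by exact_mod_cast hY
  have h1 : {c : Fin m → Fin n | ∀ i, c i ∈ Y} = (Fintype.piFinset fun _ : Fin m => Y) := by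
    ext c; simp
  have h2 : T = ({c | c ∈ T} : Finset (Fin m → Fin n)) := by ext; simp
  rw [h1]
  conv_lhs => rw [h2]
  rw [uniformOn_apply_finset, Fintype.card_piFinset_const]
  have h3 : pr (uniformWeight m Y) (· ∈ T) =
      (#((Fintype.piFinset fun _ : Fin m => Y) ∩ ({c | c ∈ T} : Finset (Fin m → Fin n))) : ℝ) /
        ((#Y ^ m : ℕ) : ℝ) := by
    unfold pr ex
    have e : ∀ c : Fin m → Fin n, (∏ i, uniformWeight m Y i (c i)) * (if c ∈ T then (1 : ℝ) else 0) =
        (if c ∈ (Fintype.piFinset fun _ : Fin m => Y) ∩ ({c | c ∈ T} : Finset (Fin m → Fin n))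
          then 1 else 0) / ((#Y ^ m : ℕ) : ℝ) := by
      intro c
      by_cases hc : ∀ i, c i ∈ Y
      · have : ∏ i, uniformWeight m Y i (c i) = 1 / (#Y : ℝ) ^ m := by
          have h4 : ∀ i, uniformWeight m Y i (c i) = 1 / (#Y : ℝ) := fun i => if_pos (hc i)
          simp [h4]
        rw [this]
        by_cases hT : c ∈ T <;> simp [hc, hT]
      · have h0 := hc
        push Not at hc
        obtain ⟨i, hi⟩ := hc
        rw [Finset.prod_eq_zero (Finset.mem_univ i) (if_neg hi)]
        simp [h0]
    simp only [e]
    rw [← Finset.sum_div, Finset.sum_boole, Finset.filter_univ_mem]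
  rw [h3, ENNReal.ofReal_div_of_pos (Nat.cast_pos.2 (pow_pos hY m)), ENNReal.ofReal_natCast, ENNReal.ofReal_natCast]

end Sampling

section Law

variable {n k : ℕ} {β : Fin n → Fin k} {a b : ℝ}

theorem coin_singleton {p : ℝ} (h0 : 0 ≤ p) (h1 : p ≤ 1) (x : Bool) :
    coin p {x} = ENNReal.ofReal (if x then p else 1 - p) := by
  have hp : Set.projIcc 0 1 zero_le_one p = ⟨p, h0, h1⟩ := Set.projIcc_of_mem zero_le_one ⟨h0, h1⟩
  rw [coin, hp]
  cases x
  · rw [bernoulliMeasure_apply_of_notMem_of_mem _ (measurableSet_singleton _) (by simp) rfl,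
      ENNReal.ofReal, if_neg (by simp)]
    congr 1
    rw [Real.toNNReal_of_nonneg (by linarith)]
    rfl
  · rw [bernoulliMeasure_apply_of_mem_of_notMem _ (measurableSet_singleton _) rfl (by simp),
      ENNReal.ofReal, if_pos rfl]
    congr 1
    rw [Real.toNNReal_of_nonneg h0]
    rfl

instance (p : ℝ) : IsProbabilityMeasure (coin p) := by
  unfold coin; infer_instance

theorem law_singleton (H : Params n k a b) (η : Sym2 (Fin n) → Bool × Bool)
    (ζ : Fin n → Bool × Bool) :
    law β a b {ofCoins η ζ} =
      ENNReal.ofReal ((∏ e, edgeWeight β a b e (η e)) * ∏ v, vertexWeight n v (ζ v)) := by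
  have h0 : ∀ e, 0 ≤ edgeProb β a b e := edgeProb_nonneg H
  have h1 : ∀ e, edgeProb β a b e ≤ 1 := edgeProb_le_one H
  have hs : ({ofCoins η ζ} : Set (Outcome n)) = {fun e => (η e).1} ×ˢ ({fun e => (η e).2} ×ˢ
      ({fun v => (ζ v).1} ×ˢ {fun v => (ζ v).2})) := by
    rw [Set.singleton_prod_singleton, Set.singleton_prod_singleton, Set.singleton_prod_singleton]
    rfl
  rw [hs, law, Measure.prod_prod, Measure.prod_prod, Measure.prod_prod, Measure.pi_singleton,
    Measure.pi_singleton, Measure.pi_singleton, Measure.pi_singleton]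
  have hhalf : ∀ x, coin (1 / 2) {x} = ENNReal.ofReal (1 / 2) := fun x => by
    rw [coin_singleton (by norm_num) (by norm_num)]
    split_ifs <;> norm_num
  have hw := isWeight_edgeWeight (β := β) H
  simp only [coin_singleton (h0 _) (h1 _), hhalf]
  rw [ENNReal.ofReal_mul (Finset.prod_nonneg fun e _ => hw.nonneg _ _),
    ENNReal.ofReal_prod_of_nonneg fun e _ => hw.nonneg _ _,
    ENNReal.ofReal_prod_of_nonneg fun e _ => isWeight_vertexWeight.nonneg _ _, ← mul_assoc,
    ← Finset.prod_mul_distrib, ← Finset.prod_mul_distrib]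
  congr 1
  · refine Finset.prod_congr rfl fun e _ => ?_
    rw [edgeWeight, ENNReal.ofReal_mul]
    split_ifs
    · exact h0 e
    · linarith [h1 e]
  · refine Finset.prod_congr rfl fun v _ => ?_
    rw [vertexWeight, ← ENNReal.ofReal_mul (by norm_num)]
    norm_num

/-- Outcomes are pairs of edge coins and vertex coins. -/
def coinsEquiv (n : ℕ) : ((Fin n → Bool × Bool) × (Sym2 (Fin n) → Bool × Bool)) ≃ Outcome n where
  toFun p := ofCoins p.2 p.1
  invFun ω := (fun v => (ω.2.2.1 v, ω.2.2.2 v), fun e => (ω.1 e, ω.2.1 e))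
  left_inv _ := rfl
  right_inv _ := rfl

theorem le_lintegral_law (H : Params n k a b) {u : Outcome n → ℝ≥0∞} {F : Outcome n → ℝ}
    (hF : ∀ ω, 0 ≤ F ω) (hu : ∀ ω, ENNReal.ofReal (F ω) ≤ u ω) :
    ENNReal.ofReal (ex (vertexWeight n) fun ζ => ex (edgeWeight β a b) fun η => F (ofCoins η ζ)) ≤
      ∫⁻ ω, u ω ∂(law β a b) := by
  have hw := isWeight_edgeWeight (β := β) H
  have hv := isWeight_vertexWeight (n := n)
  rw [lintegral_fintype, ← (coinsEquiv n).sum_comp, Fintype.sum_prod_type, ex,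
    ENNReal.ofReal_sum_of_nonneg fun ζ _ => mul_nonneg (Finset.prod_nonneg fun _ _ => hv.nonneg _ _)
      (ex_nonneg hw fun _ => hF _)]
  refine Finset.sum_le_sum fun ζ _ => ?_
  rw [ex, Finset.mul_sum, ENNReal.ofReal_sum_of_nonneg fun η _ =>
    mul_nonneg (Finset.prod_nonneg fun _ _ => hv.nonneg _ _)
      (mul_nonneg (Finset.prod_nonneg fun _ _ => hw.nonneg _ _) (hF _))]
  refine Finset.sum_le_sum fun η _ => ?_
  change _ ≤ u (ofCoins η ζ) * law β a b {ofCoins η ζ}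
  rw [law_singleton H, show (∏ i, vertexWeight n i (ζ i)) *
    ((∏ i, edgeWeight β a b i (η i)) * F (ofCoins η ζ)) = F (ofCoins η ζ) *
      ((∏ e, edgeWeight β a b e (η e)) * ∏ v, vertexWeight n v (ζ v)) by ring,
    ENNReal.ofReal_mul (hF _)]
  gcongr
  exact hu _

end Law

section Success

open Filter Topology

variable {n k : ℕ} {β : Fin n → Fin k} {a b γ : ℝ}

theorem one_sub_pr_not_le {ι κ : Type*} [Fintype ι] [DecidableEq ι] [Fintype κ] {w : ι → κ → ℝ}
    (hw : IsWeight w) (P : (ι → κ) → Prop) : 1 - pr w (fun ω => ¬ P ω) ≤ pr w P := by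
  classical
  rw [sub_le_iff_le_add, ← ex_const hw 1, pr, pr, ← ex_add]
  refine ex_mono hw fun ω => ?_
  by_cases h : P ω <;> simp [h]

/-- Bound for the failure probability caused by the vertex and edge coins. -/
noncomputable def coinsError (n k : ℕ) (γ : ℝ) : ℝ :=
  12 * 10 ^ 6 * k ^ 2 / (γ ^ 2 * n) + 15 * k ^ 2 / (γ * √n)

/-- Bound for the failure probability caused by the samples. -/
noncomputable def samplesError (n k : ℕ) : ℝ :=
  numSamples n / √n + k * (1 - 7 / (64 * k)) ^ numSamples n + (2 / 3) ^ numSamples n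

theorem le_successProb (H : Params n k a b) (hβ : EqualBlocks β) (hγ : 0 < γ) (hγ1 : γ ≤ 1)
    (hC : 10 ^ 18 * (k : ℝ) ^ 2 * a ≤ γ * (a - b) ^ 2) (hnγ : 2000 * k / γ ≤ (n : ℝ))
    (hs : samplesError n k ≤ 1) :
    ENNReal.ofReal ((1 - samplesError n k) * (1 - coinsError n k γ)) ≤ successProb γ β a b := by
  classical
  have hw := isWeight_edgeWeight (β := β) H
  have hv := isWeight_vertexWeight (n := n)
  have hn : (0 : ℝ) < n := by exact_mod_cast H.n_pos
  let V : Outcome n → Prop := fun ω => VerticesTypical β γ ω.Z ω.Y₁ ω.Y₂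
  let E : Outcome n → Prop := fun ω => EdgesTypical β a b γ ω.Z ω.Y₁ ω.Y₂ (edgeCoins ω)
  let F : Outcome n → ℝ := fun ω => (1 - samplesError n k) * if V ω ∧ E ω then 1 else 0
  have hF : ∀ ω, 0 ≤ F ω := fun ω => mul_nonneg (by linarith) (by split_ifs <;> norm_num)
  refine le_trans (ENNReal.ofReal_le_ofReal ?_) (le_lintegral_law H hF fun ω => ?_)
  · simp only [F, ex_const_mul]
    refine mul_le_mul_of_nonneg_left ?_ (by linarith)
    let η₀ : Sym2 (Fin n) → Bool × Bool := fun _ => (true, true)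
    have h1 := pr_not_verticesTypical_le hβ H.k_pos H.n_pos hγ hγ1 η₀
    have h2 : ∀ ζ, (1 - 15 * k ^ 2 / (γ * √n)) +
        (-1) * (if ¬ V (ofCoins η₀ ζ) then (1 : ℝ) else 0) ≤
        ex (edgeWeight β a b) fun η => if V (ofCoins η ζ) ∧ E (ofCoins η ζ) then 1 else 0 := by
      intro ζ
      by_cases hV : V (ofCoins η₀ ζ)
      · have h3 := pr_not_edgesTypical_le H hβ hγ hγ1 hC (disjoint_Z_Y₁ (ofCoins η₀ ζ))
          (disjoint_Z_Y₂ (ofCoins η₀ ζ)) (disjoint_Y₁_Y₂ (ofCoins η₀ ζ)) hV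
        have h4 := one_sub_pr_not_le hw (EdgesTypical β a b γ (ofCoins η₀ ζ).Z (ofCoins η₀ ζ).Y₁
          (ofCoins η₀ ζ).Y₂)
        rw [if_neg (not_not.2 hV), mul_zero, add_zero]
        refine le_trans (by linarith) (h4.trans ?_)
        refine ex_mono hw fun η => ?_
        by_cases hE : EdgesTypical β a b γ (ofCoins η₀ ζ).Z (ofCoins η₀ ζ).Y₁ (ofCoins η₀ ζ).Y₂ η
        · rw [if_pos hE, if_pos (show V (ofCoins η ζ) ∧ E (ofCoins η ζ) from ⟨hV, hE⟩)]
        · rw [if_neg hE]; split_ifs <;> norm_num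
      · rw [if_pos hV]
        refine le_trans ?_ (ex_nonneg hw fun η => by split_ifs <;> norm_num)
        have : 0 ≤ 15 * k ^ 2 / (γ * √n) := by positivity
        linarith
    refine le_trans ?_ (ex_mono hv h2)
    rw [ex_add, ex_const hv, ex_const_mul]
    have h5 : (ex (vertexWeight n) fun ζ => if ¬ V (ofCoins η₀ ζ) then (1 : ℝ) else 0) ≤
        12 * 10 ^ 6 * k ^ 2 / (γ ^ 2 * n) := by
      refine le_trans (le_of_eq ?_) h1
      unfold pr
      congr!
    unfold coinsError
    linarith
  · by_cases hVE : V ω ∧ E ω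
    · obtain ⟨hV, hE⟩ := hVE
      have hY₂ : 0 < #ω.Y₂ := by
        have hk : (0 : ℝ) < k := by exact_mod_cast H.k_pos
        have h2 : (0 : ℝ) < #(blockIn β ω.Y₂ ⟨0, H.k_pos⟩) :=
          lt_of_lt_of_le (by positivity) (hV ⟨0, H.k_pos⟩).2.2
        exact (Nat.cast_pos.1 h2).trans_le (Finset.card_le_card (Finset.filter_subset _ _))
      have hu := isWeight_uniformWeight (m := numSamples n) hY₂
      rw [uniformOn_eq_ofReal_pr hY₂]
      refine ENNReal.ofReal_le_ofReal ?_
      simp only [F, if_pos (show V ω ∧ E ω from ⟨hV, hE⟩), mul_one]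
      obtain ⟨hE1, hE2, hE3, hE4, hE5⟩ := hE
      have h1 := pr_not_samplesTypical_le (m := numSamples n) H.n_pos H.k_pos hE5 hE4
        fun i => (hV i).2.2
      refine (sub_le_sub_left h1 1).trans ((one_sub_pr_not_le hu _).trans
        (pr_mono hu fun c hc => ?_))
      obtain ⟨hc1, hc2, hc3, hc4⟩ := hc
      refine succeeds_of_typical ω H hβ hγ hγ1 hC hnγ hE1 ?_ ?_ (fun i => (hV i).1)
        (fun i => (hV i).2.1) hc1 hc2 hc3 (fun i hi => (Finset.mem_filter.1 hi).2) hc4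
      · convert hE2
      · convert hE3
    · simp [F, hVE]

theorem tendsto_numSamples : Tendsto numSamples atTop atTop :=
  tendsto_nat_ceil_atTop.comp
    ((Real.tendsto_log_atTop.comp tendsto_natCast_atTop_atTop).const_mul_atTop two_pos)

theorem tendsto_sqrt_natCast : Tendsto (fun n : ℕ => √(n : ℝ)) atTop atTop :=
  Real.tendsto_sqrt_atTop.comp tendsto_natCast_atTop_atTop

theorem tendsto_numSamples_div_sqrt :
    Tendsto (fun n : ℕ => (numSamples n : ℝ) / √n) atTop (𝓝 0) := by
  have h1 : Tendsto (fun n : ℕ => Real.log n / √n) atTop (𝓝 0) := by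
    have h := (isLittleO_log_rpow_atTop (r := 1 / 2) (by norm_num)).tendsto_div_nhds_zero.comp
      tendsto_natCast_atTop_atTop
    refine h.congr fun n => ?_
    simp only [Function.comp, Real.sqrt_eq_rpow]
  have h2 : Tendsto (fun n : ℕ => 1 / √(n : ℝ)) atTop (𝓝 0) :=
    tendsto_sqrt_natCast.const_div_atTop 1
  have h3 : Tendsto (fun n : ℕ => 2 * (Real.log n / √n) + 1 / √(n : ℝ)) atTop (𝓝 0) := by
    simpa using (h1.const_mul 2).add h2
  refine squeeze_zero (fun n => by positivity) (fun n => ?_) h3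
  have h4 : (numSamples n : ℝ) ≤ 2 * Real.log n + 1 :=
    (Nat.ceil_lt_add_one (mul_nonneg zero_le_two (Real.log_natCast_nonneg n))).le
  calc (numSamples n : ℝ) / √n ≤ (2 * Real.log n + 1) / √n := by gcongr
    _ = _ := by ring

theorem tendsto_samplesError (hk : 0 < k) : Tendsto (fun n => samplesError n k) atTop (𝓝 0) := by
  have hk1 : (1 : ℝ) ≤ k := by exact_mod_cast hk
  have h1 : (7 / (64 * k) : ℝ) ≤ 7 / 64 := by
    rw [div_le_div_iff₀ (by positivity) (by norm_num)]; linarith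
  have h2 : (0 : ℝ) < 7 / (64 * k) := by positivity
  have h3 := (tendsto_pow_atTop_nhds_zero_of_lt_one (r := (1 - 7 / (64 * k) : ℝ)) (by linarith)
    (by linarith)).comp tendsto_numSamples
  have h4 := (tendsto_pow_atTop_nhds_zero_of_lt_one (r := (2 / 3 : ℝ)) (by norm_num)
    (by norm_num)).comp tendsto_numSamples
  simpa [samplesError] using (tendsto_numSamples_div_sqrt.add (h3.const_mul (k : ℝ))).add h4

theorem tendsto_coinsError (hγ : 0 < γ) : Tendsto (fun n => coinsError n k γ) atTop (𝓝 0) := by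
  have h1 : Tendsto (fun n : ℕ => 12 * 10 ^ 6 * (k : ℝ) ^ 2 / (γ ^ 2 * n)) atTop (𝓝 0) :=
    (tendsto_natCast_atTop_atTop.const_mul_atTop (by positivity)).const_div_atTop _
  have h2 : Tendsto (fun n : ℕ => 15 * (k : ℝ) ^ 2 / (γ * √n)) atTop (𝓝 0) :=
    (tendsto_sqrt_natCast.const_mul_atTop hγ).const_div_atTop _
  simpa [coinsError] using h1.add h2

theorem eventually_errors_small (hk : 0 < k) (hγ : 0 < γ) {ε : ℝ} (hε : 0 < ε) :
    ∀ᶠ n : ℕ in atTop, samplesError n k ≤ 1 ∧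
      1 - ε ≤ (1 - samplesError n k) * (1 - coinsError n k γ) := by
  have h1 := tendsto_samplesError hk
  have h2 : Tendsto (fun n => (1 - samplesError n k) * (1 - coinsError n k γ)) atTop (𝓝 1) := by
    simpa using (h1.const_sub 1).mul ((tendsto_coinsError (k := k) hγ).const_sub 1)
  filter_upwards [h1.eventually_le_const zero_lt_one, h2.eventually_const_le (sub_lt_self 1 hε)]
    with n h3 h4
  exact ⟨h3, h4⟩

end Success

end SBM

theorem theorem4p1 :
    ∃ C₁ C₂ : ℝ, 0 < C₁ ∧ 0 < C₂ ∧
      ∀ k : ℕ, 1 ≤ k → ∀ γ : ℝ, 0 < γ → γ ≤ 1 → ∀ ε : ℝ, 0 < ε →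
        ∃ N : ℕ, ∀ n : ℕ, N ≤ n → ∀ β : Fin n → Fin k, SBM.EqualBlocks β →
          ∀ a b : ℝ, C₁ ≤ b → b < a → a ≤ n → C₂ * (k : ℝ) ^ 2 * (1 / γ) ≤ (a - b) ^ 2 / a →
            ENNReal.ofReal (1 - ε) ≤ SBM.successProb γ β a b := by
  refine ⟨1, 10 ^ 18, one_pos, by positivity, fun k hk γ hγ hγ1 ε hε => ?_⟩
  obtain ⟨N, hN⟩ := Filter.eventually_atTop.1 ((SBM.eventually_errors_small hk hγ hε).and
    ((tendsto_natCast_atTop_atTop (R := ℝ)).eventually_ge_atTop (2000 * k / γ)))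
  refine ⟨max N 1, fun n hn β hβ a b hb hba han hC => ?_⟩
  obtain ⟨⟨hs, hε'⟩, hnγ⟩ := hN n (le_of_max_le_left hn)
  have ha : 0 < a := by linarith
  rw [le_div_iff₀ ha] at hC
  have hC' : 10 ^ 18 * (k : ℝ) ^ 2 * a ≤ γ * (a - b) ^ 2 := by
    have h := mul_le_mul_of_nonneg_left hC hγ.le
    rwa [show γ * (10 ^ 18 * (k : ℝ) ^ 2 * (1 / γ) * a) = 10 ^ 18 * (k : ℝ) ^ 2 * a by
      field_simp] at h
  have hka : (k : ℝ) ^ 2 ≤ a := by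
    have h1 : γ * (a - b) ^ 2 ≤ a * a := by
      have h2 : (a - b) ^ 2 ≤ a * a := by nlinarith
      nlinarith [sq_nonneg (a - b)]
    have h3 : 10 ^ 18 * (k : ℝ) ^ 2 ≤ a := le_of_mul_le_mul_right (hC'.trans h1) ha
    nlinarith [sq_nonneg (k : ℝ)]
  have H : SBM.Params n k a b := ⟨le_of_max_le_right hn, hk, by linarith, hba, han, hka⟩
  exact (ENNReal.ofReal_le_ofReal hε').trans (SBM.le_successProb H hβ hγ hγ1 hC' hnγ hs)
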